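/- **Theorem.** For a graph $G=(V,E)$ let $R_3(G)$ be the graph whose vertices are the proper $3$-colourings of $G$, two of them being adjacent if they differ on exactly one vertex of $G$. The problem *3-Colouring Reconfiguration* asks, given an $n$-vertex graph $G$ with $m$ edges, two proper $3$-colourings $\alpha,\beta$ of $G$ and a positive integer $\ell$, whether there is a path of length at most $\ell$ between $\alpha$ and $\beta$ in $R_3(G)$. (i) 3-Colouring Reconfiguration can be solved in time $O(n+m)$. Precisely: there are a program for a random access machine (unit cost per instruction; addition and truncated subtraction are the only arithmetic) and a constant $C$ such that, on each instance given by $n$, $\ell$, the colours of the vertices and the adjacency lists of $G$, the program stops with the correct answer after at most $C(n+m+1)$ steps, and all numbers occurring in the computation are at most $C\left((n+m+1)^2+\ell\right)$. Now let $G$ be finite and connected, let $T$ be a spanning tree of $G$, and let $\alpha,\beta$ be proper $3$-colourings of $G$. For a proper $3$-colouring $c$ and adjacent vertices $v,w$ let $w(c,\overrightarrow{vw})\in\{-1,1\}$ be congruent to $c(w)-c(v)$ modulo $3$. The weight of an oriented path is the sum of the weights of its edges. For $u,v\in V$ let $h_{\alpha,u}(c,v)=w(c,\overrightarrow{P_{uv}})-w(\alpha,\overrightarrow{P_{uv}})$,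 where $\overrightarrow{P_{uv}}$ is the path from $u$ to $v$ in $T$. A vertex $v$ is *fixed* with respect to $c$ if $c'(v)=c(v)$ for every $c'$ in the component of $c$ in $R_3(G)$; let $F^i_{G,c}$ be the set of the fixed vertices with respect to $c$ of colour $i$. (ii) For every $u\in V$, there is a path between $\alpha$ and $\beta$ in $R_3(G)$ if and only if - $F^i_{G,\alpha}=F^i_{G,\beta}$ for $i=1,2,3$; - $h_{\alpha,u}(\beta,v)-h_{\alpha,u}(\beta,w)+w(\beta,\overrightarrow{vw})=w(\alpha,\overrightarrow{vw})$ for every edge $vw\in E$; and - $h_{\alpha,u}(\beta,x)=h_{\alpha,u}(\beta,y)$ for all vertices $x,y$ that are fixed with respect to $\beta$. (iii) Let $u^*$ be a *focal* vertex of $\beta$: any fixed vertex with respect to $\beta$ if there is one, and otherwise a median vertex when the vertices are ordered by $h_{\alpha,u}(\beta,\cdot)$ for some $u\in V$. Let $k_1$ be the smallest non-negative and $k_2$ the largest non-positive integer congruent to $2(\alpha(u^*)-\beta(u^*))$ modulo $6$, and let $J(k)=\sum_{v\in V}|k+h_{\alpha,u^*}(\beta,v)|$. If $\alpha$ and $\beta$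 are in the same component of $R_3(G)$, then their distance in $R_3(G)$ is $\frac12\min\{J(k_1),J(k_2)\}$. -/

import Mathlib

open scoped BigOperators

/-! ### The reconfiguration graph -/

/-- The `k`-colouring reconfiguration graph `R_k(G)`: its vertices are the proper `k`-colourings
of `G`, and two of them are adjacent when they differ on exactly one vertex of `G`. -/
def reconfGraph {V : Type*} (G : SimpleGraph V) (k : ℕ) :
    SimpleGraph (G.Coloring (Fin k)) where
  Adj c d := ∃! v, c v ≠ d v
  symm := ⟨fun _ _ h => by simpa only [ne_comm] using h⟩
  loopless := ⟨fun _ h => by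
    obtain ⟨v, hv, -⟩ := h
    exact hv rfl⟩

/-- The question of `k`-Colouring Reconfiguration: is there a path of length at most `ℓ`
between `α` and `β` in `R_k(G)`? -/
def IsYesInstance {V : Type*} (G : SimpleGraph V) {k : ℕ} (α β : G.Coloring (Fin k))
    (ℓ : ℕ) : Prop :=
  ∃ p : (reconfGraph G k).Walk α β, p.IsPath ∧ p.length ≤ ℓ

/-! ### Fixed vertices, weights and heights -/

/-- The set of vertices that have the same colour in every colouring of the component of `c`
in `R_3(G)`. -/
def fixedVertices {V : Type*} {G : SimpleGraph V} (c : G.Coloring (Fin 3)) : Set V :=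
  {v | ∀ d, (reconfGraph G 3).Reachable c d → c v = d v}

/-- The fixed vertices with colour `i`. -/
def fixedVerticesOfColour {V : Type*} {G : SimpleGraph V} (c : G.Coloring (Fin 3))
    (i : Fin 3) : Set V :=
  {v ∈ fixedVertices c | c v = i}

/-- The weight of an edge oriented from `u` to `v`: the element of `{-1, 1}` that is congruent
to `c v - c u` modulo `3` (the subtraction in `Fin 3` is modulo `3`). -/
def edgeWeight {V : Type*} {G : SimpleGraph V} (c : G.Coloring (Fin 3)) (u v : V) : ℤ :=
  if c v - c u = 1 then 1 else -1

/-- The weight of an oriented path (or walk) is the sum of the weights of its edges. The walk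
lives in a graph `T` on the same vertices, in the applications a spanning tree of `G`. -/
def walkWeight {V : Type*} {G T : SimpleGraph V} (c : G.Coloring (Fin 3)) {u v : V}
    (p : T.Walk u v) : ℤ :=
  (p.darts.map fun e => edgeWeight c e.fst e.snd).sum

/-- The unique path from `u` to `v` in a tree. -/
noncomputable def treePath {V : Type*} {T : SimpleGraph V} (hT : T.IsTree) (u v : V) :
    T.Walk u v :=
  (hT.existsUnique_path u v).choose

/-- The relative height of `c, v` with respect to `α` and `u`, computed along a tree. -/
noncomputable def relHeight {V : Type*} {G T : SimpleGraph V} (hT : T.IsTree)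
    (α : G.Coloring (Fin 3)) (u : V) (c : G.Coloring (Fin 3)) (v : V) : ℤ :=
  walkWeight c (treePath hT u v) - walkWeight α (treePath hT u v)

/-- `x` is a median vertex when the vertices are ordered by the integers `f v`. -/
def IsMedianVertex {V : Type*} [Fintype V] (f : V → ℤ) (x : V) : Prop :=
  2 * (Finset.univ.filter fun v => f v < f x).card ≤ Fintype.card V ∧
    2 * (Finset.univ.filter fun v => f x < f v).card ≤ Fintype.card V

/-- A focal vertex of `β`: a fixed vertex with respect to `β` if there is one, and otherwise a
median vertex in the order given by the relative heights (from any vertex `u`). -/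
def IsFocal {V : Type*} [Fintype V] {G T : SimpleGraph V} (hT : T.IsTree)
    (α β : G.Coloring (Fin 3)) (x : V) : Prop :=
  x ∈ fixedVertices β ∨
    (fixedVertices β = ∅ ∧ ∃ u, IsMedianVertex (relHeight hT α u β) x)

/-- `J(k) = ∑ v, |k + h_{α,x}(β, v)|`. -/
noncomputable def heightSum {V : Type*} [Fintype V] {G T : SimpleGraph V} (hT : T.IsTree)
    (α β : G.Coloring (Fin 3)) (x : V) (k : ℤ) : ℤ :=
  ∑ v, |k + relHeight hT α x β v|

/-- The set of integers congruent to `2 (α x - β x)` modulo `6`. -/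
def targetHeights {V : Type*} {G : SimpleGraph V} (α β : G.Coloring (Fin 3)) (x : V) : Set ℤ :=
  {k | k ≡ 2 * (((α x : ℕ) : ℤ) - ((β x : ℕ) : ℤ)) [ZMOD 6]}

/-! ### A random access machine

There is a bank of registers and a memory, both holding natural numbers. Every instruction takes
one unit of time; the only arithmetic is addition and truncated subtraction. -/

/-- The instructions. -/
inductive Instr : Type
  /-- `r d := k` -/
  | const (d k : ℕ)
  /-- `r d := r a` -/
  | copy (d a : ℕ)
  /-- `r d := r a + r b` -/
  | add (d a b : ℕ)
  /-- `r d := r a - r b` (truncated at `0`) -/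
  | sub (d a b : ℕ)
  /-- `r d := memory (r a)` -/
  | load (d a : ℕ)
  /-- `memory (r a) := r b` -/
  | store (a b : ℕ)
  /-- go to instruction `t` -/
  | jump (t : ℕ)
  /-- go to instruction `t` if `r a < r b` -/
  | jumpLt (a b t : ℕ)
  /-- stop with the answer `b` -/
  | halt (b : Bool)

/-- A program is a finite list of instructions; it does not depend on the input. -/
abbrev Program : Type := List Instr

/-- A configuration of the machine. -/
structure Config : Type where
  /-- the index of the next instruction -/
  pc : ℕ
  /-- the registers -/
  regs : ℕ → ℕ
  /-- the memory -/
  mem : ℕ → ℕ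

/-- Write `x` into register `d` and go on to the next instruction. -/
def Config.write (s : Config) (d x : ℕ) : Config :=
  ⟨s.pc + 1, Function.update s.regs d x, s.mem⟩

/-- The effect of an instruction. -/
def Instr.exec (s : Config) : Instr → Config
  | .const d k => s.write d k
  | .copy d a => s.write d (s.regs a)
  | .add d a b => s.write d (s.regs a + s.regs b)
  | .sub d a b => s.write d (s.regs a - s.regs b)
  | .load d a => s.write d (s.mem (s.regs a))
  | .store a b => ⟨s.pc + 1, s.regs, Function.update s.mem (s.regs a) (s.regs b)⟩
  | .jump t => ⟨t, s.regs, s.mem⟩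
  | .jumpLt a b t => ⟨if s.regs a < s.regs b then t else s.pc + 1, s.regs, s.mem⟩
  | .halt _ => s

/-- One step of the machine; a configuration outside the program does not change any more. -/
def Program.step (P : Program) (s : Config) : Config :=
  match P[s.pc]? with
  | some i => i.exec s
  | none => s

/-- At the start all registers are `0`, and the memory holds the input, followed by zeros. -/
def Config.init (input : List ℕ) : Config :=
  ⟨0, fun _ => 0, fun a => input.getD a 0⟩

/-- The configuration after `t` steps on the given input. -/
def Program.configAt (P : Program) (input : List ℕ) (t : ℕ) : Config :=
  P.step^[t] (Config.init input)

/-- The machine has stopped within `t` steps with the answer `b`. -/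
def Program.HaltsWith (P : Program) (input : List ℕ) (t : ℕ) (b : Bool) : Prop :=
  P[(P.configAt input t).pc]? = some (Instr.halt b)

/-- All numbers that occur during the computation are at most `B`. -/
def Program.WordsBounded (P : Program) (input : List ℕ) (B : ℕ) : Prop :=
  ∀ t a, (P.configAt input t).regs a ≤ B ∧ (P.configAt input t).mem a ≤ B

/-! ### Instances as inputs of the machine -/

/-- Adjacency lists of a graph, each in an arbitrary order. -/
structure AdjLists {n : ℕ} (G : SimpleGraph (Fin n)) : Type where
  /-- the list of the neighbours of a vertex -/
  nbrs : Fin n → List (Fin n)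
  nodup : ∀ v, (nbrs v).Nodup
  mem_nbrs : ∀ v w, w ∈ nbrs v ↔ G.Adj v w

/-- The total length of the lists of the vertices before `i`. -/
def AdjLists.offset {n : ℕ} {G : SimpleGraph (Fin n)} (A : AdjLists G) (i : ℕ) : ℕ :=
  ∑ v : Fin n with v.val < i, (A.nbrs v).length

/-- The input: `n`, `ℓ`, the colours of the vertices in `α`, those in `β`, then the adjacency
lists, written one after the other and preceded by the `n + 1` offsets at which they start
and end. -/
def encodeInstance {n : ℕ} {G : SimpleGraph (Fin n)} (A : AdjLists G) {k : ℕ}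
    (α β : G.Coloring (Fin k)) (ℓ : ℕ) : List ℕ :=
  [n, ℓ] ++ (List.finRange n).map (fun v => (α v).val)
    ++ (List.finRange n).map (fun v => (β v).val)
    ++ (List.range (n + 1)).map A.offset
    ++ (List.finRange n).flatMap (fun v => (A.nbrs v).map Fin.val)

set_option linter.constructorNameAsVariable false
set_option linter.unusedSimpArgs false

/-! ### Shifts between two colourings -/

section Shift

variable {V : Type*} {G : SimpleGraph V}

/-! Everything rests on integer lifts of recolouring sequences. A shift E from α to β (`IsShift`)
records for each vertex the net number of colour decreases modulo 3: E v ≡ α v - β v modulo 3, and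
on each edge twice the increment of E is the difference of the edge weights. When one vertex x is
recoloured, all its neighbours have the third colour, so all weights at x change in the same way and
the move has the shift ±1 at x and 0 elsewhere. Adding these up, every walk in R_3(G) gives a shift
that vanishes on the fixed vertices and whose sum of absolute values is at most the length
(`exists_isShift_of_walk`).

Conversely, a shift that vanishes on the frozen vertices of α is realised by a walk of length
exactly the sum of |E v| (`exists_walk_of_isShift`). Among the vertices where E is extreme, say
largest and positive, each x wants its colour decreased. A neighbour that already has the wanted
colour has E at least as large, so it is extreme too. If every extreme vertex were blocked like
this, following the blocking neighbours would close up into a frozen cycle, on which E vanishes. So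
some extreme vertex can be recoloured, and the sum drops by one (`exists_adj_isShift`). Hence the
distance is the least sum of |E v| over these shifts.

In a connected graph the heights satisfy h_u(v) = 2 (E v - E u), so E is determined up to a constant
multiple of 3. The conditions of (ii) say exactly that such an E exists and can be normalised to
vanish on the fixed vertices. For (iii), J(2 E(x)) = 2 ∑ |E v| for the focal vertex x. A fixed x
forces E x = 0; otherwise x is a median and J does not decrease away from 0 on either side, so the
targets nearest to 0 suffice (`sum_abs_add_le_of_median`, `dist_eq`).

For (i), the criterion `isYesInstance_iff` needs no connectedness and is additive over components.
The frozen vertices are what remains after repeatedly peeling off vertices that lack a neighbour of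
some other colour. A search of each component finds "levels", which are E up to a constant, or an
inconsistent edge. A histogram of the levels then allows one to sweep over all constants divisible
by 3 and to read off the least cost that makes the frozen vertices zero. All of this is linear in n
+ m, and the costs are at most quadratic in n apart from ℓ.

The algorithm is written in a small structured language with a clock. It is verified by weakest
preconditions and loop invariants that bound the clock, and the compiler to the random access
machine is proved correct with a constant number of machine steps per clock tick (`Cmd.run_code`).
-/

theorem edgeWeight_cases (c : G.Coloring (Fin 3)) {u v : V} (h : G.Adj u v) :
    (edgeWeight c u v = 1 ∧ ((c v : ℕ) = c u + 1 ∨ (c u : ℕ) = c v + 2)) ∨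
      (edgeWeight c u v = -1 ∧ ((c u : ℕ) = c v + 1 ∨ (c v : ℕ) = c u + 2)) := by
  have hne := c.valid h
  unfold edgeWeight
  generalize c u = x at *
  generalize c v = y at *
  revert x y
  decide

/-- `E v` counts how often the colour of `v` is decreased (modulo `3`) on the way from `α` to
`β`, increases being counted negatively. -/
def IsShift (α β : G.Coloring (Fin 3)) (E : V → ℤ) : Prop :=
  (∀ v, (3 : ℤ) ∣ E v - ((α v : ℕ) - (β v : ℕ))) ∧
    ∀ v w, G.Adj v w → 2 * (E w - E v) = edgeWeight β v w - edgeWeight α v w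

theorem IsShift.zero (α : G.Coloring (Fin 3)) : IsShift α α 0 :=
  ⟨fun v => by simp, fun v w _ => by simp⟩

theorem IsShift.trans {α β γ : G.Coloring (Fin 3)} {E F : V → ℤ} (h : IsShift α β E)
    (h' : IsShift β γ F) : IsShift α γ (E + F) := by
  refine ⟨fun v => ?_, fun v w hvw => ?_⟩
  · have h1 := h.1 v
    have h2 := h'.1 v
    simp only [Pi.add_apply]
    omega
  · have h1 := h.2 v w hvw
    have h2 := h'.2 v w hvw
    simp only [Pi.add_apply]
    omega

theorem IsShift.neg {α β : G.Coloring (Fin 3)} {E : V → ℤ} (h : IsShift α β E) :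
    IsShift β α (-E) := by
  refine ⟨fun v => ?_, fun v w hvw => ?_⟩
  · have h1 := h.1 v
    simp only [Pi.neg_apply]
    omega
  · have h1 := h.2 v w hvw
    simp only [Pi.neg_apply]
    omega

theorem IsShift.eq_of_zero {α β : G.Coloring (Fin 3)} (h : IsShift α β 0) : α = β := by
  ext v
  have h1 := h.1 v
  have h2 := (α v).isLt
  have h3 := (β v).isLt
  simp only [Pi.zero_apply] at h1
  omega

-- The old and the new colour of x are both absent from its neighbourhood, so all neighbours share
-- the third colour and every edge at x changes its weight consistently with a single value ±1.
open Classical in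
theorem exists_isShift_of_adj {α β : G.Coloring (Fin 3)} (h : (reconfGraph G 3).Adj α β) :
    ∃ x, α x ≠ β x ∧ (∀ v, v ≠ x → α v = β v) ∧
      ∃ s : ℤ, (s = 1 ∨ s = -1) ∧ IsShift α β (Pi.single x s) := by
  obtain ⟨x, hx, hu⟩ := h
  have heq : ∀ v, v ≠ x → α v = β v := fun v hv => by
    by_contra hc
    exact hv (hu v hc)
  refine ⟨x, hx, heq, ?_⟩
  have hx' : (α x : ℕ) ≠ β x := fun hc => hx (Fin.ext hc)
  have ha := (α x).isLt
  have hb := (β x).isLt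
  -- The two colours of x differ, so their difference is 1 or -1 modulo 3.
  obtain ⟨s, hs, hd⟩ : ∃ s : ℤ, (s = 1 ∨ s = -1) ∧ (3 : ℤ) ∣ s - ((α x : ℕ) - (β x : ℕ)) := by
    by_cases h1 : (3 : ℤ) ∣ 1 - ((α x : ℕ) - (β x : ℕ))
    · exact ⟨1, Or.inl rfl, h1⟩
    · exact ⟨-1, Or.inr rfl, by omega⟩
  refine ⟨s, hs, fun v => ?_, fun v w hvw => ?_⟩
  · by_cases hv : v = x
    · subst hv
      simpa using hd
    · simp [hv, heq v hv]
  · have e1 := edgeWeight_cases α hvw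
    have e2 := edgeWeight_cases β hvw
    by_cases hv : v = x
    · subst hv
      have hw : w ≠ v := hvw.ne'
      have e3 : (α w : ℕ) = β w := by rw [heq w hw]
      have := (α w).isLt
      simp only [Pi.single_eq_same, Pi.single_eq_of_ne hw]
      omega
    · by_cases hw : w = x
      · subst hw
        have e3 : (α v : ℕ) = β v := by rw [heq v hv]
        have := (α v).isLt
        simp only [Pi.single_eq_same, Pi.single_eq_of_ne hv]
        omega
      · have e3 : (α v : ℕ) = β v := by rw [heq v hv]
        have e4 : (α w : ℕ) = β w := by rw [heq w hw]
        simp only [Pi.single_eq_of_ne hv, Pi.single_eq_of_ne hw]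
        omega

/-! ### Fixed and frozen vertices -/

theorem fixedVertices_eq_of_reachable {c d : G.Coloring (Fin 3)}
    (h : (reconfGraph G 3).Reachable c d) : fixedVertices c = fixedVertices d := by
  have key : ∀ c d : G.Coloring (Fin 3), (reconfGraph G 3).Reachable c d →
      fixedVertices c ⊆ fixedVertices d := by
    intro c d h v hv e he
    rw [← hv d h, hv e (h.trans he)]
  exact (key c d h).antisymm (key d c h.symm)

/-- Each vertex of a frozen set has neighbours of both other colours in the set. -/
def IsFrozenSet (c : G.Coloring (Fin 3)) (K : Set V) : Prop :=
  ∀ v ∈ K, ∀ i, i ≠ c v → ∃ w ∈ K, G.Adj v w ∧ c w = i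

/-- The vertices of the frozen sets. -/
def frozenVertices (c : G.Coloring (Fin 3)) : Set V :=
  {v | ∃ K, IsFrozenSet c K ∧ v ∈ K}

/-- If v in the set changed, some neighbour of v would already have its new colour; that neighbour
keeps it, since only one vertex changes, and the new colouring would not be proper. -/
theorem IsFrozenSet.eq_of_adj {c d : G.Coloring (Fin 3)} (h : (reconfGraph G 3).Adj c d)
    {K : Set V} (hK : IsFrozenSet c K) : ∀ v ∈ K, c v = d v := by
  obtain ⟨x, hx, hu⟩ := h
  intro v hv
  by_contra hne
  obtain ⟨w, hw, hvw, hcw⟩ := hK v hv (d v) (Ne.symm hne)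
  have hwx : c w = d w := by
    by_contra hc
    exact hvw.ne ((hu v hne).trans (hu w hc).symm)
  exact d.valid hvw (hcw.symm.trans hwx)

theorem IsFrozenSet.of_adj {c d : G.Coloring (Fin 3)} (h : (reconfGraph G 3).Adj c d)
    {K : Set V} (hK : IsFrozenSet c K) : IsFrozenSet d K := by
  have heq := hK.eq_of_adj h
  intro v hv i hi
  obtain ⟨w, hw, hvw, hcw⟩ := hK v hv i (by rwa [heq v hv])
  exact ⟨w, hw, hvw, by rw [← heq w hw, hcw]⟩

theorem frozenVertices_eq_of_adj {c d : G.Coloring (Fin 3)} (h : (reconfGraph G 3).Adj c d) :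
    frozenVertices c = frozenVertices d := by
  ext v
  exact ⟨fun ⟨K, hK, hv⟩ => ⟨K, hK.of_adj h, hv⟩, fun ⟨K, hK, hv⟩ => ⟨K, hK.of_adj h.symm, hv⟩⟩

theorem IsFrozenSet.eq_of_walk {c d : G.Coloring (Fin 3)} (p : (reconfGraph G 3).Walk c d)
    {K : Set V} (hK : IsFrozenSet c K) : ∀ v ∈ K, c v = d v := by
  induction p with
  | nil => exact fun _ _ => rfl
  | cons h p ih => exact fun v hv => (hK.eq_of_adj h v hv).trans (ih (hK.of_adj h) v hv)

/-- The reverse inclusion is never needed directly: walks are constructed under the weaker demand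
that E vanishes on frozen vertices, while walks yield the stronger conclusion that E vanishes on
fixed vertices. -/
theorem frozenVertices_subset_fixedVertices (c : G.Coloring (Fin 3)) :
    frozenVertices c ⊆ fixedVertices c := by
  rintro v ⟨K, hK, hv⟩ d ⟨p⟩
  exact hK.eq_of_walk p v hv

/-! ### Walks and shifts -/

/-- The unit shifts of the moves are added. No move of the walk touches a fixed vertex, and the
bound is the triangle inequality; it is strict when some vertex moves back and forth. -/
theorem exists_isShift_of_walk [Fintype V] {α β : G.Coloring (Fin 3)}
    (p : (reconfGraph G 3).Walk α β) :
    ∃ E, IsShift α β E ∧ (∀ x ∈ fixedVertices α, E x = 0) ∧ ∑ v, |E v| ≤ p.length := by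
  classical
  induction p with
  | nil => exact ⟨0, IsShift.zero _, fun _ _ => rfl, by simp⟩
  | @cons a b c h p ih =>
    obtain ⟨E, hE, hf, hs⟩ := ih
    obtain ⟨x, hx, -, s, hs1, hS⟩ := exists_isShift_of_adj h
    refine ⟨_, hS.trans hE, fun y hy => ?_, ?_⟩
    · have hyx : y ≠ x := by
        rintro rfl
        exact hx (hy b h.reachable)
      rw [fixedVertices_eq_of_reachable h.reachable] at hy
      simp [hyx, hf y hy]
    · have h1 : ∑ v, |(Pi.single x s : V → ℤ) v| = 1 := by
        rw [Finset.sum_eq_single x]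
        · rcases hs1 with rfl | rfl <;> simp
        · intro b _ hb
          simp [hb]
        · simp
      have h2 : ∑ v, |((Pi.single x s : V → ℤ) + E) v| ≤
          ∑ v, |(Pi.single x s : V → ℤ) v| + ∑ v, |E v| := by
        rw [← Finset.sum_add_distrib]
        exact Finset.sum_le_sum fun v _ => abs_add_le _ _
      rw [SimpleGraph.Walk.length_cons]
      push_cast
      linarith

/-- A finite set in which every vertex has a neighbour whose colour is larger by `i` contains a
frozen set. -/
theorem exists_frozen_of_forall_exists [Finite V] (c : G.Coloring (Fin 3)) (i : Fin 3)
    (hi : i ≠ 0) (K : Set V) (hne : K.Nonempty)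
    (hK : ∀ v ∈ K, ∃ w ∈ K, G.Adj v w ∧ c w = c v + i) : ∃ v ∈ K, v ∈ frozenVertices c := by
  choose! f hf hadj hcol using hK
  -- A minimal nonempty subset closed under the successor map f is a cycle of f.
  obtain ⟨S, hS⟩ := Set.Finite.exists_minimal
    (s := {S : Set V | S.Nonempty ∧ S ⊆ K ∧ ∀ v ∈ S, f v ∈ S}) (Set.toFinite _)
    ⟨K, hne, subset_rfl, hf⟩
  obtain ⟨⟨v, hv⟩, hSK, hfS⟩ := hS.prop
  have hsurj : ∀ v ∈ S, ∃ u ∈ S, f u = v := by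
    -- The image of S is again nonempty and closed under f, so by minimality f maps S onto S and
    -- every vertex has a predecessor.
    have h1 : S ⊆ f '' S := hS.2 (y := f '' S)
      ⟨⟨f v, v, hv, rfl⟩, fun y ⟨u, hu, hy⟩ => hy ▸ hSK (hfS u hu),
        fun y ⟨u, hu, hy⟩ => ⟨y, hy ▸ hfS u hu, rfl⟩⟩ (fun y ⟨u, hu, hy⟩ => hy ▸ hfS u hu)
    exact fun v hv => h1 hv
  refine ⟨v, hSK hv, S, fun x hx j hj => ?_, hv⟩
  -- The two colours other than a are a + i, found at the successor, and a - i, found at the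
  -- predecessor.
  have key : ∀ a j i : Fin 3, i ≠ 0 → j ≠ a → j = a + i ∨ a = j + i := by decide
  rcases key (c x) j i hi hj with h | h
  · exact ⟨f x, hfS x hx, hadj x (hSK hx), by rw [hcol x (hSK hx), h]⟩
  · obtain ⟨u, hu, rfl⟩ := hsurj x hx
    refine ⟨u, hu, (hadj u (hSK hu)).symm, ?_⟩
    rw [hcol u (hSK hu)] at h
    exact add_right_cancel h

-- One step of the descent: some vertex where |E| is extreme is free to move towards its final
-- colour, and moving it lowers the total displacement by exactly one.
open Classical in
theorem exists_adj_isShift [Fintype V] {α β : G.Coloring (Fin 3)} {E : V → ℤ}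
    (hE : IsShift α β E) (hf : ∀ x ∈ frozenVertices α, E x = 0) (hne : E ≠ 0) :
    ∃ (γ : G.Coloring (Fin 3)) (F : V → ℤ), (reconfGraph G 3).Adj α γ ∧ IsShift γ β F ∧
      (∀ x ∈ frozenVertices γ, F x = 0) ∧ ∑ v, |E v| = ∑ v, |F v| + 1 := by
  obtain ⟨v₀, hv₀⟩ := Function.ne_iff.1 hne
  -- The sign σ reduces the case of negative values to that of positive ones. A positive shift asks
  -- for colour decreases, that is for adding 2 modulo 3; a negative one asks for adding 1.
  obtain ⟨σ, i, hσ, hpos⟩ : ∃ (σ : ℤ) (i : Fin 3), ((σ = 1 ∧ i = 2) ∨ (σ = -1 ∧ i = 1)) ∧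
      0 < σ * E v₀ := by
    rcases lt_or_gt_of_ne hv₀ with h | h
    · exact ⟨-1, 1, Or.inr ⟨rfl, rfl⟩, by simpa using h⟩
    · exact ⟨1, 2, Or.inl ⟨rfl, rfl⟩, by simpa using h⟩
  have hi : i ≠ 0 := by rcases hσ with ⟨-, rfl⟩ | ⟨-, rfl⟩ <;> decide
  have : Nonempty V := ⟨v₀⟩
  obtain ⟨m, hm⟩ := Finite.exists_max (fun v => σ * E v)
  set K : Set V := {v | σ * E v = σ * E m}
  have hmpos : 0 < σ * E m := hpos.trans_le (hm v₀)
  -- If all maximisers blocked one another, there would be a frozen vertex among them, where E is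
  -- zero and not maximal.
  have hnot : ¬ ∀ v ∈ K, ∃ w ∈ K, G.Adj v w ∧ α w = α v + i := by
    intro hK
    obtain ⟨v, hv, hvf⟩ := exists_frozen_of_forall_exists α i hi K ⟨m, rfl⟩ hK
    have hv' : σ * E v = σ * E m := hv
    rw [hf v hvf] at hv'
    omega
  push Not at hnot
  obtain ⟨x, hx, hxw⟩ := hnot
  have hxm : σ * E x = σ * E m := hx
  -- A neighbour w with the wanted colour has an extremal weight under α on the edge xw, so the edge
  -- condition gives σ E w ≥ σ E x. Then w is a maximiser too, which was excluded by the choice of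
  -- x.
  have hcol : ∀ w, G.Adj x w → α w ≠ α x + i := by
    intro w hw hc
    refine hxw w ?_ hw hc
    have h1 := hE.2 x w hw
    have h2 := edgeWeight_cases α hw
    have h3 := edgeWeight_cases β hw
    have h4 := hm w
    have h5 := congrArg Fin.val hc
    have h6 := (α x).isLt
    change σ * E w = σ * E m
    rcases hσ with ⟨rfl, rfl⟩ | ⟨rfl, rfl⟩
    · simp only [Fin.val_add, Fin.val_two] at h5
      omega
    · simp only [Fin.val_add, Fin.val_one] at h5
      omega
  let γ : G.Coloring (Fin 3) := SimpleGraph.Coloring.mk (Function.update α x (α x + i)) (by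
    intro v w hvw
    by_cases hv : v = x
    · subst hv
      rw [Function.update_self, Function.update_of_ne hvw.ne']
      exact (hcol w hvw).symm
    · by_cases hw : w = x
      · subst hw
        rw [Function.update_self, Function.update_of_ne hvw.ne]
        exact hcol v hvw.symm
      · rw [Function.update_of_ne hv, Function.update_of_ne hw]
        exact α.valid hvw)
  have hγx : γ x = α x + i := Function.update_self x _ α
  have hγ : ∀ v, v ≠ x → γ v = α v := fun v hv => Function.update_of_ne hv _ α
  have hadj : (reconfGraph G 3).Adj α γ := by
    refine ⟨x, ?_, fun y hy => ?_⟩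
    · change α x ≠ γ x
      rw [hγx]
      intro h
      exact hi (left_eq_add.1 h)
    · by_contra hyx
      exact hy (hγ y hyx).symm
  obtain ⟨y, hy, -, s, hs, hS⟩ := exists_isShift_of_adj hadj
  obtain rfl : y = x := by
    by_contra hc
    exact hy (hγ y hc).symm
  have hsσ : s = σ := by
    have h1 := hS.1 y
    have h6 := (α y).isLt
    have h5 := congrArg Fin.val hγx
    rw [Pi.single_eq_same] at h1
    rcases hσ with ⟨rfl, rfl⟩ | ⟨rfl, rfl⟩
    · simp only [Fin.val_add, Fin.val_two] at h5
      omega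
    · simp only [Fin.val_add, Fin.val_one] at h5
      omega
  subst hsσ
  refine ⟨γ, _, hadj, hS.neg.trans hE, fun z hz => ?_, ?_⟩
  · have hzy : z ≠ y := by
      rintro rfl
      have := frozenVertices_subset_fixedVertices γ hz α hadj.symm.reachable
      exact hy this.symm
    rw [← frozenVertices_eq_of_adj hadj] at hz
    simp [hzy, hf z hz]
  · rw [← Finset.add_sum_erase _ _ (Finset.mem_univ y),
      ← Finset.add_sum_erase (a := y) _ (fun v => |(-(Pi.single y s : V → ℤ) + E) v|)
        (Finset.mem_univ y)]
    have h1 : ∑ v ∈ Finset.univ.erase y, |(-(Pi.single y s : V → ℤ) + E) v| =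
        ∑ v ∈ Finset.univ.erase y, |E v| := by
      refine Finset.sum_congr rfl fun v hv => ?_
      simp [Finset.ne_of_mem_erase hv]
    rw [h1]
    simp only [Pi.add_apply, Pi.neg_apply, Pi.single_eq_same]
    -- The unit s has the sign of E y, because σ E y is the positive maximum.
    have h2 : |E y| = |-s + E y| + 1 := by
      rcases hs with rfl | rfl
      · rw [abs_of_pos (by linarith), abs_of_nonneg (by linarith)]
        ring
      · rw [abs_of_neg (by linarith), abs_of_nonpos (by linarith)]
        ring
    rw [h2]
    ring

theorem exists_walk_of_isShift [Fintype V] {α β : G.Coloring (Fin 3)} {E : V → ℤ}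
    (hE : IsShift α β E) (hf : ∀ x ∈ frozenVertices α, E x = 0) :
    ∃ p : (reconfGraph G 3).Walk α β, (p.length : ℤ) = ∑ v, |E v| := by
  classical
  obtain ⟨N, hN⟩ : ∃ N : ℕ, ∑ v, |E v| = N :=
    ⟨_, (Int.toNat_of_nonneg (Finset.sum_nonneg fun v _ => abs_nonneg _)).symm⟩
  induction N generalizing α E with
  | zero =>
    have h0 : E = 0 := by
      ext v
      have := (Finset.sum_eq_zero_iff_of_nonneg (fun v _ => abs_nonneg (E v))).1 hN v
        (Finset.mem_univ v)
      simpa using this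
    subst h0
    obtain rfl := hE.eq_of_zero
    exact ⟨.nil, by simp⟩
  | succ N ih =>
    have hne : E ≠ 0 := by
      rintro rfl
      simp at hN
      omega
    obtain ⟨γ, F, hadj, hF, hfF, hsum⟩ := exists_adj_isShift hE hf hne
    obtain ⟨p, hp⟩ := ih hF hfF (by push_cast at hN; linarith)
    refine ⟨.cons hadj p, ?_⟩
    rw [SimpleGraph.Walk.length_cons, hsum, ← hp]
    push_cast
    ring

/-- This is the criterion that the machine decides. No connectedness is assumed, so the components
of G can later be treated one at a time. -/
theorem isYesInstance_iff [Fintype V] (α β : G.Coloring (Fin 3)) (ℓ : ℕ) :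
    IsYesInstance G α β ℓ ↔
      ∃ E, IsShift α β E ∧ (∀ x ∈ frozenVertices α, E x = 0) ∧ ∑ v, |E v| ≤ ℓ := by
  classical
  constructor
  · rintro ⟨p, -, hp⟩
    obtain ⟨E, hE, hf, hs⟩ := exists_isShift_of_walk p
    exact ⟨E, hE, fun x hx => hf x (frozenVertices_subset_fixedVertices α hx), by omega⟩
  · rintro ⟨E, hE, hf, hs⟩
    obtain ⟨p, hp⟩ := exists_walk_of_isShift hE hf
    refine ⟨p.bypass, p.bypass_isPath, ?_⟩
    have := p.length_bypass_le_length
    omega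

end Shift

/-! ### Connected graphs -/

section Connected

variable {V : Type*} {G T : SimpleGraph V}

theorem walkWeight_nil (c : G.Coloring (Fin 3)) (u : V) :
    walkWeight c (SimpleGraph.Walk.nil : T.Walk u u) = 0 := by
  simp [walkWeight]

theorem walkWeight_cons (c : G.Coloring (Fin 3)) {u v w : V} (h : T.Adj u v)
    (p : T.Walk v w) :
    walkWeight c (SimpleGraph.Walk.cons h p) = edgeWeight c u v + walkWeight c p := by
  simp [walkWeight]

/-- The edge condition telescopes along the walk. Hence relative heights do not depend on the tree
once a shift exists, and they determine the shift up to a constant. -/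
theorem IsShift.walkWeight_sub (hT : T ≤ G) {α β : G.Coloring (Fin 3)} {E : V → ℤ}
    (hE : IsShift α β E) {u v : V} (p : T.Walk u v) :
    walkWeight β p - walkWeight α p = 2 * (E v - E u) := by
  induction p with
  | nil => simp [walkWeight_nil]
  | cons h p ih =>
    rw [walkWeight_cons, walkWeight_cons]
    have := hE.2 _ _ (hT h)
    linarith

theorem IsShift.relHeight_eq (hT : T ≤ G) (hT' : T.IsTree) {α β : G.Coloring (Fin 3)}
    {E : V → ℤ} (hE : IsShift α β E) (u v : V) : relHeight hT' α u β v = 2 * (E v - E u) :=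
  hE.walkWeight_sub hT _

/-- Along an edge both weights are odd, so their difference is even; modulo 3 it is minus, hence
twice, the increment of α - β. Together this gives the congruence modulo 6, which makes halving
heights exact. -/
theorem six_dvd_walkWeight_sub (hT : T ≤ G) (α β : G.Coloring (Fin 3)) {u v : V}
    (p : T.Walk u v) :
    (6 : ℤ) ∣ walkWeight β p - walkWeight α p -
      2 * (((α v : ℕ) - (β v : ℕ)) - ((α u : ℕ) - (β u : ℕ))) := by
  induction p with
  | nil => simp [walkWeight_nil]
  | cons h p ih =>
    rw [walkWeight_cons, walkWeight_cons]
    have h1 := edgeWeight_cases α (hT h)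
    have h2 := edgeWeight_cases β (hT h)
    omega

theorem IsShift.add_const {α β : G.Coloring (Fin 3)} {E : V → ℤ} (hE : IsShift α β E) {t : ℤ}
    (ht : (3 : ℤ) ∣ t) : IsShift α β fun v => E v + t := by
  refine ⟨fun v => ?_, fun v w hvw => ?_⟩
  · have := hE.1 v
    dsimp only
    omega
  · rw [← hE.2 v w hvw]
    ring

/-- For the converse, half the relative heights satisfy the edge condition, and only the additive
constant has to be chosen so that the residues are right and the fixed vertices get zero. -/
theorem reachable_iff [Finite V] (hTG : T ≤ G) (hT : T.IsTree) (α β : G.Coloring (Fin 3))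
    (u : V) :
    (reconfGraph G 3).Reachable α β ↔
      (∀ i : Fin 3, fixedVerticesOfColour α i = fixedVerticesOfColour β i) ∧
      (∀ v w : V, G.Adj v w →
        relHeight hT α u β v - relHeight hT α u β w + edgeWeight β v w = edgeWeight α v w) ∧
      (∀ x ∈ fixedVertices β, ∀ y ∈ fixedVertices β,
        relHeight hT α u β x = relHeight hT α u β y) := by
  have := Fintype.ofFinite V
  constructor
  · intro h
    obtain ⟨E, hE, hf, -⟩ := exists_isShift_of_walk h.some
    have hfix := fixedVertices_eq_of_reachable h
    refine ⟨fun i => ?_, fun v w hvw => ?_, fun x hx y hy => ?_⟩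
    · ext v
      constructor
      · rintro ⟨hv, rfl⟩
        exact ⟨hfix ▸ hv, (hv β h).symm⟩
      · rintro ⟨hv, rfl⟩
        rw [← hfix] at hv
        exact ⟨hv, hv β h⟩
    · rw [hE.relHeight_eq hTG, hE.relHeight_eq hTG]
      have := hE.2 v w hvw
      linarith
    · rw [← hfix] at hx hy
      rw [hE.relHeight_eq hTG, hE.relHeight_eq hTG, hf x hx, hf y hy]
  · rintro ⟨hcol, hedge, hfix⟩
    have hαβ : ∀ x ∈ fixedVertices α, x ∈ fixedVertices β ∧ α x = β x := by
      intro x hx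
      have h1 : x ∈ fixedVerticesOfColour α (α x) := ⟨hx, rfl⟩
      rw [hcol] at h1
      exact ⟨h1.1, h1.2.symm⟩
    -- The reference vertex is a fixed vertex if there is one; otherwise nothing has to vanish and
    -- any vertex serves.
    obtain ⟨r, hr⟩ : ∃ r : V, ∀ x ∈ fixedVertices α,
        α r = β r ∧ relHeight hT α u β x = relHeight hT α u β r := by
      by_cases hne : (fixedVertices α).Nonempty
      · obtain ⟨r, hr⟩ := hne
        exact ⟨r, fun x hx => ⟨(hαβ r hr).2, hfix x (hαβ x hx).1 r (hαβ r hr).1⟩⟩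
      · exact ⟨u, fun x hx => absurd ⟨x, hx⟩ hne⟩
    have h6 : ∀ v, (6 : ℤ) ∣ relHeight hT α u β v -
        2 * (((α v : ℕ) - (β v : ℕ)) - ((α u : ℕ) - (β u : ℕ))) := fun v =>
      six_dvd_walkWeight_sub hTG α β _
    -- The constant gives the value α r - β r at r, a correct residue there. At a fixed r it is
    -- zero, and then so are the values at all fixed vertices, which have the same height.
    have hE : IsShift α β fun v =>
        (relHeight hT α u β v - relHeight hT α u β r) / 2 + ((α r : ℕ) - (β r : ℕ)) := by
      refine ⟨fun v => ?_, fun v w hvw => ?_⟩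
      · have h1 := h6 v
        have h2 := h6 r
        dsimp only
        omega
      · have h1 := h6 v
        have h2 := h6 w
        have h3 := h6 r
        have h4 := hedge v w hvw
        dsimp only
        omega
    refine ⟨(exists_walk_of_isShift hE fun x hx => ?_).choose⟩
    obtain ⟨h1, h2⟩ := hr x (frozenVertices_subset_fixedVertices α hx)
    simp [h1, h2]

/-- When k grows from a non-negative value, the terms with f v ≥ 0 grow at full rate and the others
decrease at most at that rate; the latter are at most half of all. -/
theorem sum_abs_add_le_of_median [Fintype V] {f : V → ℤ}
    (hf : 2 * (Finset.univ.filter fun v => f v < 0).card ≤ Fintype.card V) {k k' : ℤ}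
    (hk : 0 ≤ k) (hkk : k ≤ k') : ∑ v, |k + f v| ≤ ∑ v, |k' + f v| := by
  have h1 : ∀ v, |k + f v| + (k' - k) * (if f v < 0 then -1 else 1) ≤ |k' + f v| := by
    intro v
    split_ifs with h
    · have := abs_sub_abs_le_abs_sub (k + f v) (k' + f v)
      rw [show k + f v - (k' + f v) = -(k' - k) by ring, abs_neg,
        abs_of_nonneg (by linarith : (0 : ℤ) ≤ k' - k)] at this
      linarith
    · rw [abs_of_nonneg (by linarith), abs_of_nonneg (by linarith)]
      linarith
  have h2 := Finset.sum_le_sum fun v (_ : v ∈ Finset.univ) => h1 v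
  rw [Finset.sum_add_distrib, ← Finset.mul_sum] at h2
  have h3 : (0 : ℤ) ≤ ∑ v, (if f v < 0 then (-1 : ℤ) else 1) := by
    have h4 := Finset.card_filter_add_card_filter_not (s := (Finset.univ : Finset V))
      (fun v => f v < 0)
    rw [Finset.card_univ] at h4
    rw [Finset.sum_ite]
    simp only [Finset.sum_const, nsmul_eq_mul, mul_neg, mul_one]
    omega
  have := mul_nonneg (sub_nonneg.2 hkk) h3
  linarith

theorem dist_eq [Fintype V] (hTG : T ≤ G) (hT : T.IsTree) {α β : G.Coloring (Fin 3)} {x : V}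
    (hx : IsFocal hT α β x) (h : (reconfGraph G 3).Reachable α β) {k₁ k₂ : ℤ}
    (hk₁ : IsLeast {k ∈ targetHeights α β x | 0 ≤ k} k₁)
    (hk₂ : IsGreatest {k ∈ targetHeights α β x | k ≤ 0} k₂) :
    2 * ((reconfGraph G 3).dist α β : ℤ) =
      min (heightSum hT α β x k₁) (heightSum hT α β x k₂) := by
  -- With k = 2 E x the summand of J at v is |2 E v|.
  have hsum : ∀ E, IsShift α β E → heightSum hT α β x (2 * E x) = 2 * ∑ v, |E v| := by
    intro E hE
    rw [heightSum, Finset.mul_sum]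
    refine Finset.sum_congr rfl fun v _ => ?_
    rw [hE.relHeight_eq hTG, show 2 * E x + 2 * (E v - E x) = 2 * E v by ring, abs_mul]
    rfl
  have htarget : ∀ E, IsShift α β E → 2 * E x ∈ targetHeights α β x := by
    intro E hE
    have := hE.1 x
    change _ ≡ _ [ZMOD 6]
    rw [Int.modEq_comm, Int.modEq_iff_dvd]
    omega
  have hdvd : ∀ k ∈ targetHeights α β x, (6 : ℤ) ∣ k - 2 * ((α x : ℕ) - (β x : ℕ)) :=
    fun k hk => Int.modEq_iff_dvd.1 (Int.ModEq.symm hk)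
  obtain ⟨p, hp⟩ := h.exists_walk_length_eq_dist
  obtain ⟨E, hE, hf, hs⟩ := exists_isShift_of_walk p
  have hfix := fixedVertices_eq_of_reachable h
  -- Upper bound: each target k is 2 (E x + t) with t divisible by 3, and E + t is realised by a
  -- walk as long as it vanishes on the fixed vertices. If there are none, every target is
  -- admissible.
  have hupper : ∀ k ∈ targetHeights α β x, (x ∈ fixedVertices β → k = 0) →
      2 * ((reconfGraph G 3).dist α β : ℤ) ≤ heightSum hT α β x k := by
    intro k hk hk0
    obtain ⟨t, ht, rfl⟩ : ∃ t, (3 : ℤ) ∣ t ∧ k = 2 * (E x + t) := by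
      have h1 := hdvd k hk
      have h2 := hE.1 x
      exact ⟨k / 2 - E x, by omega, by omega⟩
    have hE' := hE.add_const ht
    obtain ⟨q, hq⟩ := exists_walk_of_isShift hE' (by
      intro y hy
      have hy := frozenVertices_subset_fixedVertices α hy
      rcases hx with hx | ⟨hx, -⟩
      · have h1 := hk0 hx
        rw [← hfix] at hx
        have h2 := hf x hx
        have h3 := hf y hy
        omega
      · rw [hfix, hx] at hy
        exact hy.elim)
    rw [hsum _ hE', ← hq]
    have := (reconfGraph G 3).dist_le q
    omega
  -- At a fixed focal vertex every shift that comes from a walk is zero, so 0 is a target and k₁ =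
  -- k₂ = 0.
  have hfixed : x ∈ fixedVertices β → (0 : ℤ) ∈ targetHeights α β x := by
    intro hxf
    rw [← hfix] at hxf
    have := htarget E hE
    rwa [hf x hxf, mul_zero] at this
  have hz₁ : x ∈ fixedVertices β → k₁ = 0 := fun hxf =>
    le_antisymm (hk₁.2 ⟨hfixed hxf, le_rfl⟩) hk₁.1.2
  have hz₂ : x ∈ fixedVertices β → k₂ = 0 := fun hxf =>
    le_antisymm hk₂.1.2 (hk₂.2 ⟨hfixed hxf, le_rfl⟩)
  refine le_antisymm (le_min (hupper k₁ hk₁.1.1 hz₁) (hupper k₂ hk₂.1.1 hz₂)) ?_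
  -- Lower bound: the shift E of a shortest walk gives the target 2 E x, whose J is at most twice
  -- the distance.
  suffices hmin : min (heightSum hT α β x k₁) (heightSum hT α β x k₂) ≤
      heightSum hT α β x (2 * E x) by
    rw [hsum E hE] at hmin
    omega
  by_cases hxf : x ∈ fixedVertices β
  · rw [hfix.symm] at hxf
    rw [hf x hxf, hz₁ (hfix ▸ hxf)]
    exact min_le_left _ _
  · obtain ⟨u, hu⟩ := (hx.resolve_left hxf).2
    -- Changing the base vertex adds a constant to all heights, so the median may be taken for the
    -- heights from x itself.
    have hlt : ∀ v w, relHeight hT α u β v < relHeight hT α u β w ↔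
        relHeight hT α x β v < relHeight hT α x β w := by
      intro v w
      simp only [hE.relHeight_eq hTG]
      omega
    have hxx : relHeight hT α x β x = 0 := by
      rw [hE.relHeight_eq hTG]
      ring
    obtain ⟨hu₁, hu₂⟩ := hu
    simp only [hlt, hxx] at hu₁ hu₂
    rcases le_total 0 (2 * E x) with h0 | h0
    · exact (min_le_left _ _).trans
        (sum_abs_add_le_of_median hu₁ hk₁.1.2 (hk₁.2 ⟨htarget E hE, h0⟩))
    · refine (min_le_right _ _).trans ?_
      -- Negative targets are the mirror image: all heights and k change sign.
      have := sum_abs_add_le_of_median (f := fun v => -relHeight hT α x β v)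
        (k := -k₂) (k' := -(2 * E x)) (by simpa using hu₂) (by linarith [hk₂.1.2])
        (neg_le_neg (hk₂.2 ⟨htarget E hE, h0⟩))
      simpa only [← neg_add, abs_neg, heightSum] using this

end Connected

/-! ### A structured language

Programs with expressions, arrays and loops, which are compiled to the random access machine. -/

/-- The variables of the structured programs. -/
inductive Var : Type
  | v | j | w | x | hd | tl | r | st | sz | k | hi | cost | cnt | lo | up | best | tot
deriving DecidableEq

/-- The arrays of the structured programs. -/
inductive Arr : Type
  | count | mark | queue | seen | level | order | hist | table
deriving DecidableEq

/-- The number of a variable. -/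
def Var.idx (i : Var) : ℕ := i.ctorIdx

/-- The number of an array. -/
def Arr.idx (k : Arr) : ℕ := k.ctorIdx

/-- The array with a given number. -/
def Arr.ofIdx : ℕ → Arr
  | 0 => .count
  | 1 => .mark
  | 2 => .queue
  | 3 => .seen
  | 4 => .level
  | 5 => .order
  | 6 => .hist
  | _ => .table


theorem Var.idx_injective : Function.Injective Var.idx := by
  intro x y h
  cases x <;> cases y <;> first | rfl | cases h

theorem Arr.idx_lt (k : Arr) : k.idx < 8 := by
  cases k <;> decide

theorem Arr.ofIdx_idx (k : Arr) : Arr.ofIdx k.idx = k := by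
  cases k <;> rfl

theorem Arr.idx_ofIdx {i : ℕ} (h : i < 8) : (Arr.ofIdx i).idx = i := by
  interval_cases i <;> rfl

/-- Arithmetic expressions; `inp e` is the entry of the input with index `e`. -/
inductive Arith : Type
  | lit (k : ℕ)
  | var (i : Var)
  | inp (e : Arith)
  | arr (k : Arr) (e : Arith)
  | add (x y : Arith)
  | sub (x y : Arith)

/-- The state of a structured program: variables, arrays, and a clock. -/
structure Store : Type where
  var : Var → ℕ
  arr : Arr → ℕ → ℕ
  time : ℕ

/-- All variables and all array entries are at most `M`. -/
def Store.Le (s : Store) (M : ℕ) : Prop :=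
  (∀ i, s.var i ≤ M) ∧ ∀ k i, s.arr k i ≤ M

/-- Advance the clock. -/
def Store.tick (s : Store) : Store := ⟨s.var, s.arr, s.time + 1⟩

/-- The value of an expression. -/
def Arith.eval (I : ℕ → ℕ) (s : Store) : Arith → ℕ
  | .lit k => k
  | .var i => s.var i
  | .inp e => I (e.eval I s)
  | .arr k e => s.arr k (e.eval I s)
  | .add x y => x.eval I s + y.eval I s
  | .sub x y => x.eval I s - y.eval I s

/-- A condition for the value of an expression to be at most `M`. -/
def Arith.Small (I : ℕ → ℕ) (M : ℕ) (s : Store) : Arith → Prop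
  | .lit k => k ≤ M
  | .var _ => True
  | .inp _ => True
  | .arr _ _ => True
  | .add x y => x.eval I s + y.eval I s ≤ M
  | .sub x _ => x.Small I M s

/-- A measure of the size of the numbers in the evaluation of an expression. -/
def Arith.size : Arith → ℕ
  | .lit k => k + 1
  | .var _ => 1
  | .inp e => e.size
  | .arr _ e => e.size
  | .add x y => x.size + y.size
  | .sub x y => x.size + y.size

/-- Structured programs. The two-way branch and the loop test whether `x < y`. -/
inductive Cmd : Type
  | skip
  | set (i : Var) (e : Arith)
  | put (k : Arr) (e e' : Arith)
  | seq (c d : Cmd)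
  | ite (x y : Arith) (c d : Cmd)
  | loop (x y : Arith) (c : Cmd)

/-- The weakest precondition for a structured program to stop in a state satisfying `Q`, all
numbers assigned being at most `M`. Each assignment and each test takes one unit of time. -/
def Cmd.wp (I : ℕ → ℕ) (M : ℕ) : Cmd → (Store → Prop) → Store → Prop
  | .skip, Q, s => Q s
  | .set i e, Q, s => e.Small I M s ∧ Q ⟨Function.update s.var i (e.eval I s), s.arr, s.time + 1⟩
  | .put k e e', Q, s => e'.Small I M s ∧
      Q ⟨s.var, Function.update s.arr k (Function.update (s.arr k) (e.eval I s) (e'.eval I s)),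
        s.time + 1⟩
  | .seq c d, Q, s => c.wp I M (d.wp I M Q) s
  | .ite x y c d, Q, s => (x.eval I s < y.eval I s → c.wp I M Q s.tick) ∧
      (¬ x.eval I s < y.eval I s → d.wp I M Q s.tick)
  | .loop x y c, Q, s => ∃ k : ℕ, ((fun (X : Store → Prop) (s : Store) =>
      (x.eval I s < y.eval I s → c.wp I M X s.tick) ∧
        (¬ x.eval I s < y.eval I s → Q s.tick))^[k] fun _ => False) s

/-! ### Rules for weakest preconditions -/

section Wp

variable {I : ℕ → ℕ} {M : ℕ}

theorem Cmd.wp_skip (Q : Store → Prop) (s : Store) : Cmd.skip.wp I M Q s = Q s := rfl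

theorem Cmd.wp_set (i : Var) (e : Arith) (Q : Store → Prop) (s : Store) :
    (Cmd.set i e).wp I M Q s =
      (e.Small I M s ∧ Q ⟨Function.update s.var i (e.eval I s), s.arr, s.time + 1⟩) := rfl

theorem Cmd.wp_put (k : Arr) (e e' : Arith) (Q : Store → Prop) (s : Store) :
    (Cmd.put k e e').wp I M Q s = (e'.Small I M s ∧
      Q ⟨s.var, Function.update s.arr k (Function.update (s.arr k) (e.eval I s) (e'.eval I s)),
        s.time + 1⟩) := rfl

theorem Cmd.wp_seq (c d : Cmd) (Q : Store → Prop) (s : Store) :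
    (Cmd.seq c d).wp I M Q s = c.wp I M (d.wp I M Q) s := rfl

theorem Cmd.wp_ite (x y : Arith) (c d : Cmd) (Q : Store → Prop) (s : Store) :
    (Cmd.ite x y c d).wp I M Q s = ((x.eval I s < y.eval I s → c.wp I M Q s.tick) ∧
      (¬ x.eval I s < y.eval I s → d.wp I M Q s.tick)) := rfl

theorem Cmd.wp_mono (c : Cmd) {Q R : Store → Prop} (h : ∀ s, Q s → R s) (s : Store)
    (hs : c.wp I M Q s) : c.wp I M R s := by
  induction c generalizing Q R s with
  | skip => exact h s hs
  | set i e => exact ⟨hs.1, h _ hs.2⟩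
  | put k e e' => exact ⟨hs.1, h _ hs.2⟩
  | seq c d ihc ihd => exact ihc (fun s' hs' => ihd h s' hs') s hs
  | ite x y c d ihc ihd => exact ⟨fun hx => ihc h _ (hs.1 hx), fun hx => ihd h _ (hs.2 hx)⟩
  | loop x y c ih =>
    obtain ⟨k, hk⟩ := hs
    refine ⟨k, ?_⟩
    induction k generalizing s with
    | zero => exact hk
    | succ k ihk =>
      rw [Function.iterate_succ_apply'] at hk ⊢
      exact ⟨fun hx => ih (fun s' hs' => ihk s' hs') _ (hk.1 hx), fun hx => h _ (hk.2 hx)⟩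

/-- The clock never runs backwards. Together with the tick of each loop test this turns a bound on
the clock into termination. -/
theorem Cmd.wp_time (c : Cmd) {Q : Store → Prop} (s : Store) (hs : c.wp I M Q s) :
    c.wp I M (fun s' => Q s' ∧ s.time ≤ s'.time) s := by
  induction c generalizing Q s with
  | skip => exact ⟨hs, le_rfl⟩
  | set i e => exact ⟨hs.1, hs.2, Nat.le_succ _⟩
  | put k e e' => exact ⟨hs.1, hs.2, Nat.le_succ _⟩
  | seq c d ihc ihd =>
    refine c.wp_mono (fun s' hs' => ?_) s (ihc s hs)
    exact d.wp_mono (fun s'' hs'' => ⟨hs''.1, hs'.2.trans hs''.2⟩) s' (ihd s' hs'.1)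
  | ite x y c d ihc ihd =>
    exact ⟨fun hx => c.wp_mono (fun s' h => ⟨h.1, (Nat.le_succ _).trans h.2⟩) _ (ihc _ (hs.1 hx)),
      fun hx => d.wp_mono (fun s' h => ⟨h.1, (Nat.le_succ _).trans h.2⟩) _ (ihd _ (hs.2 hx))⟩
  | loop x y c ih =>
    obtain ⟨k, hk⟩ := hs
    refine ⟨k, ?_⟩
    -- The reference time t is fixed at the start of the loop, while the state s' changes with the
    -- unrollings.
    suffices H : ∀ k s' (t : ℕ), t ≤ s'.time → ((fun (X : Store → Prop) (s : Store) =>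
        (x.eval I s < y.eval I s → c.wp I M X s.tick) ∧
          (¬ x.eval I s < y.eval I s → Q s.tick))^[k] fun _ => False) s' →
        ((fun (X : Store → Prop) (s : Store) =>
        (x.eval I s < y.eval I s → c.wp I M X s.tick) ∧
          (¬ x.eval I s < y.eval I s → Q s.tick ∧ t ≤ s.tick.time))^[k] fun _ => False) s' from
      H k s _ le_rfl hk
    intro k
    induction k with
    | zero => exact fun s' t _ h => h
    | succ k ihk =>
      intro s' t ht hk
      rw [Function.iterate_succ_apply'] at hk ⊢
      exact ⟨fun hx => c.wp_mono (fun s'' hs'' => ihk s'' t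
        ((ht.trans (Nat.le_succ _)).trans hs''.2) hs''.1) _ (ih _ (hk.1 hx)),
        fun hx => ⟨hk.2 hx, ht.trans (Nat.le_succ _)⟩⟩

/-- A loop may be verified with an invariant that bounds the clock. -/
theorem Cmd.wp_loop {x y : Arith} {c : Cmd} {Q : Store → Prop} (J : Store → Prop) (T : ℕ)
    {s : Store} (hs : J s) (hT : ∀ s, J s → s.time ≤ T)
    (hbody : ∀ s, J s → x.eval I s < y.eval I s → c.wp I M J s.tick)
    (hexit : ∀ s, J s → ¬ x.eval I s < y.eval I s → Q s.tick) :
    (Cmd.loop x y c).wp I M Q s := by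
  refine ⟨T + 1, ?_⟩
  -- The remaining number k of unrollings is enough while T < time + k; each round advances the
  -- clock by at least one, and the invariant forbids a time beyond T.
  suffices H : ∀ k s, J s → T < s.time + k → ((fun (X : Store → Prop) (s : Store) =>
      (x.eval I s < y.eval I s → c.wp I M X s.tick) ∧
        (¬ x.eval I s < y.eval I s → Q s.tick))^[k] fun _ => False) s from
    H _ s hs (by omega)
  intro k
  induction k with
  | zero =>
    intro s hs hk
    have := hT s hs
    omega
  | succ k ih =>
    intro s hs hk
    rw [Function.iterate_succ_apply']
    refine ⟨fun hx => ?_, hexit s hs⟩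
    refine c.wp_mono (fun s' hs' => ih s' hs'.1 ?_) _ (c.wp_time _ (hbody s hs hx))
    have : s.time + 1 ≤ s'.time := hs'.2
    omega

theorem Arith.eval_le_of_small (hI : ∀ a, I a ≤ M) {s : Store} (hs : s.Le M) (e : Arith)
    (he : e.Small I M s) : e.eval I s ≤ M := by
  induction e with
  | lit k => exact he
  | var i => exact hs.1 i
  | inp e => exact hI _
  | arr k e => exact hs.2 _ _
  | add x y => exact he
  | sub x y ih => exact (Nat.sub_le _ _).trans (ih he)

theorem Arith.size_pos (e : Arith) : 0 < e.size := by
  induction e <;> simp_all [Arith.size]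

/-- Intermediate values need not be at most M: indices such as 3 v + c are formed freely and are
bounded through the size of the expression. The summand 1 in M + 1 serves the literals. -/
theorem Arith.eval_le (hI : ∀ a, I a ≤ M) {s : Store} (hs : s.Le M) (e : Arith) :
    e.eval I s ≤ e.size * (M + 1) := by
  induction e with
  | lit k => simp only [Arith.eval, Arith.size]; nlinarith
  | var i => simp only [Arith.eval, Arith.size]; have := hs.1 i; omega
  | inp e =>
    simp only [Arith.eval, Arith.size]
    have := hI (e.eval I s)
    have := e.size_pos
    nlinarith
  | arr k e =>
    simp only [Arith.eval, Arith.size]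
    have := hs.2 k (e.eval I s)
    have := e.size_pos
    nlinarith
  | add x y => simp only [Arith.eval, Arith.size]; nlinarith
  | sub x y =>
    simp only [Arith.eval, Arith.size]
    have := Nat.sub_le (x.eval I s) (y.eval I s)
    nlinarith

end Wp

/-! ### Runs of the machine -/

/-- All registers and memory cells hold numbers at most `B`. -/
def Config.Le (c : Config) (B : ℕ) : Prop :=
  ∀ a, c.regs a ≤ B ∧ c.mem a ≤ B

/-- The machine goes from `c` to `c'` in `t` steps, with all numbers at most `B`. -/
def Program.Run (P : Program) (B : ℕ) (c : Config) (t : ℕ) (c' : Config) : Prop :=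
  P.step^[t] c = c' ∧ ∀ i ≤ t, (P.step^[i] c).Le B

/-- The list `L` stands in the program `P` from the position `p` on. -/
def Program.CodeAt (P : Program) (p : ℕ) (L : List Instr) : Prop :=
  ∀ i x, L[i]? = some x → P[p + i]? = some x

section Run

variable {P : Program} {B : ℕ}

theorem Program.Run.refl {c : Config} (h : c.Le B) : P.Run B c 0 c :=
  ⟨rfl, fun i hi => by
    obtain rfl : i = 0 := by omega
    exact h⟩

theorem Program.Run.le {c c' : Config} {t : ℕ} (h : P.Run B c t c') : c'.Le B :=
  h.1 ▸ h.2 t le_rfl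

theorem Program.Run.trans {c c' c'' : Config} {t t' : ℕ} (h : P.Run B c t c')
    (h' : P.Run B c' t' c'') : P.Run B c (t + t') c'' := by
  obtain ⟨rfl, h1⟩ := h
  obtain ⟨rfl, h2⟩ := h'
  refine ⟨by rw [add_comm, Function.iterate_add_apply], fun i hi => ?_⟩
  rcases le_total i t with h | h
  · exact h1 i h
  · obtain ⟨j, rfl⟩ := Nat.exists_eq_add_of_le h
    rw [add_comm, Function.iterate_add_apply]
    exact h2 j (by omega)

theorem Program.Run.single {c : Config} {i : Instr} (hi : P[c.pc]? = some i) (hc : c.Le B)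
    (hc' : (i.exec c).Le B) : P.Run B c 1 (i.exec c) := by
  have h : P.step c = i.exec c := by simp only [Program.step, hi]
  refine ⟨by simpa using h, fun j hj => ?_⟩
  interval_cases j
  · exact hc
  · simpa [h] using hc'

theorem Config.Le.write {c : Config} (hc : c.Le B) {d x : ℕ} (hx : x ≤ B) :
    (c.write d x).Le B := by
  intro a
  refine ⟨?_, (hc a).2⟩
  by_cases h : a = d
  · subst h
    simpa [Config.write] using hx
  · simpa [Config.write, h] using (hc a).1

theorem Program.CodeAt.append {p : ℕ} {L L' : List Instr} (h : P.CodeAt p (L ++ L')) :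
    P.CodeAt p L ∧ P.CodeAt (p + L.length) L' := by
  refine ⟨fun i x hx => h i x ?_, fun i x hx => ?_⟩
  · rw [List.getElem?_append_left (List.getElem?_eq_some_iff.1 hx).1]
    exact hx
  · rw [add_assoc]
    refine h _ x ?_
    rw [List.getElem?_append_right (by omega)]
    simpa using hx

theorem Program.CodeAt.cons {p : ℕ} {i : Instr} {L : List Instr} (h : P.CodeAt p (i :: L)) :
    P[p]? = some i ∧ P.CodeAt (p + 1) L := by
  refine ⟨h 0 i rfl, fun j x hx => ?_⟩
  rw [add_assoc, add_comm 1]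
  exact h (j + 1) x (by simpa using hx)

/-- The effect of code that computes `x` in register `2 * d + 1`, using as scratch only the odd
registers from there on. -/
def Config.Computes (c : Config) (d len x : ℕ) (c' : Config) : Prop :=
  c'.pc = c.pc + len ∧ c'.mem = c.mem ∧ c'.regs (2 * d + 1) = x ∧
    ∀ r, (∀ j, d ≤ j → r ≠ 2 * j + 1) → c'.regs r = c.regs r

theorem Program.Run.snoc {c c' : Config} {t d x : ℕ} {i : Instr} (h : P.Run B c t c')
    (hi : P[c'.pc]? = some i) (he : i.exec c' = c'.write d x) (hx : x ≤ B) :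
    P.Run B c (t + 1) (c'.write d x) :=
  h.trans (he ▸ Program.Run.single hi h.le (he ▸ h.le.write hx))

end Run

/-! ### Compilation -/

/-- Replace the number `x` in register `2 * d + 1` by the address of the entry `x` of the array
`k`, register `0` holding the length of the input. -/
def addrCode (d k : ℕ) : List Instr :=
  [.add (2 * d + 1) (2 * d + 1) (2 * d + 1), .add (2 * d + 1) (2 * d + 1) (2 * d + 1),
    .add (2 * d + 1) (2 * d + 1) (2 * d + 1), .const (2 * (d + 1) + 1) (k + 1),
    .add (2 * d + 1) (2 * d + 1) (2 * (d + 1) + 1), .add (2 * d + 1) (2 * d + 1) 0]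

/-- Code that computes an expression in register `2 * d + 1`; the variable `i` is in register
`2 * i.idx + 2`. -/
def Arith.code : Arith → ℕ → List Instr
  | .lit k, d => [.const (2 * d + 1) k]
  | .var i, d => [.copy (2 * d + 1) (2 * i.idx + 2)]
  | .inp e, d => e.code d ++ [.sub (2 * (d + 1) + 1) (2 * d + 1) 0,
      .sub (2 * d + 1) (2 * d + 1) (2 * (d + 1) + 1), .load (2 * d + 1) (2 * d + 1)]
  | .arr k e, d => e.code d ++ (addrCode d k.idx ++ [.load (2 * d + 1) (2 * d + 1)])
  | .add x y, d => x.code d ++ (y.code (d + 1) ++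
      [.add (2 * d + 1) (2 * d + 1) (2 * (d + 1) + 1)])
  | .sub x y, d => x.code d ++ (y.code (d + 1) ++
      [.sub (2 * d + 1) (2 * d + 1) (2 * (d + 1) + 1)])

/-- Code for the two sides of a test. -/
def testCode (x y : Arith) : List Instr := x.code 0 ++ y.code 1

/-- The length of the code of a structured program. -/
def Cmd.len : Cmd → ℕ
  | .skip => 0
  | .set _ e => (e.code 0).length + 1
  | .put _ e e' => (e.code 0).length + 6 + (e'.code 1).length + 1
  | .seq c d => c.len + d.len
  | .ite x y c d => (testCode x y).length + 1 + d.len + 1 + c.len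
  | .loop x y c => (testCode x y).length + 2 + c.len + 1

/-- The code of a structured program, to be placed at position `p`. -/
def Cmd.code : Cmd → ℕ → List Instr
  | .skip, _ => []
  | .set i e, _ => e.code 0 ++ [.copy (2 * i.idx + 2) 1]
  | .put k e e', _ => e.code 0 ++ (addrCode 0 k.idx ++ (e'.code 1 ++ [.store 1 3]))
  | .seq c d, p => c.code p ++ d.code (p + c.len)
  | .ite x y c d, p =>
      testCode x y ++ (.jumpLt 1 3 (p + (testCode x y).length + 1 + d.len + 1) ::
        (d.code (p + (testCode x y).length + 1) ++
        (.jump (p + (testCode x y).length + 1 + d.len + 1 + c.len) ::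
        c.code (p + (testCode x y).length + 1 + d.len + 1))))
  | .loop x y c, p =>
      testCode x y ++ (.jumpLt 1 3 (p + (testCode x y).length + 2) ::
        .jump (p + (testCode x y).length + 2 + c.len + 1) ::
        (c.code (p + (testCode x y).length + 2) ++ [.jump p]))

theorem Cmd.length_code (c : Cmd) (p : ℕ) : (c.code p).length = c.len := by
  induction c generalizing p with
  | skip => rfl
  | set i e => simp [Cmd.code, Cmd.len]
  | put k e e' => simp [Cmd.code, Cmd.len, addrCode]; omega
  | seq c d ihc ihd => simp [Cmd.code, Cmd.len, ihc, ihd]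
  | ite x y c d ihc ihd => simp [Cmd.code, Cmd.len, ihc, ihd]; omega
  | loop x y c ih => simp [Cmd.code, Cmd.len, ih]; omega

/-- The sum of the sizes of the expressions in a structured program. -/
def Cmd.size : Cmd → ℕ
  | .skip => 0
  | .set _ e => e.size
  | .put _ e e' => e.size + e'.size
  | .seq c d => c.size + d.size
  | .ite x y c d => x.size + y.size + c.size + d.size
  | .loop x y c => x.size + y.size + c.size

/-- The memory in which the input of length `W` is followed by the arrays. -/
def Store.image (I : ℕ → ℕ) (W : ℕ) (s : Store) (a : ℕ) : ℕ :=
  if a ≤ W then I a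
  else s.arr (.ofIdx ((a - W - 1) % 8)) ((a - W - 1) / 8)

/-- The configuration `c` represents the state `s`. -/
def Store.Repr (I : ℕ → ℕ) (W : ℕ) (s : Store) (c : Config) : Prop :=
  c.regs 0 = W ∧ (∀ i : Var, c.regs (2 * i.idx + 2) = s.var i) ∧ c.mem = s.image I W

section Compile

variable {P : Program} {B M W S : ℕ} {I : ℕ → ℕ}

/-- The eight arrays are interleaved modulo 8 after the input, so that none of them needs a length
fixed in advance. Cell W stays empty between the input and the arrays. -/
theorem Store.image_address (s : Store) (k : Arr) (x : ℕ) :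
    s.image I W (8 * x + (k.idx + 1) + W) = s.arr k x := by
  have h := k.idx_lt
  rw [Store.image, if_neg (by omega), show (8 * x + (k.idx + 1) + W - W - 1) % 8 = k.idx by omega,
    show (8 * x + (k.idx + 1) + W - W - 1) / 8 = x by omega, k.ofIdx_idx]

theorem Store.update_image (s : Store) (k : Arr) (x v : ℕ) (t : ℕ) (f : Var → ℕ) :
    Function.update (s.image I W) (8 * x + (k.idx + 1) + W) v =
      Store.image I W ⟨f, Function.update s.arr k (Function.update (s.arr k) x v), t⟩ := by
  have h := k.idx_lt
  ext a
  by_cases ha : a ≤ W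
  · rw [Function.update_of_ne (by omega), Store.image, Store.image, if_pos ha, if_pos ha]
  · obtain ⟨k', y, rfl⟩ : ∃ (k' : Arr) (y : ℕ), a = 8 * y + (k'.idx + 1) + W :=
      ⟨.ofIdx ((a - W - 1) % 8), (a - W - 1) / 8, by
        rw [Arr.idx_ofIdx (Nat.mod_lt _ (by norm_num))]
        omega⟩
    have h' := k'.idx_lt
    rw [Store.image_address]
    by_cases hk : k' = k
    · subst hk
      by_cases hy : y = x
      · subst hy
        simp
      · rw [Function.update_of_ne (by omega), Store.image_address]
        simp [hy]
    · have : k'.idx ≠ k.idx := fun h => hk (by rw [← k'.ofIdx_idx, h, k.ofIdx_idx])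
      rw [Function.update_of_ne (by omega), Store.image_address]
      simp [hk]

/-- Three doublings give 8 x; then k + 1 and the length W of the input are added. -/
theorem run_addrCode {c : Config} {d x : ℕ} (k : Arr) (hc : c.Le B) (hW : c.regs 0 = W)
    (hx : c.regs (2 * d + 1) = x) (hcode : P.CodeAt c.pc (addrCode d k.idx))
    (hB : 8 * x + W + 9 ≤ B) :
    ∃ c', P.Run B c 6 c' ∧ c.Computes d 6 (8 * x + (k.idx + 1) + W) c' := by
  have hk := k.idx_lt
  obtain ⟨h1, hcode⟩ := hcode.cons
  obtain ⟨h2, hcode⟩ := hcode.cons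
  obtain ⟨h3, hcode⟩ := hcode.cons
  obtain ⟨h4, hcode⟩ := hcode.cons
  obtain ⟨h5, hcode⟩ := hcode.cons
  obtain ⟨h6, -⟩ := hcode.cons
  have r1 := (Program.Run.refl (P := P) hc).snoc h1 rfl (by rw [hx]; omega)
  have r2 := r1.snoc h2 rfl (by simp [Config.write, hx]; omega)
  have r3 := r2.snoc h3 rfl (by simp [Config.write, hx]; omega)
  have r4 := r3.snoc h4 rfl (by omega)
  have r5 := r4.snoc h5 rfl (by simp [Config.write, hx]; omega)
  have r6 := r5.snoc h6 rfl (by simp [Config.write, hx, hW]; omega)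
  refine ⟨_, r6, by simp [Config.write], rfl, ?_, fun r hr => ?_⟩
  · simp [Config.write, hx, hW]
    omega
  · have e1 := hr d le_rfl
    have e2 := hr (d + 1) (by omega)
    simp [Config.write, e1, e2]

theorem Store.Repr.of_computes {s : Store} {c c' : Config} {d len x : ℕ} (h : s.Repr I W c)
    (h' : c.Computes d len x c') : s.Repr I W c' := by
  obtain ⟨h1, h2, h3⟩ := h
  obtain ⟨-, e2, -, e4⟩ := h'
  refine ⟨?_, fun i => ?_, e2.trans h3⟩
  · rw [e4 0 (by omega), h1]
  · rw [e4 _ (by omega), h2]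

/-- The odd registers form an evaluation stack of which d is the current height, while variables sit
in positive even registers and W in register 0; so evaluation disturbs neither the state nor the
operands below. -/
theorem Arith.run_code (hI : ∀ a, I a ≤ M) (hIW : ∀ a, W ≤ a → I a = 0)
    (hB : 8 * (S * (M + 1)) + W + 9 ≤ B) {s : Store} (hs : s.Le M) (e : Arith)
    (he : e.size ≤ S) (d : ℕ) (c : Config) (hc : c.Le B) (hr : s.Repr I W c)
    (hcode : P.CodeAt c.pc (e.code d)) :
    ∃ c', P.Run B c (e.code d).length c' ∧
      c.Computes d (e.code d).length (e.eval I s) c' := by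
  induction e generalizing d c with
  | lit k =>
    obtain ⟨h1, -⟩ := hcode.cons
    have hk : k ≤ B := by
      simp only [Arith.size] at he
      nlinarith
    exact ⟨_, (Program.Run.refl hc).snoc h1 rfl hk, rfl, rfl, by simp [Config.write, Arith.eval],
      fun r hr => by simp [Config.write, hr d le_rfl]⟩
  | var i =>
    obtain ⟨h1, -⟩ := hcode.cons
    exact ⟨_, (Program.Run.refl hc).snoc h1 rfl (hc _).1, rfl, rfl,
      by simp [Config.write, Arith.eval, hr.2.1 i],
      fun r hr => by simp [Config.write, hr d le_rfl]⟩
  | inp e ih =>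
    obtain ⟨hcode1, hcode⟩ := Program.CodeAt.append hcode
    obtain ⟨c1, r1, m1⟩ := ih he d c hc hr hcode1
    rw [← m1.1] at hcode
    obtain ⟨h1, hcode⟩ := hcode.cons
    obtain ⟨h2, hcode⟩ := hcode.cons
    obtain ⟨h3, -⟩ := hcode.cons
    have q1 := hr.of_computes m1
    have hle := r1.le
    have r2 := r1.snoc h1 rfl (by have := (hle (2 * d + 1)).1; omega)
    have r3 := r2.snoc h2 rfl (by
      have := (hle (2 * d + 1)).1
      simp [Config.write]
      omega)
    have r4 := r3.snoc h3 rfl (r3.le _).2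
    have hlen : (Arith.code (.inp e) d).length = (e.code d).length + 1 + 1 + 1 := by
      simp [Arith.code]
    rw [hlen]
    refine ⟨_, r4, ?_, m1.2.1, ?_, fun r hr => ?_⟩
    · simp [Config.write, m1.1]
      omega
    · have hm : c1.mem = s.image I W := q1.2.2
      simp only [Config.write, Arith.eval, Function.update_self, hm, q1.1, m1.2.2.1]
      rw [Function.update_of_ne (by omega), m1.2.2.1, Store.image, if_pos (by omega)]
      -- The two truncated subtractions compute min(x, W). Reading beyond the input thus hits the
      -- empty cell W instead of an array, in agreement with I being 0 there.
      rcases le_total (e.eval I s) W with h | h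
      · congr 1
        omega
      · rw [hIW _ (by omega), hIW _ h]
    · have e1 := hr d le_rfl
      have e2 := hr (d + 1) (by omega)
      simp only [Config.write, Function.update_of_ne e1, Function.update_of_ne e2]
      exact m1.2.2.2 r hr
  | arr k e ih =>
    obtain ⟨hcode1, hcode⟩ := Program.CodeAt.append hcode
    obtain ⟨c1, r1, m1⟩ := ih he d c hc hr hcode1
    rw [← m1.1] at hcode
    obtain ⟨hcode2, hcode⟩ := hcode.append
    have hev := e.eval_le hI hs
    have hev' : e.size * (M + 1) ≤ S * (M + 1) := Nat.mul_le_mul_right _ he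
    obtain ⟨c2, r2, m2⟩ := run_addrCode k r1.le (hr.of_computes m1).1 m1.2.2.1 hcode2 (by omega)
    change P.CodeAt (c1.pc + 6) _ at hcode
    rw [← m2.1] at hcode
    obtain ⟨h3, -⟩ := hcode.cons
    have r3 := (r1.trans r2).snoc h3 rfl (r2.le _).2
    have hlen : (Arith.code (.arr k e) d).length = (e.code d).length + 6 + 1 := by
      simp [Arith.code, addrCode]
    rw [hlen]
    refine ⟨_, r3, ?_, m2.2.1.trans m1.2.1, ?_,
      fun r hr => ?_⟩
    · simp [Config.write, m2.1, m1.1]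
      omega
    · have hm : c2.mem = s.image I W := ((hr.of_computes m1).of_computes m2).2.2
      simp only [Config.write, Arith.eval, Function.update_self, hm, m2.2.2.1,
        Store.image_address]
    · have e1 := hr d le_rfl
      simp only [Config.write, Function.update_of_ne e1]
      rw [m2.2.2.2 r hr, m1.2.2.2 r hr]
  | add x y ihx ihy =>
    obtain ⟨hcode1, hcode⟩ := Program.CodeAt.append hcode
    have hsz : (x.size + y.size) * (M + 1) ≤ S * (M + 1) := Nat.mul_le_mul_right _ he
    simp only [Arith.size] at he
    obtain ⟨c1, r1, m1⟩ := ihx (by omega) d c hc hr hcode1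
    rw [← m1.1] at hcode
    obtain ⟨hcode2, hcode⟩ := hcode.append
    obtain ⟨c2, r2, m2⟩ := ihy (by omega) (d + 1) c1 r1.le (hr.of_computes m1) hcode2
    rw [← m2.1] at hcode
    obtain ⟨h3, -⟩ := hcode.cons
    -- Evaluating y at height d + 1 leaves the value of x below it intact.
    have hx : c2.regs (2 * d + 1) = x.eval I s := by
      rw [m2.2.2.2 _ (by omega), m1.2.2.1]
    have e1 := x.eval_le hI hs
    have e2 := y.eval_le hI hs
    have r3 := (r1.trans r2).snoc h3 rfl (by
      rw [hx, m2.2.2.1]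
      nlinarith)
    have hlen : (Arith.code (.add x y) d).length =
        (x.code d).length + (y.code (d + 1)).length + 1 := by
      simp [Arith.code, add_assoc]
    rw [hlen]
    refine ⟨_, r3, ?_, m2.2.1.trans m1.2.1, ?_,
      fun r hr => ?_⟩
    · simp [Config.write, m2.1, m1.1]
      omega
    · simp only [Config.write, Arith.eval, Function.update_self, hx, m2.2.2.1]
    · have e1 := hr d le_rfl
      simp only [Config.write, Function.update_of_ne e1]
      rw [m2.2.2.2 r (fun j hj => hr j (by omega)), m1.2.2.2 r hr]
  | sub x y ihx ihy =>
    obtain ⟨hcode1, hcode⟩ := Program.CodeAt.append hcode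
    simp only [Arith.size] at he
    obtain ⟨c1, r1, m1⟩ := ihx (by omega) d c hc hr hcode1
    rw [← m1.1] at hcode
    obtain ⟨hcode2, hcode⟩ := hcode.append
    obtain ⟨c2, r2, m2⟩ := ihy (by omega) (d + 1) c1 r1.le (hr.of_computes m1) hcode2
    rw [← m2.1] at hcode
    obtain ⟨h3, -⟩ := hcode.cons
    have hx : c2.regs (2 * d + 1) = x.eval I s := by
      rw [m2.2.2.2 _ (by omega), m1.2.2.1]
    have r3 := (r1.trans r2).snoc h3 rfl ((Nat.sub_le _ _).trans (r2.le _).1)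
    have hlen : (Arith.code (.sub x y) d).length =
        (x.code d).length + (y.code (d + 1)).length + 1 := by
      simp [Arith.code, add_assoc]
    rw [hlen]
    refine ⟨_, r3, ?_, m2.2.1.trans m1.2.1, ?_,
      fun r hr => ?_⟩
    · simp [Config.write, m2.1, m1.1]
      omega
    · simp only [Config.write, Arith.eval, Function.update_self, hx, m2.2.2.1]
    · have e1 := hr d le_rfl
      simp only [Config.write, Function.update_of_ne e1]
      rw [m2.2.2.2 r (fun j hj => hr j (by omega)), m1.2.2.2 r hr]

end Compile

/-! ### Simulation of structured programs by the machine -/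

section Compile

variable {P : Program} {B M W S K : ℕ} {I : ℕ → ℕ}

theorem run_testCode (hI : ∀ a, I a ≤ M) (hIW : ∀ a, W ≤ a → I a = 0)
    (hB : 8 * (S * (M + 1)) + W + 9 ≤ B) {s : Store} (hs : s.Le M) (x y : Arith)
    (hxy : x.size + y.size ≤ S) (c : Config) (hc : c.Le B) (hr : s.Repr I W c)
    (hcode : P.CodeAt c.pc (testCode x y)) :
    ∃ c', P.Run B c (testCode x y).length c' ∧ c'.pc = c.pc + (testCode x y).length ∧
      s.Repr I W c' ∧ c'.regs 1 = x.eval I s ∧ c'.regs 3 = y.eval I s := by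
  obtain ⟨hcode1, hcode2⟩ := Program.CodeAt.append hcode
  obtain ⟨c1, r1, m1⟩ := x.run_code hI hIW hB hs (by omega) 0 c hc hr hcode1
  have q1 := hr.of_computes m1
  rw [← m1.1] at hcode2
  obtain ⟨c2, r2, m2⟩ := y.run_code hI hIW hB hs (by omega) 1 c1 r1.le q1 hcode2
  have hlen : (testCode x y).length = (x.code 0).length + (y.code 1).length := by
    simp [testCode]
  refine ⟨c2, hlen ▸ r1.trans r2, by rw [m2.1, m1.1, hlen, add_assoc], q1.of_computes m2, ?_,
    m2.2.2.1⟩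
  rw [m2.2.2.2 1 (by omega)]
  exact m1.2.2.1

theorem Config.Le.jump {c : Config} (hc : c.Le B) (p : ℕ) : Config.Le ⟨p, c.regs, c.mem⟩ B := hc

theorem Store.Le.set {s : Store} (hs : s.Le M) (i : Var) {v : ℕ} (hv : v ≤ M) (t : ℕ) :
    Store.Le ⟨Function.update s.var i v, s.arr, t⟩ M := by
  refine ⟨fun j => ?_, hs.2⟩
  by_cases h : j = i
  · subst h
    simpa using hv
  · simpa [h] using hs.1 j

theorem Store.Le.put {s : Store} (hs : s.Le M) (k : Arr) (a : ℕ) {v : ℕ} (hv : v ≤ M) (t : ℕ) :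
    Store.Le ⟨s.var, Function.update s.arr k (Function.update (s.arr k) a v), t⟩ M := by
  refine ⟨hs.1, fun j b => ?_⟩
  by_cases h : j = k
  · subst h
    by_cases hb : b = a
    · subst hb
      simpa using hv
    · simpa [hb] using hs.2 j b
  · simpa [h] using hs.2 j b

/-- Amortised accounting: every tick of the clock pays for K machine steps. The straight-line code
of an assignment, or of a test with its jumps, is shorter than K, and composition costs nothing. -/
theorem Cmd.run_code (hI : ∀ a, I a ≤ M) (hIW : ∀ a, W ≤ a → I a = 0)
    (hB : 8 * (S * (M + 1)) + W + 9 ≤ B) (hMB : M ≤ B) (c : Cmd) (hS : c.size ≤ S)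
    (hK : c.len + 2 ≤ K) (Q : Store → Prop) (s : Store) (hwp : c.wp I M Q s) (hs : s.Le M)
    (σ : Config) (hσ : σ.Le B) (hr : s.Repr I W σ) (hcode : P.CodeAt σ.pc (c.code σ.pc)) :
    ∃ s' σ' t, Q s' ∧ s'.Le M ∧ s'.Repr I W σ' ∧ P.Run B σ t σ' ∧ σ'.pc = σ.pc + c.len ∧
      t + K * s.time ≤ K * s'.time := by
  induction c generalizing Q s σ with
  | skip => exact ⟨s, σ, 0, hwp, hs, hr, .refl hσ, rfl, by omega⟩
  | set i e =>
    obtain ⟨hcode1, hcode⟩ := Program.CodeAt.append hcode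
    obtain ⟨σ1, r1, m1⟩ := e.run_code hI hIW hB hs hS 0 σ hσ hr hcode1
    have q1 := hr.of_computes m1
    rw [← m1.1] at hcode
    have hv := e.eval_le_of_small hI hs hwp.1
    have e1 : σ1.regs 1 = e.eval I s := m1.2.2.1
    have r2 := r1.snoc hcode.cons.1 rfl (r1.le 1).1
    rw [e1] at r2
    refine ⟨_, σ1.write (2 * i.idx + 2) (e.eval I s), _, hwp.2, hs.set i hv _,
      ⟨?_, fun j => ?_, q1.2.2⟩, r2, ?_, ?_⟩
    · simp [Config.write, q1.1]
    · by_cases hj : j = i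
      · subst hj
        simp [Config.write]
      · have hj' : j.idx ≠ i.idx := fun h => hj (Var.idx_injective h)
        simp [Config.write, hj, hj', q1.2.1]
    · simp only [Config.write, m1.1, Cmd.len]
      omega
    · simp only [Cmd.len] at hK
      dsimp only
      rw [mul_add]
      omega
  | put k e e' =>
    have hev := e.eval_le hI hs
    have hS' : e.size * (M + 1) ≤ S * (M + 1) :=
      Nat.mul_le_mul_right _ ((Nat.le_add_right _ _).trans hS)
    simp only [Cmd.size] at hS
    obtain ⟨hcode1, hcode⟩ := Program.CodeAt.append hcode
    obtain ⟨σ1, r1, m1⟩ := e.run_code hI hIW hB hs (by omega) 0 σ hσ hr hcode1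
    have q1 := hr.of_computes m1
    rw [← m1.1] at hcode
    obtain ⟨hcode2, hcode⟩ := hcode.append
    obtain ⟨σ2, r2, m2⟩ := run_addrCode k r1.le q1.1 m1.2.2.1 hcode2 (by omega)
    have q2 := q1.of_computes m2
    change P.CodeAt (σ1.pc + 6) _ at hcode
    rw [← m2.1] at hcode
    obtain ⟨hcode3, hcode⟩ := hcode.append
    obtain ⟨σ3, r3, m3⟩ := e'.run_code hI hIW hB hs (by omega) 1 σ2 r2.le q2 hcode3
    have q3 := q2.of_computes m3
    rw [← m3.1] at hcode
    have hv := e'.eval_le_of_small hI hs hwp.1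
    have e1 : σ3.regs 1 = 8 * e.eval I s + (k.idx + 1) + W := by
      rw [m3.2.2.2 1 (by omega)]
      exact m2.2.2.1
    have e3 : σ3.regs 3 = e'.eval I s := m3.2.2.1
    have r4 : P.Run B σ3 1 _ := Program.Run.single hcode.cons.1 r3.le (by
      intro a
      refine ⟨(r3.le a).1, ?_⟩
      by_cases ha : a = σ3.regs 1
      · subst ha
        simpa [Instr.exec, e3] using hv.trans hMB
      · simpa [Instr.exec, ha] using (r3.le a).2)
    refine ⟨_, Instr.exec σ3 (.store 1 3), _, hwp.2, hs.put k _ hv _, ⟨q3.1, q3.2.1, ?_⟩,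
      ((r1.trans r2).trans r3).trans r4, ?_, ?_⟩
    · simp only [Instr.exec, e1, e3, q3.2.2]
      exact s.update_image k _ _ _ _
    · simp only [Instr.exec, m3.1, m2.1, m1.1, Cmd.len]
      omega
    · simp only [Cmd.len] at hK
      dsimp only
      rw [mul_add]
      omega
  | seq c d ihc ihd =>
    simp only [Cmd.size] at hS
    simp only [Cmd.len] at hK
    obtain ⟨hcode1, hcode⟩ := Program.CodeAt.append hcode
    obtain ⟨s1, σ1, t1, w1, l1, q1, r1, p1, h1⟩ :=
      ihc (by omega) (by omega) _ s hwp hs σ hσ hr hcode1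
    rw [c.length_code, ← p1] at hcode
    obtain ⟨s2, σ2, t2, w2, l2, q2, r2, p2, h2⟩ :=
      ihd (by omega) (by omega) Q s1 w1 l1 σ1 r1.le q1 hcode
    exact ⟨s2, σ2, _, w2, l2, q2, r1.trans r2, by rw [p2, p1, Cmd.len, add_assoc], by omega⟩
  | ite x y c d ihc ihd =>
    simp only [Cmd.size] at hS
    simp only [Cmd.len] at hK
    obtain ⟨hcode1, hcode⟩ := Program.CodeAt.append hcode
    obtain ⟨σ1, r1, p1, q1, e1, e3⟩ := run_testCode hI hIW hB hs x y (by omega) σ hσ hr hcode1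
    rw [← p1] at hcode
    obtain ⟨hj, hcode⟩ := hcode.cons
    obtain ⟨hcode2, hcode⟩ := Program.CodeAt.append hcode
    obtain ⟨hj2, hcode⟩ := hcode.cons
    rw [d.length_code] at hj2 hcode
    have r2 := Program.Run.single hj r1.le (r1.le.jump _)
    have r12 := r1.trans r2
    by_cases hxy : x.eval I s < y.eval I s
    · simp only [Instr.exec, e1, e3, if_pos hxy] at r12
      obtain ⟨s3, σ3, t3, w3, l3, q3, r3, p3, h3⟩ := ihc (by omega) (by omega) Q s.tick
        (hwp.1 hxy) hs _ r12.le q1 (by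
          dsimp only
          convert hcode using 1)
      refine ⟨s3, σ3, _, w3, l3, q3, r12.trans r3, ?_, ?_⟩
      · rw [p3]
        simp only [Cmd.len]
        omega
      · simp only [Store.tick, mul_add] at h3
        omega
    · simp only [Instr.exec, e1, e3, if_neg hxy] at r12
      obtain ⟨s3, σ3, t3, w3, l3, q3, r3, p3, h3⟩ := ihd (by omega) (by omega) Q s.tick
        (hwp.2 hxy) hs _ r12.le q1 (by
          dsimp only
          exact hcode2)
      dsimp only at p3
      rw [← p3] at hj2
      have r4 := Program.Run.single hj2 r3.le (r3.le.jump _)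
      refine ⟨s3, _, _, w3, l3, ?_, (r12.trans r3).trans r4, ?_, ?_⟩
      · exact q3
      · simp only [Instr.exec, Cmd.len]
        omega
      · simp only [Store.tick, mul_add] at h3
        omega
  | loop x y c ih =>
    simp only [Cmd.size] at hS
    simp only [Cmd.len] at hK
    obtain ⟨p, hp⟩ : ∃ p, σ.pc = p := ⟨_, rfl⟩
    obtain ⟨hcode1, hj, hj2, hcode2, hj3⟩ : P.CodeAt p (testCode x y) ∧
        P[p + (testCode x y).length]? = some (.jumpLt 1 3 (p + (testCode x y).length + 2)) ∧
        P[p + (testCode x y).length + 1]? =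
          some (.jump (p + (testCode x y).length + 2 + c.len + 1)) ∧
        P.CodeAt (p + (testCode x y).length + 2) (c.code (p + (testCode x y).length + 2)) ∧
        P[p + (testCode x y).length + 2 + c.len]? = some (.jump p) := by
      rw [hp] at hcode
      obtain ⟨hcode1, hcode⟩ := Program.CodeAt.append hcode
      obtain ⟨hj, hcode⟩ := hcode.cons
      obtain ⟨hj2, hcode⟩ := hcode.cons
      obtain ⟨hcode2, hcode⟩ := Program.CodeAt.append hcode
      have hj3 := hcode.cons.1
      rw [c.length_code] at hj3
      exact ⟨hcode1, hj, hj2, hcode2, hj3⟩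
    clear hcode
    -- The weakest precondition of a loop supplies a number of unrollings, on which the induction
    -- runs; the configuration varies but returns to position p each time.
    obtain ⟨k, hk⟩ := hwp
    induction k generalizing s σ with
    | zero => exact hk.elim
    | succ k ihk =>
      rw [Function.iterate_succ_apply'] at hk
      obtain ⟨σ1, r1, p1, q1, e1, e3⟩ := run_testCode hI hIW hB hs x y (by omega) σ hσ hr
        (by rwa [hp])
      rw [hp] at p1 ⊢
      have hj' := hj
      rw [← p1] at hj'
      have r2 := Program.Run.single hj' r1.le (r1.le.jump _)
      have r12 := r1.trans r2
      by_cases hxy : x.eval I s < y.eval I s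
      · simp only [Instr.exec, e1, e3, if_pos hxy] at r12
        obtain ⟨s3, σ3, t3, w3, l3, q3, r3, p3, h3⟩ := ih (by omega) (by omega) _ s.tick
          (hk.1 hxy) hs _ r12.le q1 (by
            dsimp only
            rwa [p1])
        dsimp only at p3
        rw [p1] at p3
        have hj3' := hj3
        rw [← p3] at hj3'
        have r4 := Program.Run.single hj3' r3.le (r3.le.jump _)
        -- The tick of the test has paid for the test, the conditional jump and the jump back.
        obtain ⟨s5, σ5, t5, w5, l5, q5, r5, p5, h5⟩ :=
          ihk s3 l3 _ r4.le q3 rfl w3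
        refine ⟨s5, σ5, _, w5, l5, q5, ((r12.trans r3).trans r4).trans r5, p5, ?_⟩
        simp only [Store.tick, mul_add] at h3
        omega
      · simp only [Instr.exec, e1, e3, if_neg hxy] at r12
        rw [p1] at r12
        have r3 := Program.Run.single (c := ⟨_, σ1.regs, σ1.mem⟩) hj2 r12.le (r12.le.jump _)
        refine ⟨s.tick, ⟨p + (testCode x y).length + 2 + c.len + 1, σ1.regs, σ1.mem⟩, _,
          hk.2 hxy, hs,
          q1, r12.trans r3, ?_, ?_⟩
        · simp only [Cmd.len]
          omega
        · simp only [Store.tick, mul_add]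
          omega

end Compile

/-! ### The complete machine -/

/-- Code that computes in register `0` the length of the encoding of an instance. -/
def lengthCode : List Instr :=
  [.const 1 0, .load 1 1, .add 3 1 1, .add 1 1 3, .const 3 2, .add 1 1 3, .load 3 1, .add 0 1 3,
    .const 3 1, .add 0 0 3]

/-- The machine that runs the structured program `c` and accepts when `¬ x < y` at the end. -/
def Cmd.machine (c : Cmd) (x y : Arith) : Program :=
  lengthCode ++ (c.code 10 ++ (testCode x y ++
    [.jumpLt 1 3 (10 + c.len + (testCode x y).length + 2), .halt true, .halt false]))

theorem Program.codeAt_self (P : Program) : P.CodeAt 0 P := fun i x h => by rwa [zero_add]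

/-- A halted configuration is a fixed point, so a bound up to the halt holds at all later times. -/
theorem Program.wordsBounded_of_run {P : Program} {input : List ℕ} {B t : ℕ} {σ : Config}
    (h : P.Run B (Config.init input) t σ) {b : Bool} (hb : P[σ.pc]? = some (.halt b)) :
    P.WordsBounded input B := by
  have hstep : P.step σ = σ := by simp only [Program.step, hb, Instr.exec]
  intro i
  rcases le_total i t with hi | hi
  · exact h.2 i hi
  · obtain ⟨j, rfl⟩ := Nat.exists_eq_add_of_le hi
    intro a
    rw [Program.configAt, add_comm, Function.iterate_add_apply, h.1,
      Function.iterate_fixed hstep]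
    exact h.le a

/-- The length W of the input is recovered from the input itself: entry 3 n + 2 is the last offset,
the total length of the adjacency lists, and 3 n + 3 entries precede these. The additive part of the
time bound pays for this and for the final test. -/
theorem Cmd.machine_spec (c : Cmd) (x y : Arith) {input : List ℕ} {I : ℕ → ℕ} {W M T B : ℕ}
    {ans : Prop} (hinput : ∀ a, input.getD a 0 = I a) (hIW : ∀ a, W ≤ a → I a = 0)
    (hW : W = 3 * I 0 + 3 + I (3 * I 0 + 2)) (hM : ∀ a, I a ≤ M)
    (hB : 8 * ((c.size + x.size + y.size) * (M + 1)) + W + 9 ≤ B)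
    (hwp : c.wp I M (fun s => s.time ≤ T ∧ (x.eval I s < y.eval I s ↔ ¬ ans))
      ⟨fun _ => 0, fun _ _ => 0, 0⟩) :
    (∃ t ≤ (c.len + (testCode x y).length + 20) * (T + 1), ∃ b : Bool,
      (c.machine x y).HaltsWith input t b ∧ (b = true ↔ ans)) ∧
      (c.machine x y).WordsBounded input B := by
  set P := c.machine x y with hP
  have hMB : M ≤ B := by
    have := x.size_pos
    nlinarith
  have h0 : (Config.init input).Le B := fun a => ⟨Nat.zero_le _, by
    change input.getD a 0 ≤ B
    rw [hinput]
    exact (hM a).trans hMB⟩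
  have hm : (Config.init input).mem = I := funext hinput
  obtain ⟨hcode1, hcode⟩ := (P.codeAt_self).append
  obtain ⟨hcode2, hcode⟩ := Program.CodeAt.append hcode
  obtain ⟨hcode3, hcode⟩ := Program.CodeAt.append hcode
  rw [c.length_code] at hcode3 hcode
  change P.CodeAt 10 _ at hcode2
  change P.CodeAt (10 + c.len) _ at hcode3
  change P.CodeAt (10 + c.len + _) _ at hcode
  obtain ⟨i0, hcode1⟩ := hcode1.cons
  obtain ⟨i1, hcode1⟩ := hcode1.cons
  obtain ⟨i2, hcode1⟩ := hcode1.cons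
  obtain ⟨i3, hcode1⟩ := hcode1.cons
  obtain ⟨i4, hcode1⟩ := hcode1.cons
  obtain ⟨i5, hcode1⟩ := hcode1.cons
  obtain ⟨i6, hcode1⟩ := hcode1.cons
  obtain ⟨i7, hcode1⟩ := hcode1.cons
  obtain ⟨i8, hcode1⟩ := hcode1.cons
  obtain ⟨i9, -⟩ := hcode1.cons
  have r := (Program.Run.refl (P := P) h0).snoc i0 rfl (by omega)
  have r := r.snoc i1 rfl (r.le _).2
  have r := r.snoc i2 rfl (by simp [Config.write, hm]; omega)
  have r := r.snoc i3 rfl (by simp [Config.write, hm]; omega)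
  have r := r.snoc i4 rfl (by omega)
  have r := r.snoc i5 rfl (by simp [Config.write, hm]; omega)
  have r := r.snoc i6 rfl (r.le _).2
  have r := r.snoc i7 rfl (by
    simp only [Config.write, Config.init, hinput, Function.update_apply]
    simp
    rw [show I 0 + (I 0 + I 0) + 2 = 3 * I 0 + 2 by ring]
    omega)
  have r := r.snoc i8 rfl (by omega)
  have r := r.snoc i9 rfl (by
    simp only [Config.write, Config.init, hinput, Function.update_apply]
    simp
    rw [show I 0 + (I 0 + I 0) + 2 = 3 * I 0 + 2 by ring]
    omega)
  obtain ⟨σ, hσ⟩ : ∃ σ, P.Run B (Config.init input) 10 σ ∧ σ.pc = 10 ∧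
      Store.Repr I W ⟨fun _ => 0, fun _ _ => 0, 0⟩ σ := by
    refine ⟨_, r, rfl, ?_, fun i => ?_, ?_⟩
    · simp only [Config.write, Config.init, hinput, Function.update_apply]
      simp
      rw [show I 0 + (I 0 + I 0) + 2 = 3 * I 0 + 2 by ring]
      omega
    · have e1 : 2 * i.idx + 2 ≠ 1 := by omega
      have e3 : 2 * i.idx + 2 ≠ 3 := by omega
      have e0 : 2 * i.idx + 2 ≠ 0 := by omega
      simp [Config.write, Config.init, e1, e3]
    · ext a
      simp only [Config.write, hm, Store.image]
      split_ifs with h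
      · rfl
      · exact hIW a (by omega)
  clear r
  obtain ⟨r1, p1, q1⟩ := hσ
  obtain ⟨s2, σ2, t2, ⟨hT, hans⟩, l2, q2, r2, p2, ht2⟩ := c.run_code
    (S := c.size + x.size + y.size) (K := c.len + (testCode x y).length + 20) hM hIW hB hMB
    (by omega) (by omega) _ _ hwp ⟨fun _ => Nat.zero_le _, fun _ _ => Nat.zero_le _⟩ σ r1.le q1
    (by rwa [p1])
  rw [p1] at p2
  obtain ⟨σ3, r3, p3, -, e1, e3⟩ := run_testCode (S := c.size + x.size + y.size) hM hIW hB l2 x y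
    (by omega) σ2 r2.le q2 (by rwa [p2])
  rw [p2] at p3
  rw [← p3] at hcode
  obtain ⟨j1, hcode⟩ := hcode.cons
  obtain ⟨j2, hcode⟩ := hcode.cons
  obtain ⟨j3, -⟩ := hcode.cons
  have r4 := Program.Run.single j1 r3.le (r3.le.jump _)
  have r := ((r1.trans r2).trans r3).trans r4
  have ht : 10 + t2 + (testCode x y).length + 1 ≤
      (c.len + (testCode x y).length + 20) * (T + 1) := by
    have := Nat.mul_le_mul_left (c.len + (testCode x y).length + 20) hT
    rw [mul_add]
    omega
  by_cases h : x.eval I s2 < y.eval I s2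
  · simp only [Instr.exec, e1, e3, if_pos h] at r
    have hh : P[σ3.pc + 2]? = some (.halt false) := j3
    refine ⟨⟨_, ht, false, ?_, by simp [hans.1 h]⟩, Program.wordsBounded_of_run r hh⟩
    rw [Program.HaltsWith, Program.configAt, r.1]
    exact hh
  · simp only [Instr.exec, e1, e3, if_neg h] at r
    have hh : P[σ3.pc + 1]? = some (.halt true) := j2
    refine ⟨⟨_, ht, true, ?_, by simpa using fun hc => h (hans.2 hc)⟩,
      Program.wordsBounded_of_run r hh⟩
    rw [Program.HaltsWith, Program.configAt, r.1]
    exact hh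

/-! ### Encoded instances -/

section Input

variable (I : ℕ → ℕ)

/-- The colour of `v` in the first colouring. -/
def srcCol (v : ℕ) : ℕ := I (2 + v)

/-- The colour of `v` in the second colouring. -/
def tgtCol (v : ℕ) : ℕ := I (2 + I 0 + v)

/-- The position at which the adjacency list of `v` starts. -/
def offset (v : ℕ) : ℕ := I (2 + (I 0 + I 0) + v)

/-- The entry at position `j` of the concatenated adjacency lists. -/
def nbr (j : ℕ) : ℕ := I (3 + (I 0 + (I 0 + I 0)) + j)

/-- The positions in the adjacency list of `v`. -/
def slots (v : ℕ) : Finset ℕ := Finset.Ico (offset I v) (offset I (v + 1))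

/-- The input encodes a graph with two proper `3`-colourings. -/
structure IsNet : Prop where
  offset_zero : offset I 0 = 0
  offset_le : ∀ v < I 0, offset I v ≤ offset I (v + 1)
  nbr_lt : ∀ v < I 0, ∀ j ∈ slots I v, nbr I j < I 0
  inj : ∀ v < I 0, ∀ i ∈ slots I v, ∀ j ∈ slots I v, nbr I i = nbr I j → i = j
  symm : ∀ v < I 0, ∀ j ∈ slots I v, ∃ i ∈ slots I (nbr I j), nbr I i = v
  src_lt : ∀ v < I 0, srcCol I v < 3
  tgt_lt : ∀ v < I 0, tgtCol I v < 3
  src_ne : ∀ v < I 0, ∀ j ∈ slots I v, srcCol I (nbr I j) ≠ srcCol I v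
  tgt_ne : ∀ v < I 0, ∀ j ∈ slots I v, tgtCol I (nbr I j) ≠ tgtCol I v

variable {I}

theorem IsNet.offset_mono (h : IsNet I) {u v : ℕ} (huv : u ≤ v) (hv : v ≤ I 0) :
    offset I u ≤ offset I v := by
  induction v, huv using Nat.le_induction with
  | base => exact le_rfl
  | succ v _ ih => exact (ih (by omega)).trans (h.offset_le v (by omega))

theorem IsNet.offset_le_total (h : IsNet I) {v : ℕ} (hv : v < I 0) :
    offset I (v + 1) ≤ offset I (I 0) := h.offset_mono hv le_rfl

theorem IsNet.sum_card_slots (h : IsNet I) {k : ℕ} (hk : k ≤ I 0) :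
    ∑ v ∈ Finset.range k, (slots I v).card = offset I k := by
  induction k with
  | zero => simp [h.offset_zero]
  | succ k ih =>
    rw [Finset.sum_range_succ, ih (by omega), slots, Nat.card_Ico]
    have := h.offset_le k (by omega)
    omega

/-- Each pass charges a constant times degree plus one to each vertex; this is the resulting linear
total. -/
theorem IsNet.sum_card_slots_le (h : IsNet I) {U : Finset ℕ} (hU : ∀ u ∈ U, u < I 0) :
    ∑ v ∈ U, ((slots I v).card + 1) ≤ offset I (I 0) + I 0 := by
  calc ∑ v ∈ U, ((slots I v).card + 1)
      ≤ ∑ v ∈ Finset.range (I 0), ((slots I v).card + 1) :=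
        Finset.sum_le_sum_of_subset fun u hu => Finset.mem_range.2 (hU u hu)
    _ = offset I (I 0) + I 0 := by
        rw [Finset.sum_add_distrib, h.sum_card_slots le_rfl]
        simp

/-- The expression for the number of vertices. -/
def Arith.order : Arith := .inp (.lit 0)

/-- The expression for a colour in the first colouring. -/
def Arith.srcCol (e : Arith) : Arith := .inp (.add (.lit 2) e)

/-- The expression for a colour in the second colouring. -/
def Arith.tgtCol (e : Arith) : Arith := .inp (.add (.add (.lit 2) .order) e)

/-- The expression for the start of an adjacency list. -/
def Arith.offset (e : Arith) : Arith := .inp (.add (.add (.lit 2) (.add .order .order)) e)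

/-- The expression for an entry of the adjacency lists. -/
def Arith.nbr (e : Arith) : Arith :=
  .inp (.add (.add (.lit 3) (.add .order (.add .order .order))) e)

theorem Arith.eval_order (s : Store) : Arith.order.eval I s = I 0 := rfl

theorem Arith.eval_srcCol (s : Store) (e : Arith) :
    (Arith.srcCol e).eval I s = _root_.srcCol I (e.eval I s) := rfl

theorem Arith.eval_tgtCol (s : Store) (e : Arith) :
    (Arith.tgtCol e).eval I s = _root_.tgtCol I (e.eval I s) := rfl

theorem Arith.eval_offset (s : Store) (e : Arith) :
    (Arith.offset e).eval I s = _root_.offset I (e.eval I s) := rfl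

theorem Arith.eval_nbr (s : Store) (e : Arith) :
    (Arith.nbr e).eval I s = _root_.nbr I (e.eval I s) := rfl

theorem Arith.small_order (M : ℕ) (s : Store) : Arith.order.Small I M s := trivial

theorem Arith.small_srcCol (M : ℕ) (s : Store) (e : Arith) : (Arith.srcCol e).Small I M s :=
  trivial

theorem Arith.small_tgtCol (M : ℕ) (s : Store) (e : Arith) : (Arith.tgtCol e).Small I M s :=
  trivial

theorem Arith.small_offset (M : ℕ) (s : Store) (e : Arith) : (Arith.offset e).Small I M s :=
  trivial

theorem Arith.small_nbr (M : ℕ) (s : Store) (e : Arith) : (Arith.nbr e).Small I M s := trivial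

end Input

/-! ### Scanning an adjacency list -/

infixr:60 " ;; " => Cmd.seq

/-- Run `body` for each position `j` in the adjacency list of `v`. -/
def Cmd.scan (body : Cmd) : Cmd :=
  .set .j (.offset (.var .v)) ;;
  .loop (.var .j) (.offset (.add (.var .v) (.lit 1)))
    (body ;; .set .j (.add (.var .j) (.lit 1)))

section Scan

variable {I : ℕ → ℕ} {M : ℕ}

/-- The predicate J i describes the state when the positions before i are done. The constant c
counts the loop test and the body; the additional unit per position is the increment of j. -/
theorem Cmd.wp_scan {body : Cmd} {Q : Store → Prop} {s : Store} {v : ℕ} (J : ℕ → Store → Prop)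
    (c : ℕ) (hv : s.var .v = v) (hle : offset I v ≤ offset I (v + 1))
    (hM : offset I (v + 1) ≤ M)
    (hstart : J (offset I v) ⟨Function.update s.var .j (offset I v), s.arr, s.time + 1⟩)
    (hbody : ∀ i s', i ∈ slots I v → s'.var .v = v → s'.var .j = i → J i s' →
      body.wp I M (fun s'' => s''.var .v = v ∧ s''.var .j = i ∧ s''.time ≤ s'.time + c ∧
        J (i + 1) ⟨Function.update s''.var .j (i + 1), s''.arr, s''.time + 1⟩) s'.tick)
    (hQ : ∀ s', s'.var .v = v → s'.time + 1 ≤ s.time + 2 + (c + 1) * (slots I v).card →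
      J (offset I (v + 1)) s' → Q s'.tick) :
    (Cmd.scan body).wp I M Q s := by
  refine ⟨trivial, ?_⟩
  simp only [Arith.eval_offset, Arith.eval, hv]
  refine Cmd.wp_loop (fun s' => s'.var .v = v ∧ offset I v ≤ s'.var .j ∧
    s'.var .j ≤ offset I (v + 1) ∧ s'.time ≤ s.time + 1 + (c + 1) * (s'.var .j - offset I v) ∧
    J (s'.var .j) s') (s.time + 1 + (c + 1) * (offset I (v + 1) - offset I v)) ?_ ?_ ?_ ?_
  · simp [hv, hle, hstart]
  · rintro s' ⟨h1, h2, h3, h4, h5⟩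
    refine h4.trans (Nat.add_le_add_left (Nat.mul_le_mul_left _ (by omega)) _)
  · rintro s' ⟨h1, h2, h3, h4, h5⟩ hlt
    simp only [Arith.eval_offset, Arith.eval, h1] at hlt
    refine Cmd.wp_mono body ?_ _
      (hbody (s'.var .j) s' (Finset.mem_Ico.2 ⟨h2, hlt⟩) h1 rfl h5)
    rintro s'' ⟨k1, k2, k3, k4⟩
    simp only [Cmd.wp, Arith.Small, Arith.eval, k2]
    refine ⟨by omega, ?_⟩
    simp only [Function.update_self, ne_eq, reduceCtorEq, not_false_eq_true,
      Function.update_of_ne]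
    refine ⟨k1, by omega, by omega, ?_, k4⟩
    rw [show s'.var .j + 1 - offset I v = s'.var .j - offset I v + 1 by omega, mul_add]
    omega
  · rintro s' ⟨h1, h2, h3, h4, h5⟩ hlt
    simp only [Arith.eval_offset, Arith.eval, h1] at hlt
    have e : s'.var .j = offset I (v + 1) := by omega
    rw [e] at h4 h5
    exact hQ s' h1 (by rw [slots, Nat.card_Ico]; omega) h5

end Scan

/-! ### Queues -/

/-- The set of the first `k` values of `q`. -/
def firsts (q : ℕ → ℕ) (k : ℕ) : Finset ℕ := (Finset.range k).image q

theorem firsts_succ (q : ℕ → ℕ) (k : ℕ) : firsts q (k + 1) = insert (q k) (firsts q k) := by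
  rw [firsts, Finset.range_add_one, Finset.image_insert, firsts]

theorem firsts_update {q : ℕ → ℕ} {k t : ℕ} (h : k ≤ t) (u : ℕ) :
    firsts (Function.update q t u) k = firsts q k :=
  Finset.image_congr fun i hi => by
    have : i < k := by simpa using hi
    exact Function.update_of_ne (by omega) _ _

theorem firsts_update_succ (q : ℕ → ℕ) (t u : ℕ) :
    firsts (Function.update q t u) (t + 1) = insert u (firsts q t) := by
  rw [firsts_succ, Function.update_self, firsts_update le_rfl]

theorem mem_firsts {q : ℕ → ℕ} {k u : ℕ} : u ∈ firsts q k ↔ ∃ i < k, q i = u := by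
  simp [firsts]

theorem firsts_mono (q : ℕ → ℕ) {k l : ℕ} (h : k ≤ l) : firsts q k ⊆ firsts q l :=
  Finset.image_subset_image (Finset.range_subset_range.2 h)

/-- The first `t` values of `q` are distinct numbers below `n`, and `mark` is the indicator
function of the set of these. -/
structure IsQueue (n : ℕ) (mark q : ℕ → ℕ) (t : ℕ) : Prop where
  card : (firsts q t).card = t
  lt : ∀ u ∈ firsts q t, u < n
  mark_eq : ∀ u, mark u = if u ∈ firsts q t then 1 else 0

section Queue

variable {n t : ℕ} {mark q : ℕ → ℕ}

theorem IsQueue.le (h : IsQueue n mark q t) : t ≤ n := by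
  have := Finset.card_le_card (s := firsts q t) (t := Finset.range n)
    (fun u hu => Finset.mem_range.2 (h.lt u hu))
  rwa [h.card, Finset.card_range] at this

theorem IsQueue.mem_iff (h : IsQueue n mark q t) (u : ℕ) : u ∈ firsts q t ↔ mark u ≠ 0 := by
  rw [h.mark_eq]
  split_ifs with hu <;> simp [hu]

theorem IsQueue.push (h : IsQueue n mark q t) {u : ℕ} (hu : u < n) (hm : mark u = 0) :
    IsQueue n (Function.update mark u 1) (Function.update q t u) (t + 1) := by
  have hnot : u ∉ firsts q t := fun hc => (h.mem_iff u).1 hc hm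
  refine ⟨?_, ?_, fun x => ?_⟩
  · rw [firsts_update_succ, Finset.card_insert_of_notMem hnot, h.card]
  · rw [firsts_update_succ]
    intro x hx
    rcases Finset.mem_insert.1 hx with rfl | hx
    · exact hu
    · exact h.lt x hx
  · rw [firsts_update_succ]
    by_cases hx : x = u
    · subst hx
      simp
    · simp [hx, h.mark_eq x]

theorem IsQueue.injOn (h : IsQueue n mark q t) : Set.InjOn q (Finset.range t) := by
  refine Finset.card_image_iff.1 ?_
  rw [Finset.card_range]
  exact h.card

theorem IsQueue.notMem (h : IsQueue n mark q t) {i : ℕ} (hi : i < t) : q i ∉ firsts q i := by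
  intro hc
  obtain ⟨k, hk, hq⟩ := mem_firsts.1 hc
  have := h.injOn (by simp; omega) (by simp; omega) hq
  omega

end Queue

/-! ### The frozen vertices of the first colouring -/

section Core

variable {I : ℕ → ℕ}

/-- A set of vertices each of which has neighbours of both other colours in the set. -/
def IsCoreSet (I : ℕ → ℕ) (K : Set ℕ) : Prop :=
  ∀ v ∈ K, v < I 0 ∧ ∀ c < 3, c ≠ srcCol I v → ∃ i ∈ slots I v, nbr I i ∈ K ∧ srcCol I (nbr I i) = c

/-- The union of these sets. -/
def core (I : ℕ → ℕ) : Set ℕ := {v | ∃ K, IsCoreSet I K ∧ v ∈ K}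

/-- The number of neighbours of `u` of colour `c` outside `S`, increased by one for the colour
of `u` itself. -/
def aliveCount (I : ℕ → ℕ) (u c : ℕ) (S : Finset ℕ) : ℕ :=
  ((slots I u).filter fun i => srcCol I (nbr I i) = c ∧ nbr I i ∉ S).card +
    if c = srcCol I u then 1 else 0

/-- A core set that contains u would need a neighbour of u of colour c, which would lie in S and in
the core. Because the colour of u itself always counts one, all three colours can be tested alike.
-/
theorem notMem_core_of_aliveCount_eq_zero {u c : ℕ} {S : Finset ℕ} (hc : c < 3)
    (h : aliveCount I u c S = 0) (hS : ∀ x ∈ S, x ∉ core I) : u ∉ core I := by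
  rintro ⟨K, hK, hu⟩
  obtain ⟨h1, h2⟩ := Nat.add_eq_zero_iff.1 h
  have hne : c ≠ srcCol I u := by
    intro hc
    simp [hc] at h2
  obtain ⟨i, hi, hiK, hic⟩ := (hK u hu).2 c hc hne
  rw [Finset.card_eq_zero, Finset.filter_eq_empty_iff] at h1
  refine h1 hi ⟨hic, fun hiS => hS _ hiS ⟨K, hK, hiK⟩⟩

/-- When peeling stops, the set of the remaining vertices is itself a core set. -/
theorem mem_core_of_forall_aliveCount {S : Finset ℕ} (hI : IsNet I)
    (h : ∀ u < I 0, u ∉ S → ∀ c < 3, 0 < aliveCount I u c S) {v : ℕ} (hv : v < I 0)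
    (hvS : v ∉ S) : v ∈ core I := by
  refine ⟨{u | u < I 0 ∧ u ∉ S}, fun u ⟨hu, huS⟩ => ⟨hu, fun c hc hne => ?_⟩, hv, hvS⟩
  have h1 := h u hu huS c hc
  rw [aliveCount, if_neg hne, add_zero, Finset.card_pos] at h1
  obtain ⟨i, hi⟩ := h1
  obtain ⟨hi, hic, hiS⟩ := Finset.mem_filter.1 hi
  exact ⟨i, hi, ⟨hI.nbr_lt u hu i hi, hiS⟩, hic⟩

theorem aliveCount_insert_of_forall_ne {u c v : ℕ} {S : Finset ℕ}
    (h : ∀ i ∈ slots I u, srcCol I (nbr I i) = c → nbr I i ≠ v) :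
    aliveCount I u c (insert v S) = aliveCount I u c S := by
  unfold aliveCount
  congr 2
  refine Finset.filter_congr fun i hi => ?_
  refine and_congr_right fun hc => ?_
  simp [h i hi hc]

/-- Adjacency lists have no repetitions, so removing v takes exactly one from the count at a
neighbour, and only in the colour of v. -/
theorem aliveCount_insert (hI : IsNet I) {u v : ℕ} {S : Finset ℕ} (hu : u < I 0) {i : ℕ}
    (hi : i ∈ slots I u) (hiv : nbr I i = v) (hv : v ∉ S) :
    aliveCount I u (srcCol I v) S = aliveCount I u (srcCol I v) (insert v S) + 1 := by
  unfold aliveCount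
  have : (slots I u).filter (fun i => srcCol I (nbr I i) = srcCol I v ∧ nbr I i ∉ S) =
      insert i ((slots I u).filter fun i => srcCol I (nbr I i) = srcCol I v ∧
        nbr I i ∉ insert v S) := by
    ext k
    simp only [Finset.mem_filter, Finset.mem_insert, not_or]
    constructor
    · rintro ⟨h1, h2, h3⟩
      by_cases hk : nbr I k = v
      · exact Or.inl (hI.inj u hu k h1 i hi (hk.trans hiv.symm))
      · exact Or.inr ⟨h1, h2, hk, h3⟩
    · rintro (rfl | ⟨h1, h2, h3, h4⟩)
      · exact ⟨hi, by rw [hiv], by rwa [hiv]⟩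
      · exact ⟨h1, h2, h4⟩
  rw [this, Finset.card_insert_of_notMem (by simp [hiv])]
  omega

end Core

/-! ### Counting the neighbours of each colour -/

/-- The index of the entry of the vertex `e` and the colour `c`. -/
def Arith.cell (e c : Arith) : Arith := .add e (.add e (.add e c))

/-- Append the vertex `e` to a list and mark it. -/
def Cmd.push (mark list : Arr) (e : Arith) : Cmd :=
  .put mark e (.lit 1) ;; .put list (.var .tl) e ;; .set .tl (.add (.var .tl) (.lit 1))

/-- Count the neighbours of each colour, and list the vertices that lack a colour. -/
def countCmd : Cmd :=
  .set .tl (.lit 0) ;; .set .v (.lit 0) ;;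
  .loop (.var .v) .order
    (.put .count (.cell (.var .v) (.srcCol (.var .v))) (.lit 1) ;;
    .scan (.set .x (.cell (.var .v) (.srcCol (.nbr (.var .j)))) ;;
      .put .count (.var .x) (.add (.arr .count (.var .x)) (.lit 1))) ;;
    .ite (.lit 0) (.add (.sub (.lit 1) (.arr .count (.cell (.var .v) (.lit 0))))
        (.add (.sub (.lit 1) (.arr .count (.cell (.var .v) (.lit 1))))
          (.sub (.lit 1) (.arr .count (.cell (.var .v) (.lit 2))))))
      (.push .mark .queue (.var .v)) .skip ;;
    .set .v (.add (.var .v) (.lit 1)))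

section Count

variable {I : ℕ → ℕ} {M : ℕ}

theorem card_filter_Ico_succ {p : ℕ → Prop} [DecidablePred p] {a b : ℕ} (h : a ≤ b) :
    ((Finset.Ico a (b + 1)).filter p).card =
      ((Finset.Ico a b).filter p).card + if p b then 1 else 0 := by
  rw [← Nat.succ_eq_add_one, Nat.Ico_succ_right_eq_insert_Ico h, Finset.filter_insert]
  split_ifs with hp
  · rw [Finset.card_insert_of_notMem (by simp)]
  · rfl

/-- The invariant of `countCmd` when the vertices before `v` are done. -/
structure CountInv (I : ℕ → ℕ) (T v : ℕ) (count mark queue : ℕ → ℕ) (tl time : ℕ) : Prop where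
  le : v ≤ I 0
  isQueue : IsQueue (I 0) mark queue tl
  count_eq : ∀ u < v, ∀ c < 3, count (u + (u + (u + c))) = aliveCount I u c ∅
  zero : ∀ i, v + (v + v) ≤ i → count i = 0
  alive : ∀ u < v, u ∈ firsts queue tl ∨ ∀ c < 3, 0 < aliveCount I u c ∅
  notMem_core : ∀ u ∈ firsts queue tl, u < v ∧ u ∉ core I
  time_le : time ≤ T + 20 * v + 4 * offset I v

theorem countCmd_wp (hI : IsNet I) (hM : 3 * I 0 + 20 + offset I (I 0) ≤ M) {Q : Store → Prop}
    {s : Store} (hcount : ∀ i, s.arr .count i = 0) (hmark : ∀ i, s.arr .mark i = 0)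
    (hQ : ∀ s' : Store, (∀ k, k ≠ .count → k ≠ .mark → k ≠ .queue → s'.arr k = s.arr k) →
      CountInv I (s.time + 2) (I 0) (s'.arr .count) (s'.arr .mark) (s'.arr .queue) (s'.var .tl)
        s'.time → Q s'.tick) :
    countCmd.wp I M Q s := by
  simp only [Cmd.wp_skip, Cmd.wp_set, Cmd.wp_put, Cmd.wp_seq, Cmd.wp_ite, Arith.Small,
    Arith.eval, Arith.eval_order, Arith.eval_srcCol, Arith.eval_tgtCol, Arith.eval_offset,
    Arith.eval_nbr, Arith.small_order, Arith.small_srcCol, Arith.small_tgtCol,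
    Arith.small_offset, Arith.small_nbr, Arith.cell, Store.tick, Function.update_self, ne_eq,
    reduceCtorEq, not_false_eq_true, Function.update_of_ne, true_and, countCmd]
  refine ⟨by omega, by omega, ?_⟩
  refine Cmd.wp_loop (fun s' => (∀ k, k ≠ .count → k ≠ .mark → k ≠ .queue → s'.arr k = s.arr k) ∧
      CountInv I (s.time + 2) (s'.var .v) (s'.arr .count) (s'.arr .mark) (s'.arr .queue)
        (s'.var .tl) s'.time) (s.time + 2 + 20 * I 0 + 4 * offset I (I 0)) ?_ ?_ ?_ ?_
  · simp only [Cmd.wp_skip, Cmd.wp_set, Cmd.wp_put, Cmd.wp_seq, Cmd.wp_ite, Arith.Small,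
    Arith.eval, Arith.eval_order, Arith.eval_srcCol, Arith.eval_tgtCol, Arith.eval_offset,
    Arith.eval_nbr, Arith.small_order, Arith.small_srcCol, Arith.small_tgtCol,
    Arith.small_offset, Arith.small_nbr, Arith.cell, Store.tick, Function.update_self, ne_eq,
    reduceCtorEq, not_false_eq_true, Function.update_of_ne, true_and]
    exact ⟨fun k _ _ _ => trivial, Nat.zero_le _, ⟨by simp [firsts], by simp [firsts], by
      simp [firsts, hmark]⟩, by omega, fun i _ => hcount i, by omega, by simp [firsts], by omega⟩
  · rintro s1 ⟨-, h⟩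
    have h1 := h.time_le
    have h2 := h.le
    have h3 := hI.offset_mono h2 le_rfl
    omega
  · rintro s1 ⟨hfr, hinv⟩ hlt
    simp only [Arith.eval, Arith.eval_order] at hlt
    obtain ⟨v, hv⟩ : ∃ v, s1.var .v = v := ⟨_, rfl⟩
    rw [hv] at hlt hinv
    have hoff := hI.offset_le_total hlt
    simp only [Cmd.wp_skip, Cmd.wp_set, Cmd.wp_put, Cmd.wp_seq, Cmd.wp_ite, Arith.Small,
      Arith.eval, Arith.eval_order, Arith.eval_srcCol, Arith.eval_tgtCol, Arith.eval_offset,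
      Arith.eval_nbr, Arith.small_order, Arith.small_srcCol, Arith.small_tgtCol,
      Arith.small_offset, Arith.small_nbr, Arith.cell, Store.tick, Function.update_self,
      ne_eq, reduceCtorEq, not_false_eq_true, Function.update_of_ne, true_and, hv]
    refine ⟨by omega, ?_⟩
    -- The row of v holds the counts over the positions before i, started with one for the colour of
    -- v; other rows are untouched.
    refine Cmd.wp_scan (v := v) (fun i s' =>
      (∀ k, k ≠ .count → s'.arr k = s1.arr k) ∧ s'.var .tl = s1.var .tl ∧
      (∀ c < 3, s'.arr .count (v + (v + (v + c))) = ((Finset.Ico (offset I v) i).filter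
        (fun i => srcCol I (nbr I i) = c)).card + if c = srcCol I v then 1 else 0) ∧
      ∀ x, (∀ c < 3, x ≠ v + (v + (v + c))) → s'.arr .count x = s1.arr .count x) 3 hv
        (hI.offset_le v hlt) (hoff.trans (by omega)) ?_ ?_ ?_
    · dsimp only
      refine ⟨fun k hk => by simp [hk], rfl, fun c hc => ?_, fun x hx => ?_⟩
      · rw [Function.update_self]
        by_cases h : c = srcCol I v
        · subst h
          simp
        · rw [Function.update_of_ne (by omega), hinv.zero _ (by omega)]
          simp [h]
      · rw [Function.update_self, Function.update_of_ne (hx _ (hI.src_lt v hlt))]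
    · rintro i s2 hi hv2 hj2 ⟨h1, h2, h3, h4⟩
      have hi' := Finset.mem_Ico.1 hi
      have hcol := hI.src_lt _ (hI.nbr_lt v hlt i hi)
      simp only [Cmd.wp_skip, Cmd.wp_set, Cmd.wp_put, Cmd.wp_seq, Cmd.wp_ite, Arith.Small,
        Arith.eval, Arith.eval_order, Arith.eval_srcCol, Arith.eval_tgtCol,
        Arith.eval_offset, Arith.eval_nbr, Arith.small_order, Arith.small_srcCol,
        Arith.small_tgtCol, Arith.small_offset, Arith.small_nbr, Arith.cell, Store.tick,
        Function.update_self, ne_eq, reduceCtorEq, not_false_eq_true, Function.update_of_ne,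
        true_and, hv2, hj2]
      refine ⟨by omega, ?_, by omega, fun k hk => ?_, h2, fun c hc => ?_, fun x hx => ?_⟩
      · rw [h3 _ hcol]
        have := Finset.card_filter_le (Finset.Ico (offset I v) i)
          (fun k => srcCol I (nbr I k) = srcCol I (nbr I i))
        rw [Nat.card_Ico] at this
        split_ifs <;> omega
      · rw [Function.update_of_ne hk, h1 k hk]
      · rw [card_filter_Ico_succ hi'.1]
        by_cases h : c = srcCol I (nbr I i)
        · subst h
          rw [Function.update_self, h3 _ hc, if_pos rfl]
          omega
        · rw [Function.update_of_ne (by omega), h3 c hc, if_neg (Ne.symm h)]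
          omega
      · rw [Function.update_of_ne (hx _ hcol), h4 x hx]
    · rintro s2 hv2 ht2 ⟨h1, h2, h3, h4⟩
      have hcnt : ∀ c < 3, s2.arr .count (v + (v + (v + c))) = aliveCount I v c ∅ := by
        intro c hc
        rw [h3 c hc]
        simp [aliveCount, slots]
      have e0 := hcnt 0 (by omega)
      have e1 := hcnt 1 (by omega)
      have e2 := hcnt 2 (by omega)
      have hcount' : ∀ u < v + 1, ∀ c < 3,
          s2.arr .count (u + (u + (u + c))) = aliveCount I u c ∅ := by
        intro u hu c hc
        by_cases huv : u = v
        · subst huv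
          exact hcnt c hc
        · rw [h4 _ (by omega), hinv.count_eq u (by omega) c hc]
      have hzero' : ∀ i, v + 1 + (v + 1 + (v + 1)) ≤ i → s2.arr .count i = 0 := by
        intro i hi
        rw [h4 _ (by omega), hinv.zero i (by omega)]
      have htime : s2.time + 8 ≤ s.time + 2 + 20 * (v + 1) + 4 * offset I (v + 1) := by
        have h5 := hinv.time_le
        have h6 := hI.offset_le v hlt
        rw [slots, Nat.card_Ico] at ht2
        dsimp only at ht2
        omega
      have hfr' : ∀ k, k ≠ .count → k ≠ .mark → k ≠ .queue → s2.arr k = s.arr k :=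
        fun k k1 k2 k3 => (h1 k k1).trans (hfr k k1 k2 k3)
      have hq := hinv.isQueue
      rw [← h1 .mark (by simp), ← h1 .queue (by simp), ← h2] at hq
      have halive := hinv.alive
      have hnot := hinv.notMem_core
      rw [← h1 .queue (by simp), ← h2] at halive hnot
      have htl := hq.le
      simp only [Cmd.wp_skip, Cmd.wp_set, Cmd.wp_put, Cmd.wp_seq, Cmd.wp_ite, Arith.Small,
        Arith.eval, Arith.eval_order, Arith.eval_srcCol, Arith.eval_tgtCol,
        Arith.eval_offset, Arith.eval_nbr, Arith.small_order, Arith.small_srcCol,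
        Arith.small_tgtCol, Arith.small_offset, Arith.small_nbr, Arith.cell, Store.tick,
        Function.update_self, ne_eq, reduceCtorEq, not_false_eq_true, Function.update_of_ne,
        true_and, hv2, Cmd.push, e0, e1, e2]
      refine ⟨fun hc => ⟨by omega, by omega, by omega, fun k k1 k2 k3 => ?_, ?_⟩,
        fun hc => ⟨by omega, hfr', ?_⟩⟩
      · rw [Function.update_of_ne k3, Function.update_of_ne k2, hfr' k k1 k2 k3]
      · have hvc : v ∉ core I := by
          -- The tested sum of the truncated differences 1 - count is positive exactly when one of
          -- the three counts is zero.
          obtain ⟨c, hc3, hc0⟩ : ∃ c < 3, aliveCount I v c ∅ = 0 := by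
            by_contra hcon
            push Not at hcon
            have := hcon 0 (by omega)
            have := hcon 1 (by omega)
            have := hcon 2 (by omega)
            omega
          exact notMem_core_of_aliveCount_eq_zero hc3 hc0 (by simp)
        have hm0 : s2.arr .mark v = 0 := by
          by_contra hcon
          exact absurd (hnot v ((hq.mem_iff v).2 hcon)).1 (lt_irrefl v)
        refine ⟨hlt, hq.push hlt hm0, hcount', hzero', fun u hu => ?_, fun u hu => ?_, by omega⟩
        · rw [firsts_update_succ]
          by_cases huv : u = v
          · exact Or.inl (huv ▸ Finset.mem_insert_self _ _)
          · exact (halive u (by omega)).imp_left (Finset.mem_insert_of_mem)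
        · rw [firsts_update_succ] at hu
          rcases Finset.mem_insert.1 hu with rfl | hu
          · exact ⟨Nat.lt_succ_self _, hvc⟩
          · exact ⟨(hnot u hu).1.trans (Nat.lt_succ_self _), (hnot u hu).2⟩
      · refine ⟨hlt, hq, hcount', hzero', fun u hu => ?_,
          fun u hu => ⟨(hnot u hu).1.trans (Nat.lt_succ_self _), (hnot u hu).2⟩, by omega⟩
        by_cases huv : u = v
        · subst huv
          refine Or.inr fun c hc3 => ?_
          interval_cases c <;> omega
        · exact halive u (by omega)
  · rintro s1 ⟨hfr, hinv⟩ hlt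
    simp only [Arith.eval, Arith.eval_order] at hlt
    have e : s1.var .v = I 0 := le_antisymm hinv.le (by omega)
    rw [e] at hinv
    exact hQ s1 hfr hinv

end Count

/-! ### Peeling off the vertices outside the core -/

/-- Remove the listed vertices one by one, and list the vertices that lack a colour after this. -/
def pruneCmd : Cmd :=
  .set .hd (.lit 0) ;;
  .loop (.var .hd) (.var .tl)
    (.set .v (.arr .queue (.var .hd)) ;; .set .hd (.add (.var .hd) (.lit 1)) ;;
    .scan (.set .w (.nbr (.var .j)) ;; .set .x (.cell (.var .w) (.srcCol (.var .v))) ;;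
      .put .count (.var .x) (.sub (.arr .count (.var .x)) (.lit 1)) ;;
      .ite (.add (.arr .count (.var .x)) (.arr .mark (.var .w))) (.lit 1)
        (.push .mark .queue (.var .w)) .skip))

section Prune

variable {I : ℕ → ℕ} {M : ℕ}

/-- The invariant of `pruneCmd`, in which `S u` is the set of the removed vertices as it is known
to the vertex `u`. -/
structure PruneInv (I : ℕ → ℕ) (S : ℕ → Finset ℕ) (count mark queue : ℕ → ℕ) (tl : ℕ) :
    Prop where
  isQueue : IsQueue (I 0) mark queue tl
  count_eq : ∀ u < I 0, ∀ c < 3, count (u + (u + (u + c))) = aliveCount I u c (S u)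
  alive : ∀ u < I 0, u ∈ firsts queue tl ∨ ∀ c < 3, 0 < aliveCount I u c (S u)
  notMem_core : ∀ u ∈ firsts queue tl, u ∉ core I

/-- The removed vertices as known to `u`, when the removal of `v` has been communicated to the
positions before `i` in its adjacency list. -/
def removedAt (I : ℕ → ℕ) (S : Finset ℕ) (v i u : ℕ) : Finset ℕ :=
  if u ∈ (Finset.Ico (offset I v) i).image (nbr I) then insert v S else S

theorem removedAt_succ_of_ne {S : Finset ℕ} {v i u : ℕ} (hi : offset I v ≤ i)
    (hu : u ≠ nbr I i) : removedAt I S v (i + 1) u = removedAt I S v i u := by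
  unfold removedAt
  rw [← Nat.succ_eq_add_one, Nat.Ico_succ_right_eq_insert_Ico hi, Finset.image_insert]
  simp only [Finset.mem_insert, hu, false_or]

theorem removedAt_succ_self {S : Finset ℕ} {v i : ℕ} (hi : offset I v ≤ i) :
    removedAt I S v (i + 1) (nbr I i) = insert v S := by
  unfold removedAt
  rw [if_pos]
  exact Finset.mem_image_of_mem _ (Finset.mem_Ico.2 ⟨hi, Nat.lt_succ_self i⟩)

theorem removedAt_self (hI : IsNet I) {S : Finset ℕ} {v i : ℕ} (hv : v < I 0)
    (hi : i ∈ slots I v) : removedAt I S v i (nbr I i) = S := by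
  unfold removedAt
  rw [if_neg]
  intro hc
  obtain ⟨k, hk, he⟩ := Finset.mem_image.1 hc
  have h1 := Finset.mem_Ico.1 hk
  have h2 := Finset.mem_Ico.1 hi
  have := hI.inj v hv k (Finset.mem_Ico.2 ⟨h1.1, by omega⟩) i hi he
  omega

/-- A vertex that was not told of the removal of v is not on the list of v; by symmetry v is not on
its list, so its counts do not involve v. -/
theorem aliveCount_removedAt_end (hI : IsNet I) {S : Finset ℕ} {v u : ℕ} (hu : u < I 0) (c : ℕ) :
    aliveCount I u c (removedAt I S v (offset I (v + 1)) u) = aliveCount I u c (insert v S) := by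
  unfold removedAt
  split_ifs with h
  · rfl
  · refine (aliveCount_insert_of_forall_ne fun i hi _ he => h ?_).symm
    obtain ⟨k, hk, hku⟩ := hI.symm u hu i hi
    rw [he] at hk
    exact Finset.mem_image.2 ⟨k, hk, hku⟩

/-- Each vertex enters the queue at most once and its list is scanned once, which gives the linear
time. No listed vertex is in the core, and at the end every unlisted one has a live neighbour of
each other colour. -/
theorem pruneCmd_wp (hI : IsNet I) (hM : 3 * I 0 + 20 + offset I (I 0) ≤ M) {Q : Store → Prop}
    {s : Store} (hinv : PruneInv I (fun _ => ∅) (s.arr .count) (s.arr .mark) (s.arr .queue)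
      (s.var .tl))
    (hQ : ∀ s' : Store, (∀ k, k ≠ .count → k ≠ .mark → k ≠ .queue → s'.arr k = s.arr k) →
      (∀ v < I 0, s'.arr .mark v = 0 ↔ v ∈ core I) →
      s'.time ≤ s.time + 1 + 13 * (offset I (I 0) + I 0) → Q s'.tick) :
    pruneCmd.wp I M Q s := by
  simp only [Cmd.wp_skip, Cmd.wp_set, Cmd.wp_put, Cmd.wp_seq, Cmd.wp_ite, Arith.Small,
    Arith.eval, Arith.eval_order, Arith.eval_srcCol, Arith.eval_tgtCol, Arith.eval_offset,
    Arith.eval_nbr, Arith.small_order, Arith.small_srcCol, Arith.small_tgtCol,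
    Arith.small_offset, Arith.small_nbr, Arith.cell, Store.tick, Function.update_self, ne_eq,
    reduceCtorEq, not_false_eq_true, Function.update_of_ne, true_and, pruneCmd]
  refine ⟨by omega, ?_⟩
  refine Cmd.wp_loop (fun s' => (∀ k, k ≠ .count → k ≠ .mark → k ≠ .queue → s'.arr k = s.arr k) ∧
      s'.var .hd ≤ s'.var .tl ∧
      PruneInv I (fun _ => firsts (s'.arr .queue) (s'.var .hd)) (s'.arr .count) (s'.arr .mark)
        (s'.arr .queue) (s'.var .tl) ∧
      s'.time ≤ s.time + 1 +
        13 * ∑ v ∈ firsts (s'.arr .queue) (s'.var .hd), ((slots I v).card + 1))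
    (s.time + 1 + 13 * (offset I (I 0) + I 0)) ?_ ?_ ?_ ?_
  · simp only [Cmd.wp_skip, Cmd.wp_set, Cmd.wp_put, Cmd.wp_seq, Cmd.wp_ite, Arith.Small,
    Arith.eval, Arith.eval_order, Arith.eval_srcCol, Arith.eval_tgtCol, Arith.eval_offset,
    Arith.eval_nbr, Arith.small_order, Arith.small_srcCol, Arith.small_tgtCol,
    Arith.small_offset, Arith.small_nbr, Arith.cell, Store.tick, Function.update_self, ne_eq,
    reduceCtorEq, not_false_eq_true, Function.update_of_ne, true_and]
    exact ⟨fun k _ _ _ => trivial, Nat.zero_le _, by simpa [firsts] using hinv, by omega⟩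
  · rintro s1 ⟨-, h1, h2, h3⟩
    refine h3.trans (Nat.add_le_add_left (Nat.mul_le_mul_left _ (hI.sum_card_slots_le
      fun u hu => h2.isQueue.lt u (firsts_mono _ h1 hu))) _)
  · rintro s1 ⟨hfr, hle, hinv, htime⟩ hlt
    simp only [Arith.eval] at hlt
    obtain ⟨h, hh⟩ : ∃ h, s1.var .hd = h := ⟨_, rfl⟩
    obtain ⟨v, hv⟩ : ∃ v, s1.arr .queue h = v := ⟨_, rfl⟩
    obtain ⟨S, hS⟩ : ∃ S, firsts (s1.arr .queue) h = S := ⟨_, rfl⟩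
    rw [hh] at hlt hle htime hinv
    rw [hS] at htime hinv
    have htl := hinv.isQueue.le
    have hvmem : v ∈ firsts (s1.arr .queue) (s1.var .tl) := mem_firsts.2 ⟨h, hlt, hv⟩
    have hvn := hinv.isQueue.lt v hvmem
    have hvS : v ∉ S := by
      rw [← hS, ← hv]
      exact hinv.isQueue.notMem hlt
    have hoff := hI.offset_le_total hvn
    simp only [Cmd.wp_skip, Cmd.wp_set, Cmd.wp_put, Cmd.wp_seq, Cmd.wp_ite, Arith.Small,
      Arith.eval, Arith.eval_order, Arith.eval_srcCol, Arith.eval_tgtCol, Arith.eval_offset,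
      Arith.eval_nbr, Arith.small_order, Arith.small_srcCol, Arith.small_tgtCol,
      Arith.small_offset, Arith.small_nbr, Arith.cell, Store.tick, Function.update_self,
      ne_eq, reduceCtorEq, not_false_eq_true, Function.update_of_ne, true_and, hh, hv]
    refine ⟨by omega, ?_⟩
    refine Cmd.wp_scan (v := v) (fun i s' =>
      (∀ k, k ≠ .count → k ≠ .mark → k ≠ .queue → s'.arr k = s1.arr k) ∧
      s'.var .hd = h + 1 ∧ h + 1 ≤ s'.var .tl ∧ s'.arr .queue h = v ∧
      firsts (s'.arr .queue) h = S ∧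
      PruneInv I (removedAt I S v i) (s'.arr .count) (s'.arr .mark) (s'.arr .queue) (s'.var .tl))
      8 (by simp) (hI.offset_le v hvn) (hoff.trans (by omega)) ?_ ?_ ?_
    · simp only [Cmd.wp_skip, Cmd.wp_set, Cmd.wp_put, Cmd.wp_seq, Cmd.wp_ite, Arith.Small,
      Arith.eval, Arith.eval_order, Arith.eval_srcCol, Arith.eval_tgtCol, Arith.eval_offset,
      Arith.eval_nbr, Arith.small_order, Arith.small_srcCol, Arith.small_tgtCol,
      Arith.small_offset, Arith.small_nbr, Arith.cell, Store.tick, Function.update_self,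
      ne_eq, reduceCtorEq, not_false_eq_true, Function.update_of_ne, true_and]
      refine ⟨fun k _ _ _ => trivial, hlt, hv, hS, ?_⟩
      have e : removedAt I S v (offset I v) = fun _ => S := funext fun u => by simp [removedAt]
      rwa [e]
    · rintro i s2 hi hv2 hj2 ⟨h1, h2, h3, h4, h5, h6⟩
      have hi' := Finset.mem_Ico.1 hi
      obtain ⟨w, hw⟩ : ∃ w, nbr I i = w := ⟨_, rfl⟩
      have hwn : w < I 0 := hw ▸ hI.nbr_lt v hvn i hi
      have hcol := hI.src_lt v hvn
      have hself : removedAt I S v i w = S := hw ▸ removedAt_self hI hvn hi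
      have hself' : removedAt I S v (i + 1) w = insert v S := hw ▸ removedAt_succ_self hi'.1
      have hother : ∀ u, u ≠ w → removedAt I S v (i + 1) u = removedAt I S v i u :=
        fun u hu => removedAt_succ_of_ne hi'.1 (hw ▸ hu)
      -- By symmetry v is on the list of w, so the count at w really decreases by one.
      obtain ⟨i', hi1, hi2⟩ := hI.symm v hvn i hi
      rw [hw] at hi1
      have hdec := aliveCount_insert hI hwn hi1 hi2 hvS
      have hsame : ∀ c, c ≠ srcCol I v → aliveCount I w c (insert v S) = aliveCount I w c S :=
        fun c hc => aliveCount_insert_of_forall_ne fun k _ hk he => hc (by rw [← hk, he])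
      have hcw := h6.count_eq w hwn _ hcol
      rw [hself, hdec] at hcw
      have hcount : ∀ u < I 0, ∀ c < 3,
          Function.update (s2.arr .count) (w + (w + (w + srcCol I v)))
            (aliveCount I w (srcCol I v) (insert v S)) (u + (u + (u + c))) =
            aliveCount I u c (removedAt I S v (i + 1) u) := by
        intro u hu c hc
        by_cases huw : u = w
        · subst huw
          rw [hself']
          by_cases hcv : c = srcCol I v
          · subst hcv
            rw [Function.update_self]
          · rw [Function.update_of_ne (by omega), h6.count_eq u hu c hc, hself, hsame c hcv]
        · rw [Function.update_of_ne (by omega), h6.count_eq u hu c hc, hother u huw]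
      have hq := h6.isQueue
      have htl2 := hq.le
      -- The removed vertices, v included, form an initial part of the queue, hence lie outside the
      -- core.
      have hins : ∀ x ∈ insert v S, x ∉ core I := by
        intro x hx
        rw [← h5, ← h4, ← firsts_succ] at hx
        exact h6.notMem_core x (firsts_mono _ h3 hx)
      have hfr2 : ∀ k, k ≠ Arr.count → k ≠ .mark → k ≠ .queue → ∀ f,
          Function.update s2.arr .count f k = s1.arr k := fun k k1 k2 k3 f => by
        rw [Function.update_of_ne k1, h1 k k1 k2 k3]
      simp only [Cmd.wp_skip, Cmd.wp_set, Cmd.wp_put, Cmd.wp_seq, Cmd.wp_ite, Arith.Small,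
        Arith.eval, Arith.eval_order, Arith.eval_srcCol, Arith.eval_tgtCol,
        Arith.eval_offset, Arith.eval_nbr, Arith.small_order, Arith.small_srcCol,
        Arith.small_tgtCol, Arith.small_offset, Arith.small_nbr, Arith.cell, Store.tick,
        Function.update_self, ne_eq, reduceCtorEq, not_false_eq_true, Function.update_of_ne,
        true_and, hv2, hj2, hw, hcw, Nat.add_sub_cancel, Cmd.push]
      -- The vertex w is listed when count + mark < 1, that is when the count has reached zero and w
      -- is not listed yet.
      refine ⟨by omega, fun hc => ⟨by omega, by omega, by omega, fun k k1 k2 k3 => ?_, h2,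
        by omega, ?_, ?_, hq.push hwn (by omega), hcount, fun u hu => ?_, fun u hu => ?_⟩,
        fun hc => ⟨by omega, fun k k1 k2 k3 => hfr2 k k1 k2 k3 _, h2, h3, h4, h5, hq, hcount,
          fun u hu => ?_, h6.notMem_core⟩⟩
      · rw [Function.update_of_ne k3, Function.update_of_ne k2, hfr2 k k1 k2 k3 _]
      · rw [Function.update_of_ne (by omega), h4]
      · rw [firsts_update (by omega), h5]
      · rw [firsts_update_succ]
        by_cases huw : u = w
        · exact Or.inl (huw ▸ Finset.mem_insert_self _ _)
        · rw [hother u huw]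
          exact (h6.alive u hu).imp_left Finset.mem_insert_of_mem
      · rw [firsts_update_succ] at hu
        rcases Finset.mem_insert.1 hu with rfl | hu
        · exact notMem_core_of_aliveCount_eq_zero hcol (by omega) hins
        · exact h6.notMem_core u hu
      · by_cases huw : u = w
        · subst huw
          rw [hself']
          rcases h6.alive u hu with h | h
          · exact Or.inl h
          · rw [hself] at h
            by_cases hmem : u ∈ firsts (s2.arr .queue) (s2.var .tl)
            · exact Or.inl hmem
            · have hm0 := not_not.1 (mt (hq.mem_iff u).2 hmem)
              refine Or.inr fun c hc3 => ?_
              by_cases hcv : c = srcCol I v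
              · subst hcv
                omega
              · rw [hsame c hcv]
                exact h c hc3
        · rw [hother u huw]
          exact h6.alive u hu
    · rintro s2 hv2 ht2 ⟨h1, h2, h3, h4, h5, h6⟩
      have e : firsts (s2.arr .queue) (h + 1) = insert v S := by rw [firsts_succ, h4, h5]
      simp only [Cmd.wp_skip, Cmd.wp_set, Cmd.wp_put, Cmd.wp_seq, Cmd.wp_ite, Arith.Small,
        Arith.eval, Arith.eval_order, Arith.eval_srcCol, Arith.eval_tgtCol,
        Arith.eval_offset, Arith.eval_nbr, Arith.small_order, Arith.small_srcCol,
        Arith.small_tgtCol, Arith.small_offset, Arith.small_nbr, Arith.cell, Store.tick,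
        Function.update_self, ne_eq, reduceCtorEq, not_false_eq_true, Function.update_of_ne,
        true_and, h2, e]
      refine ⟨fun k k1 k2 k3 => (h1 k k1 k2 k3).trans (hfr k k1 k2 k3), h3,
        ⟨h6.isQueue, fun u hu c hc => ?_, fun u hu => ?_, h6.notMem_core⟩, ?_⟩
      · rw [h6.count_eq u hu c hc, aliveCount_removedAt_end hI hu]
      · refine (h6.alive u hu).imp_right fun h c hc => ?_
        rw [← aliveCount_removedAt_end hI hu]
        exact h c hc
      · rw [Finset.sum_insert hvS]
        dsimp only at ht2
        omega
  · rintro s1 ⟨hfr, hle, hinv, htime⟩ hlt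
    simp only [Arith.eval] at hlt
    have e : s1.var .hd = s1.var .tl := by omega
    rw [e] at hinv htime
    refine hQ s1 hfr (fun v hv => ?_) (htime.trans (Nat.add_le_add_left (Nat.mul_le_mul_left _
      (hI.sum_card_slots_le hinv.isQueue.lt)) _))
    constructor
    · intro h0
      exact mem_core_of_forall_aliveCount hI
        (fun u hu hS => (hinv.alive u hu).resolve_left hS) hv
        (fun hmem => (hinv.isQueue.mem_iff v).1 hmem h0)
    · intro hcore
      by_contra h0
      exact hinv.notMem_core v ((hinv.isQueue.mem_iff v).2 h0) hcore

end Prune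

/-! ### Exploring a component -/

/-- Whether the colour `y` is the successor of the colour `x`. -/
def rise (x y : ℕ) : ℕ := if y + 3 - x = 1 ∨ y + 3 - x = 4 then 1 else 0

theorem rise_le (x y : ℕ) : rise x y ≤ 1 := by
  unfold rise
  split_ifs <;> omega

/-- The prescribed difference of the values of a shift at `w` and `v`. -/
def shiftStep (I : ℕ → ℕ) (v w : ℕ) : ℤ :=
  (rise (tgtCol I v) (tgtCol I w) : ℤ) - rise (srcCol I v) (srcCol I w)

/-- The level of a vertex with vanishing shift. -/
def baseLevel (I : ℕ → ℕ) : ℕ := 3 + (I 0 + (I 0 + I 0))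

/-- The expression for the level of a vertex with vanishing shift. -/
def Arith.base : Arith := .add (.lit 3) (.add .order (.add .order .order))

/-- Reject the instance. -/
def Cmd.reject : Cmd := .set .tot (.add (.inp (.lit 1)) (.lit 1))

/-- List the component of the vertex `r`, determine the levels of its vertices, and reject if
they are inconsistent. -/
def exploreCmd : Cmd :=
  .set .st (.var .tl) ;;
  .put .level (.var .r) (.sub (.add .base (.srcCol (.var .r))) (.tgtCol (.var .r))) ;;
  .push .seen .order (.var .r) ;;
  .loop (.var .hd) (.var .tl)
    (.set .v (.arr .order (.var .hd)) ;; .set .hd (.add (.var .hd) (.lit 1)) ;;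
    .scan (.set .w (.nbr (.var .j)) ;;
      .set .x (.sub (.add (.arr .level (.var .v))
          (.arr .table (.sub (.add (.tgtCol (.var .w)) (.lit 3)) (.tgtCol (.var .v)))))
        (.arr .table (.sub (.add (.srcCol (.var .w)) (.lit 3)) (.srcCol (.var .v))))) ;;
      .ite (.arr .seen (.var .w)) (.lit 1)
        (.put .level (.var .w) (.var .x) ;; .push .seen .order (.var .w))
        (.ite (.arr .level (.var .w)) (.var .x) .reject
          (.ite (.var .x) (.arr .level (.var .w)) .reject .skip))))

section Explore

variable {I : ℕ → ℕ} {M : ℕ}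

/-- The invariant of `exploreCmd`, in which `U` is the set of the vertices listed before, `R` is
the set of the edges examined so far, and `tot₀` is the initial value of `tot`. -/
structure ExploreInv (I : ℕ → ℕ) (U : Finset ℕ) (st r tot₀ : ℕ) (R : ℕ → ℕ → Prop)
    (seen order level : ℕ → ℕ) (tl tot : ℕ) : Prop where
  isQueue : IsQueue (I 0) seen order tl
  firsts_st : firsts order st = U
  st_lt : st < tl
  root : r ∈ firsts order tl ∧ r ∉ U
  level_root : level r + tgtCol I r = baseLevel I + srcCol I r
  bound : ∀ v ∈ firsts order tl, v ∉ U →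
    baseLevel I + st ≤ level v + tl + 1 ∧ level v + st ≤ baseLevel I + tl + 1
  arcs : ∀ u w, R u w → u ∉ U ∧ u ∈ firsts order tl ∧ w ∈ firsts order tl
  rigid : ∀ E : ℕ → ℤ, (∀ u w, R u w → E w - E u = shiftStep I u w) →
    ∀ u ∈ firsts order tl, u ∉ U → E u - E r = level u - level r
  tot_eq : (tot = tot₀ ∧ ∀ u w, R u w → (level w : ℤ) - level u = shiftStep I u w) ∨
    (tot = I 1 + 1 ∧ ∀ E : ℕ → ℤ, ¬ ∀ u w, R u w → E w - E u = shiftStep I u w)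

theorem shiftStep_abs (I : ℕ → ℕ) (v w : ℕ) : -1 ≤ shiftStep I v w ∧ shiftStep I v w ≤ 1 := by
  have h1 := rise_le (tgtCol I v) (tgtCol I w)
  have h2 := rise_le (srcCol I v) (srcCol I w)
  unfold shiftStep
  omega

variable {U : Finset ℕ} {st r tot₀ tl tot : ℕ} {R : ℕ → ℕ → Prop} {seen order level : ℕ → ℕ}

theorem ExploreInv.congr (h : ExploreInv I U st r tot₀ R seen order level tl tot)
    {R' : ℕ → ℕ → Prop} (hR : ∀ u w, R u w ↔ R' u w) :
    ExploreInv I U st r tot₀ R' seen order level tl tot := by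
  obtain rfl : R = R' := funext fun u => funext fun w => propext (hR u w)
  exact h

/-- The level of a new vertex is forced by the edge along which it is found. Levels move by at most
one per vertex and the root starts within 2 of the base, which gives the bound by the number of
listed vertices plus one. -/
theorem ExploreInv.extend (h : ExploreInv I U st r tot₀ R seen order level tl tot) {v w x : ℕ}
    (hv : v ∈ firsts order tl) (hvU : v ∉ U) (hw : w < I 0) (hws : seen w = 0)
    (hx : (x : ℤ) = level v + shiftStep I v w) :
    ExploreInv I U st r tot₀ (fun a b => R a b ∨ (a = v ∧ b = w)) (Function.update seen w 1)
      (Function.update order tl w) (Function.update level w x) (tl + 1) tot := by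
  have hnot : w ∉ firsts order tl := fun hc => (h.isQueue.mem_iff w).1 hc hws
  have hlev : ∀ u ∈ firsts order tl, Function.update level w x u = level u := by
    intro u hu
    refine Function.update_of_ne ?_ _ _
    rintro rfl
    exact hnot hu
  have hs := shiftStep_abs I v w
  have hr := h.root
  refine ⟨h.isQueue.push hw hws, ?_, h.st_lt.trans (Nat.lt_succ_self _), ?_, ?_, ?_, ?_, ?_, ?_⟩
  · rw [firsts_update h.st_lt.le, h.firsts_st]
  · rw [firsts_update_succ]
    exact ⟨Finset.mem_insert_of_mem hr.1, hr.2⟩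
  · rw [hlev r hr.1, h.level_root]
  · intro u hu huU
    rw [firsts_update_succ] at hu
    rcases Finset.mem_insert.1 hu with rfl | hu
    · rw [Function.update_self]
      have := h.bound v hv hvU
      omega
    · rw [hlev u hu]
      have := h.bound u hu huU
      omega
  · rintro a b (hab | ⟨rfl, rfl⟩)
    · rw [firsts_update_succ]
      obtain ⟨h1, h2, h3⟩ := h.arcs a b hab
      exact ⟨h1, Finset.mem_insert_of_mem h2, Finset.mem_insert_of_mem h3⟩
    · rw [firsts_update_succ]
      exact ⟨hvU, Finset.mem_insert_of_mem hv, Finset.mem_insert_self _ _⟩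
  · intro E hE u hu huU
    have hE' := h.rigid E (fun a b hab => hE a b (Or.inl hab))
    rw [firsts_update_succ] at hu
    rw [hlev r hr.1]
    rcases Finset.mem_insert.1 hu with rfl | hu
    · rw [Function.update_self]
      have h1 := hE v u (Or.inr ⟨rfl, rfl⟩)
      have h2 := hE' v hv hvU
      omega
    · rw [hlev u hu]
      exact hE' u hu huU
  · refine h.tot_eq.imp (fun ⟨h1, h2⟩ => ⟨h1, ?_⟩) (fun ⟨h1, h2⟩ => ⟨h1, fun E hE =>
      h2 E fun a b hab => hE a b (Or.inl hab)⟩)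
    rintro a b (hab | ⟨rfl, rfl⟩)
    · obtain ⟨-, k2, k3⟩ := h.arcs a b hab
      rw [hlev a k2, hlev b k3]
      exact h2 a b hab
    · rw [hlev a hv, Function.update_self]
      omega

theorem ExploreInv.keep (h : ExploreInv I U st r tot₀ R seen order level tl tot) {v w : ℕ}
    (hv : v ∈ firsts order tl) (hvU : v ∉ U) (hw : w ∈ firsts order tl)
    (hx : (level w : ℤ) = level v + shiftStep I v w) :
    ExploreInv I U st r tot₀ (fun a b => R a b ∨ (a = v ∧ b = w)) seen order level tl tot := by
  refine ⟨h.isQueue, h.firsts_st, h.st_lt, h.root, h.level_root, h.bound, ?_,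
    fun E hE => h.rigid E fun a b hab => hE a b (Or.inl hab), ?_⟩
  · rintro a b (hab | ⟨rfl, rfl⟩)
    · exact h.arcs a b hab
    · exact ⟨hvU, hv, hw⟩
  · refine h.tot_eq.imp (fun ⟨h1, h2⟩ => ⟨h1, ?_⟩) (fun ⟨h1, h2⟩ => ⟨h1, fun E hE =>
      h2 E fun a b hab => hE a b (Or.inl hab)⟩)
    rintro a b (hab | ⟨rfl, rfl⟩)
    · exact h2 a b hab
    · omega

/-- The edges examined so far force the levels of both ends relative to the root, so an edge that
contradicts them excludes every solution E. -/
theorem ExploreInv.reject (h : ExploreInv I U st r tot₀ R seen order level tl tot) {v w : ℕ}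
    (hv : v ∈ firsts order tl) (hvU : v ∉ U) (hw : w ∈ firsts order tl) (hwU : w ∉ U)
    (hx : (level w : ℤ) ≠ level v + shiftStep I v w) :
    ExploreInv I U st r tot₀ (fun a b => R a b ∨ (a = v ∧ b = w)) seen order level tl
      (I 1 + 1) := by
  refine ⟨h.isQueue, h.firsts_st, h.st_lt, h.root, h.level_root, h.bound, ?_,
    fun E hE => h.rigid E fun a b hab => hE a b (Or.inl hab), Or.inr ⟨rfl, fun E hE => hx ?_⟩⟩
  · rintro a b (hab | ⟨rfl, rfl⟩)
    · exact h.arcs a b hab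
    · exact ⟨hvU, hv, hw⟩
  · have hE' := h.rigid E (fun a b hab => hE a b (Or.inl hab))
    have h1 := hE v w (Or.inr ⟨rfl, rfl⟩)
    have h2 := hE' v hv hvU
    have h3 := hE' w hw hwU
    omega

/-- The edges examined when the vertices in `S` have been processed, and the vertex `v` up to the
position `i` in its adjacency list. -/
def arcsAt (I : ℕ → ℕ) (U S : Finset ℕ) (v i u w : ℕ) : Prop :=
  (u ∈ S ∧ u ∉ U ∧ ∃ k ∈ slots I u, nbr I k = w) ∨
    (u = v ∧ ∃ k ∈ Finset.Ico (offset I v) i, nbr I k = w)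

theorem arcsAt_succ {S : Finset ℕ} {v i : ℕ} (hi : offset I v ≤ i) (a b : ℕ) :
    (arcsAt I U S v i a b ∨ (a = v ∧ b = nbr I i)) ↔ arcsAt I U S v (i + 1) a b := by
  unfold arcsAt
  rw [← Nat.succ_eq_add_one, Nat.Ico_succ_right_eq_insert_Ico hi, or_assoc, ← and_or_left]
  simp only [Finset.mem_insert, exists_eq_or_imp]
  rw [or_comm (a := nbr I i = b), eq_comm (a := b)]

theorem exploreCmd_wp (hI : IsNet I) (hM : 7 * I 0 + 20 + offset I (I 0) + I 1 ≤ M)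
    {Q : Store → Prop} {s : Store}
    (htable : ∀ x y, s.arr .table (y + 3 - x) = rise x y)
    (hr : s.var .r < I 0) (hseen : s.arr .seen (s.var .r) = 0) (hhd : s.var .hd = s.var .tl)
    (hq : IsQueue (I 0) (s.arr .seen) (s.arr .order) (s.var .tl))
    (hU : ∀ u ∈ firsts (s.arr .order) (s.var .tl), ∀ k ∈ slots I u,
      nbr I k ∈ firsts (s.arr .order) (s.var .tl))
    (hQ : ∀ s' : Store, (∀ k, k ≠ .seen → k ≠ .order → k ≠ .level → s'.arr k = s.arr k) →
      s'.var .r = s.var .r → s'.var .st = s.var .tl → s'.var .hd = s'.var .tl →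
      ExploreInv I (firsts (s.arr .order) (s.var .tl)) (s.var .tl) (s.var .r) (s.var .tot)
        (fun u w => u ∈ firsts (s'.arr .order) (s'.var .tl) ∧
          u ∉ firsts (s.arr .order) (s.var .tl) ∧ ∃ k ∈ slots I u, nbr I k = w)
        (s'.arr .seen) (s'.arr .order) (s'.arr .level) (s'.var .tl) (s'.var .tot) →
      s'.time ≤ s.time + 5 + 16 * ∑ v ∈ firsts (s'.arr .order) (s'.var .tl) \
        firsts (s.arr .order) (s.var .tl), ((slots I v).card + 1) → Q s'.tick) :
    exploreCmd.wp I M Q s := by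
  obtain ⟨t, ht⟩ : ∃ t, s.var .tl = t := ⟨_, rfl⟩
  obtain ⟨r, hr'⟩ : ∃ r, s.var .r = r := ⟨_, rfl⟩
  obtain ⟨U, hU'⟩ : ∃ U, firsts (s.arr .order) t = U := ⟨_, rfl⟩
  rw [ht] at hhd hq hU hQ
  rw [hr'] at hr hseen hQ
  rw [hU'] at hU hQ
  have htn := hq.le
  have hsrc := hI.src_lt r hr
  have htgt := hI.tgt_lt r hr
  have hrU : r ∉ U := fun hc => (hq.mem_iff r).1 (hU' ▸ hc) hseen
  simp only [Cmd.wp_skip, Cmd.wp_set, Cmd.wp_put, Cmd.wp_seq, Cmd.wp_ite, Arith.Small,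
    Arith.eval, Arith.eval_order, Arith.eval_srcCol, Arith.eval_tgtCol, Arith.eval_offset,
    Arith.eval_nbr, Arith.small_order, Arith.small_srcCol, Arith.small_tgtCol,
    Arith.small_offset, Arith.small_nbr, Arith.cell, Store.tick, Function.update_self, ne_eq,
    reduceCtorEq, not_false_eq_true, Function.update_of_ne, true_and, exploreCmd, Cmd.push,
    Arith.base, ht, hr']
  refine ⟨by omega, by omega, by omega, ?_⟩
  refine Cmd.wp_loop (fun s' => (∀ k, k ≠ .seen → k ≠ .order → k ≠ .level → s'.arr k = s.arr k) ∧
      s'.var .r = r ∧ s'.var .st = t ∧ t ≤ s'.var .hd ∧ s'.var .hd ≤ s'.var .tl ∧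
      ExploreInv I U t r (s.var .tot)
        (fun u w => u ∈ firsts (s'.arr .order) (s'.var .hd) ∧ u ∉ U ∧ ∃ k ∈ slots I u, nbr I k = w)
        (s'.arr .seen) (s'.arr .order) (s'.arr .level) (s'.var .tl) (s'.var .tot) ∧
      s'.time ≤ s.time + 5 +
        16 * ∑ v ∈ firsts (s'.arr .order) (s'.var .hd) \ U, ((slots I v).card + 1))
    (s.time + 5 + 16 * (offset I (I 0) + I 0)) ?_ ?_ ?_ ?_
  · simp only [Cmd.wp_skip, Cmd.wp_set, Cmd.wp_put, Cmd.wp_seq, Cmd.wp_ite, Arith.Small,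
    Arith.eval, Arith.eval_order, Arith.eval_srcCol, Arith.eval_tgtCol, Arith.eval_offset,
    Arith.eval_nbr, Arith.small_order, Arith.small_srcCol, Arith.small_tgtCol,
    Arith.small_offset, Arith.small_nbr, Arith.cell, Store.tick, Function.update_self, ne_eq,
    reduceCtorEq, not_false_eq_true, Function.update_of_ne, true_and, hhd, hr', ht]
    refine ⟨fun k k1 k2 k3 => ?_, le_rfl, Nat.le_succ _, ⟨hq.push hr hseen, ?_, Nat.lt_succ_self _,
      ?_, ?_, ?_, ?_, ?_, ?_⟩, by omega⟩
    · rw [Function.update_of_ne k2, Function.update_of_ne k1, Function.update_of_ne k3]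
    · rw [firsts_update le_rfl, hU']
    · rw [firsts_update_succ, hU']
      exact ⟨Finset.mem_insert_self _ _, hrU⟩
    · rw [Function.update_self, baseLevel]
      omega
    · rw [firsts_update_succ, hU']
      intro v hv hvU
      obtain rfl := (Finset.mem_insert.1 hv).resolve_right hvU
      rw [Function.update_self, baseLevel]
      omega
    · rw [firsts_update le_rfl, hU']
      rintro u w ⟨h1, h2, -⟩
      exact absurd h1 h2
    · rw [firsts_update_succ, hU']
      intro E _ v hv hvU
      obtain rfl := (Finset.mem_insert.1 hv).resolve_right hvU
      simp
    · rw [firsts_update le_rfl, hU']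
      refine Or.inl ⟨rfl, ?_⟩
      rintro u w ⟨h1, h2, -⟩
      exact absurd h1 h2
  · rintro s1 ⟨-, -, -, -, h1, h2, h3⟩
    refine h3.trans (Nat.add_le_add_left (Nat.mul_le_mul_left _ (hI.sum_card_slots_le
      fun u hu => h2.isQueue.lt u (firsts_mono _ h1 (Finset.sdiff_subset hu)))) _)
  · rintro s1 ⟨hfr, hr1, hst, hth, hle, hinv, htime⟩ hlt
    simp only [Arith.eval] at hlt
    obtain ⟨h, hh⟩ : ∃ h, s1.var .hd = h := ⟨_, rfl⟩
    obtain ⟨v, hv⟩ : ∃ v, s1.arr .order h = v := ⟨_, rfl⟩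
    obtain ⟨S, hS⟩ : ∃ S, firsts (s1.arr .order) h = S := ⟨_, rfl⟩
    rw [hh] at hlt hle htime hinv hth
    rw [hS] at htime hinv
    have htl := hinv.isQueue.le
    have hvmem : v ∈ firsts (s1.arr .order) (s1.var .tl) := mem_firsts.2 ⟨h, hlt, hv⟩
    have hvn := hinv.isQueue.lt v hvmem
    have hvS : v ∉ S := by
      rw [← hS, ← hv]
      exact hinv.isQueue.notMem hlt
    have hvU : v ∉ U := by
      intro hc
      rw [← hinv.firsts_st] at hc
      exact hvS (hS ▸ firsts_mono _ hth hc)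
    have hoff := hI.offset_le_total hvn
    simp only [Cmd.wp_skip, Cmd.wp_set, Cmd.wp_put, Cmd.wp_seq, Cmd.wp_ite, Arith.Small,
      Arith.eval, Arith.eval_order, Arith.eval_srcCol, Arith.eval_tgtCol, Arith.eval_offset,
      Arith.eval_nbr, Arith.small_order, Arith.small_srcCol, Arith.small_tgtCol,
      Arith.small_offset, Arith.small_nbr, Arith.cell, Store.tick, Function.update_self,
      ne_eq, reduceCtorEq, not_false_eq_true, Function.update_of_ne, true_and, hh, hv]
    refine ⟨by omega, ?_⟩
    refine Cmd.wp_scan (v := v) (fun i s' =>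
      (∀ k, k ≠ .seen → k ≠ .order → k ≠ .level → s'.arr k = s.arr k) ∧
      s'.var .r = r ∧ s'.var .st = t ∧
      s'.var .hd = h + 1 ∧ h + 1 ≤ s'.var .tl ∧ s'.arr .order h = v ∧
      firsts (s'.arr .order) h = S ∧
      ExploreInv I U t r (s.var .tot) (arcsAt I U S v i)
        (s'.arr .seen) (s'.arr .order) (s'.arr .level) (s'.var .tl) (s'.var .tot))
      10 (by simp) (hI.offset_le v hvn) (hoff.trans (by omega)) ?_ ?_ ?_
    · simp only [Cmd.wp_skip, Cmd.wp_set, Cmd.wp_put, Cmd.wp_seq, Cmd.wp_ite, Arith.Small,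
      Arith.eval, Arith.eval_order, Arith.eval_srcCol, Arith.eval_tgtCol, Arith.eval_offset,
      Arith.eval_nbr, Arith.small_order, Arith.small_srcCol, Arith.small_tgtCol,
      Arith.small_offset, Arith.small_nbr, Arith.cell, Store.tick, Function.update_self,
      ne_eq, reduceCtorEq, not_false_eq_true, Function.update_of_ne, true_and]
      refine ⟨hfr, hr1, hst, hlt, hv, hS, hinv.congr fun u w => ?_⟩
      simp [arcsAt]
    · rintro i s2 hi hv2 hj2 ⟨h1, h2, h3, h4, h5, h6, h7, h8⟩
      have hi' := Finset.mem_Ico.1 hi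
      obtain ⟨w, hw⟩ : ∃ w, nbr I i = w := ⟨_, rfl⟩
      have hwn : w < I 0 := hw ▸ hI.nbr_lt v hvn i hi
      -- The old list is closed under neighbours, so by symmetry a neighbour in U would bring v into
      -- U.
      have hwU : w ∉ U := by
        intro hc
        obtain ⟨k, hk, hkv⟩ := hI.symm v hvn i hi
        rw [hw] at hk
        exact hvU (hkv ▸ hU w hc k hk)
      have htab2 : ∀ x y, s2.arr .table (y + 3 - x) = rise x y := fun x y => by
        rw [h1 .table (by simp) (by simp) (by simp), htable]
      have htl2 := h8.isQueue.le
      have hv2mem : v ∈ firsts (s2.arr .order) (s2.var .tl) := mem_firsts.2 ⟨h, by omega, h6⟩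
      have hbd := h8.bound v hv2mem hvU
      rw [baseLevel] at hbd
      have hr1 := rise_le (tgtCol I v) (tgtCol I w)
      have hr2 := rise_le (srcCol I v) (srcCol I w)
      have hst2 := h8.st_lt
      -- The base exceeds every possible drift of the levels, so the level of v is positive and the
      -- truncated subtraction is exact.
      obtain ⟨x, hx⟩ : ∃ x, s2.arr .level v + rise (tgtCol I v) (tgtCol I w) -
        rise (srcCol I v) (srcCol I w) = x := ⟨_, rfl⟩
      have hxs : (x : ℤ) = s2.arr .level v + shiftStep I v w := by
        unfold shiftStep
        omega
      have hcongr : ∀ a b, (arcsAt I U S v i a b ∨ (a = v ∧ b = w)) ↔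
          arcsAt I U S v (i + 1) a b := fun a b => hw ▸ arcsAt_succ hi'.1 a b
      simp only [Cmd.wp_skip, Cmd.wp_set, Cmd.wp_put, Cmd.wp_seq, Cmd.wp_ite, Arith.Small,
        Arith.eval, Arith.eval_order, Arith.eval_srcCol, Arith.eval_tgtCol,
        Arith.eval_offset, Arith.eval_nbr, Arith.small_order, Arith.small_srcCol,
        Arith.small_tgtCol, Arith.small_offset, Arith.small_nbr, Arith.cell, Store.tick,
        Function.update_self, ne_eq, reduceCtorEq, not_false_eq_true, Function.update_of_ne,
        true_and, hv2, hj2, hw, htab2, hx, Cmd.push, Cmd.reject]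
      refine ⟨by omega, fun hc => ⟨by omega, by omega, by omega, fun k k1 k2 k3 => ?_, h2, h3, h4,
        by omega, ?_, ?_, (h8.extend hv2mem hvU hwn (by omega) hxs).congr hcongr⟩, fun hc => ?_⟩
      · rw [Function.update_of_ne k2, Function.update_of_ne k1, Function.update_of_ne k3,
          h1 k k1 k2 k3]
      · rw [Function.update_of_ne (by omega), h6]
      · rw [firsts_update (by omega), h7]
      · have hwmem := (h8.isQueue.mem_iff w).2 (by omega)
        -- The two strict comparisons in the program detect any inequality; both lead to the same
        -- rejection.
        have hrej : s2.arr .level w ≠ x → ExploreInv I U t r (s.var .tot) (arcsAt I U S v (i + 1))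
            (s2.arr .seen) (s2.arr .order) (s2.arr .level) (s2.var .tl) (I 1 + 1) := fun hne =>
          (h8.reject hv2mem hvU hwmem hwU (by omega)).congr hcongr
        refine ⟨fun hc1 => ⟨by omega, by omega, h1, h2, h3, h4, h5, h6, h7, hrej (by omega)⟩,
          fun hc1 => ⟨fun hc2 => ⟨by omega, by omega, h1, h2, h3, h4, h5, h6, h7,
            hrej (by omega)⟩, fun hc2 => ⟨by omega, h1, h2, h3, h4, h5, h6, h7,
            (h8.keep hv2mem hvU hwmem (by omega)).congr hcongr⟩⟩⟩
    · rintro s2 hv2 ht2 ⟨h1, h2, h3, h4, h5, h6, h7, h8⟩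
      have e : firsts (s2.arr .order) (h + 1) = insert v S := by rw [firsts_succ, h6, h7]
      simp only [Cmd.wp_skip, Cmd.wp_set, Cmd.wp_put, Cmd.wp_seq, Cmd.wp_ite, Arith.Small,
        Arith.eval, Arith.eval_order, Arith.eval_srcCol, Arith.eval_tgtCol,
        Arith.eval_offset, Arith.eval_nbr, Arith.small_order, Arith.small_srcCol,
        Arith.small_tgtCol, Arith.small_offset, Arith.small_nbr, Arith.cell, Store.tick,
        Function.update_self, ne_eq, reduceCtorEq, not_false_eq_true, Function.update_of_ne,
        true_and, h4, e]
      refine ⟨h1, h2, h3, by omega, h5, h8.congr fun a b => ?_, ?_⟩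
      · unfold arcsAt
        simp only [Finset.mem_insert]
        constructor
        · rintro (⟨k1, k2, k3⟩ | ⟨rfl, k3⟩)
          · exact ⟨Or.inr k1, k2, k3⟩
          · exact ⟨Or.inl rfl, hvU, k3⟩
        · rintro ⟨rfl | k1, k2, k3⟩
          · exact Or.inr ⟨rfl, k3⟩
          · exact Or.inl ⟨k1, k2, k3⟩
      · rw [Finset.insert_sdiff_of_notMem _ hvU, Finset.sum_insert (by simp [hvS])]
        dsimp only at ht2
        omega
  · rintro s1 ⟨hfr, hr1, hst, hth, hle, hinv, htime⟩ hlt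
    simp only [Arith.eval] at hlt
    have e : s1.var .hd = s1.var .tl := by omega
    rw [e] at hinv htime
    exact hQ s1 hfr hr1 hst e hinv htime

end Explore

/-! ### The cost of a component -/

/-- Go on to the next level `k`; `cnt` is the number of vertices below level `k`, and `cost` is the
sum of the distances of the levels from `k`. -/
def levelCmd : Cmd :=
  .set .cnt (.add (.var .cnt) (.arr .hist (.var .k))) ;;
  .put .hist (.var .k) (.lit 0) ;;
  .set .cost (.sub (.add (.var .cost) (.add (.var .cnt) (.var .cnt))) (.var .sz)) ;;
  .set .k (.add (.var .k) (.lit 1))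

/-- Make a histogram of the levels of the component, and find the window `[lo, up]` of the levels
to which all its frozen vertices belong. -/
def histCmd : Cmd :=
  .set .sz (.sub (.var .tl) (.var .st)) ;;
  .set .k (.sub .base (.add (.var .sz) (.add (.var .sz) (.var .sz)))) ;;
  .set .hi (.add .base (.add (.var .sz) (.add (.var .sz) (.var .sz)))) ;;
  .set .cost (.lit 0) ;; .set .lo (.lit 0) ;; .set .up (.var .hi) ;; .set .x (.var .st) ;;
  .loop (.var .x) (.var .tl)
    (.set .v (.arr .order (.var .x)) ;;
    .put .hist (.arr .level (.var .v)) (.add (.arr .hist (.arr .level (.var .v))) (.lit 1)) ;;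
    .set .cost (.add (.var .cost) (.sub (.arr .level (.var .v)) (.var .k))) ;;
    .ite (.arr .mark (.var .v)) (.lit 1)
      (.ite (.var .lo) (.arr .level (.var .v)) (.set .lo (.arr .level (.var .v))) .skip ;;
        .ite (.arr .level (.var .v)) (.var .up) (.set .up (.arr .level (.var .v))) .skip)
      .skip ;;
    .set .x (.add (.var .x) (.lit 1)))

/-- Find the least cost of a level that is divisible by three and lies in the window. -/
def bestCmd : Cmd :=
  .set .cnt (.lit 0) ;; .set .best (.add (.inp (.lit 1)) (.lit 1)) ;;
  .loop (.var .k) (.add (.var .hi) (.lit 1))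
    (.ite (.var .k) (.var .lo) .skip (.ite (.var .up) (.var .k) .skip
        (.ite (.var .cost) (.var .best) (.set .best (.var .cost)) .skip)) ;;
      levelCmd ;; levelCmd ;; levelCmd)

section Cost

variable {I : ℕ → ℕ} {M : ℕ}

/-- The distance of two natural numbers. -/
def gap (x y : ℕ) : ℕ := (x - y) + (y - x)

/-- Raising the target from K to K + 1 adds one for every value at most K and takes one off for
every other value. This updates the cost of a level in constant time. -/
theorem sum_gap_succ (S : Finset ℕ) (f : ℕ → ℕ) (K : ℕ) :
    ∑ p ∈ S, gap (f p) (K + 1) + S.card =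
      ∑ p ∈ S, gap (f p) K + 2 * (S.filter fun p => f p < K + 1).card := by
  rw [Finset.card_eq_sum_ones, Finset.card_filter, Finset.mul_sum, ← Finset.sum_add_distrib,
    ← Finset.sum_add_distrib]
  refine Finset.sum_congr rfl fun p _ => ?_
  unfold gap
  split_ifs <;> omega

theorem card_filter_lt_succ (S : Finset ℕ) (f : ℕ → ℕ) (K : ℕ) :
    (S.filter fun p => f p < K + 1).card =
      (S.filter fun p => f p < K).card + (S.filter fun p => f p = K).card := by
  rw [← Finset.card_union_of_disjoint, ← Finset.filter_or]
  · exact congrArg _ (Finset.filter_congr fun p _ => Nat.lt_succ_iff_lt_or_eq)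
  · exact Finset.disjoint_filter.2 fun p _ h1 h2 => h1.ne h2

/-- The invariant of `levelCmd` at the level `K`. -/
structure LevelInv (S : Finset ℕ) (f : ℕ → ℕ) (K cnt cost : ℕ) (hist : ℕ → ℕ) : Prop where
  cnt_eq : cnt = (S.filter fun p => f p < K).card
  cost_eq : cost = ∑ p ∈ S, gap (f p) K
  hist_eq : ∀ y, hist y = if y < K then 0 else (S.filter fun p => f p = y).card

/-- The histogram entries are erased as they are passed, so the array is clean again for the next
component without a pass over all levels. -/
theorem levelCmd_wp {S : Finset ℕ} {f : ℕ → ℕ} {K : ℕ} {Q : Store → Prop} {s : Store}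
    (hk : s.var .k = K) (hsz : s.var .sz = S.card)
    (h : LevelInv S f K (s.var .cnt) (s.var .cost) (s.arr .hist))
    (hM : ∑ p ∈ S, gap (f p) K + 2 * S.card + K + 1 ≤ M)
    (hQ : ∀ s' : Store, (∀ k, k ≠ .hist → s'.arr k = s.arr k) →
      (∀ i, i ≠ .cnt → i ≠ .cost → i ≠ .k → s'.var i = s.var i) → s'.var .k = K + 1 →
      s'.time = s.time + 4 → LevelInv S f (K + 1) (s'.var .cnt) (s'.var .cost) (s'.arr .hist) →
      Q s') :
    levelCmd.wp I M Q s := by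
  obtain ⟨h1, h2, h3⟩ := h
  have e1 := card_filter_lt_succ S f K
  have e2 := sum_gap_succ S f K
  have e3 := h3 K
  rw [if_neg (lt_irrefl K)] at e3
  have e4 := Finset.card_filter_le S fun p => f p < K + 1
  simp only [Cmd.wp_skip, Cmd.wp_set, Cmd.wp_put, Cmd.wp_seq, Cmd.wp_ite, Arith.Small,
    Arith.eval, Arith.eval_order, Arith.eval_srcCol, Arith.eval_tgtCol, Arith.eval_offset,
    Arith.eval_nbr, Arith.small_order, Arith.small_srcCol, Arith.small_tgtCol,
    Arith.small_offset, Arith.small_nbr, Arith.cell, Store.tick, Function.update_self, ne_eq,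
    reduceCtorEq, not_false_eq_true, Function.update_of_ne, true_and, levelCmd, hk, hsz]
  refine ⟨by omega, by omega, by omega, by omega, ?_⟩
  refine hQ _ (fun k hk => ?_) (fun i i1 i2 i3 => ?_) ?_ rfl ⟨?_, ?_, fun y => ?_⟩
  · simp only [Cmd.wp_skip, Cmd.wp_set, Cmd.wp_put, Cmd.wp_seq, Cmd.wp_ite, Arith.Small,
    Arith.eval, Arith.eval_order, Arith.eval_srcCol, Arith.eval_tgtCol, Arith.eval_offset,
    Arith.eval_nbr, Arith.small_order, Arith.small_srcCol, Arith.small_tgtCol,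
    Arith.small_offset, Arith.small_nbr, Arith.cell, Store.tick, Function.update_self, ne_eq,
    reduceCtorEq, not_false_eq_true, Function.update_of_ne, true_and, hk]
  · simp only [Cmd.wp_skip, Cmd.wp_set, Cmd.wp_put, Cmd.wp_seq, Cmd.wp_ite, Arith.Small,
    Arith.eval, Arith.eval_order, Arith.eval_srcCol, Arith.eval_tgtCol, Arith.eval_offset,
    Arith.eval_nbr, Arith.small_order, Arith.small_srcCol, Arith.small_tgtCol,
    Arith.small_offset, Arith.small_nbr, Arith.cell, Store.tick, Function.update_self, ne_eq,
    reduceCtorEq, not_false_eq_true, Function.update_of_ne, true_and, i1, i2, i3]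
  · simp only [Cmd.wp_skip, Cmd.wp_set, Cmd.wp_put, Cmd.wp_seq, Cmd.wp_ite, Arith.Small,
    Arith.eval, Arith.eval_order, Arith.eval_srcCol, Arith.eval_tgtCol, Arith.eval_offset,
    Arith.eval_nbr, Arith.small_order, Arith.small_srcCol, Arith.small_tgtCol,
    Arith.small_offset, Arith.small_nbr, Arith.cell, Store.tick, Function.update_self, ne_eq,
    reduceCtorEq, not_false_eq_true, Function.update_of_ne, true_and]
  · simp only [Cmd.wp_skip, Cmd.wp_set, Cmd.wp_put, Cmd.wp_seq, Cmd.wp_ite, Arith.Small,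
    Arith.eval, Arith.eval_order, Arith.eval_srcCol, Arith.eval_tgtCol, Arith.eval_offset,
    Arith.eval_nbr, Arith.small_order, Arith.small_srcCol, Arith.small_tgtCol,
    Arith.small_offset, Arith.small_nbr, Arith.cell, Store.tick, Function.update_self, ne_eq,
    reduceCtorEq, not_false_eq_true, Function.update_of_ne, true_and]
    omega
  · simp only [Cmd.wp_skip, Cmd.wp_set, Cmd.wp_put, Cmd.wp_seq, Cmd.wp_ite, Arith.Small,
    Arith.eval, Arith.eval_order, Arith.eval_srcCol, Arith.eval_tgtCol, Arith.eval_offset,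
    Arith.eval_nbr, Arith.small_order, Arith.small_srcCol, Arith.small_tgtCol,
    Arith.small_offset, Arith.small_nbr, Arith.cell, Store.tick, Function.update_self, ne_eq,
    reduceCtorEq, not_false_eq_true, Function.update_of_ne, true_and]
    omega
  · simp only [Cmd.wp_skip, Cmd.wp_set, Cmd.wp_put, Cmd.wp_seq, Cmd.wp_ite, Arith.Small,
    Arith.eval, Arith.eval_order, Arith.eval_srcCol, Arith.eval_tgtCol, Arith.eval_offset,
    Arith.eval_nbr, Arith.small_order, Arith.small_srcCol, Arith.small_tgtCol,
    Arith.small_offset, Arith.small_nbr, Arith.cell, Store.tick, Function.update_self, ne_eq,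
    reduceCtorEq, not_false_eq_true, Function.update_of_ne, true_and]
    by_cases hy : y = K
    · subst hy
      rw [Function.update_self, if_pos (Nat.lt_succ_self y)]
    · rw [Function.update_of_ne hy, h3]
      by_cases hy' : y < K
      · rw [if_pos hy', if_pos (by omega)]
      · rw [if_neg hy', if_neg (by omega)]

/-- The postcondition of `histCmd`, in which `f` gives the levels and `frozen` the frozen vertices
of the component in terms of the positions in `order`. -/
structure HistInv (a p k₀ hi : ℕ) (f : ℕ → ℕ) (frozen : ℕ → Prop) (cost lo up : ℕ)
    (hist : ℕ → ℕ) : Prop where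
  cost_eq : cost = ∑ q ∈ Finset.Ico a p, (f q - k₀)
  window : ∀ K ≤ hi, (lo ≤ K ∧ K ≤ up) ↔ ∀ q ∈ Finset.Ico a p, frozen q → f q = K
  hist_eq : ∀ y, hist y = ((Finset.Ico a p).filter fun q => f q = y).card

theorem sum_Ico_le {a p n c : ℕ} (hpn : p ≤ n) (g : ℕ → ℕ)
    (hg : ∀ q ∈ Finset.Ico a p, g q ≤ c) : ∑ q ∈ Finset.Ico a p, g q ≤ n * c := by
  refine (Finset.sum_le_card_nsmul _ _ _ hg).trans ?_
  rw [Nat.card_Ico, smul_eq_mul]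
  exact Nat.mul_le_mul_right _ (by omega)

theorem histCmd_wp {a b : ℕ} (hab : a ≤ b) (hb : b ≤ I 0)
    (hM : I 0 * (6 * I 0) + 20 * I 0 + 20 ≤ M) {Q : Store → Prop} {s : Store} (ha : s.var .st = a)
    (hb' : s.var .tl = b) {f : ℕ → ℕ} (hf : ∀ q, s.arr .level (s.arr .order q) = f q)
    (hfle : ∀ q ∈ Finset.Ico a b, f q ≤ baseLevel I + 3 * (b - a))
    (hhist : ∀ y, s.arr .hist y = 0)
    (hQ : ∀ s' : Store, (∀ k, k ≠ .hist → s'.arr k = s.arr k) →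
      s'.var .tl = b → s'.var .hd = s.var .hd → s'.var .r = s.var .r → s'.var .tot = s.var .tot →
      s'.var .sz = b - a → s'.var .k = baseLevel I - 3 * (b - a) →
      s'.var .hi = baseLevel I + 3 * (b - a) →
      HistInv a b (baseLevel I - 3 * (b - a)) (baseLevel I + 3 * (b - a)) f
        (fun q => s.arr .mark (s.arr .order q) = 0) (s'.var .cost) (s'.var .lo) (s'.var .up)
        (s'.arr .hist) → s'.time ≤ s.time + 7 + 11 * (b - a) → Q s'.tick) :
    histCmd.wp I M Q s := by
  have hbase : baseLevel I = 3 + (I 0 + (I 0 + I 0)) := rfl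
  simp only [Cmd.wp_skip, Cmd.wp_set, Cmd.wp_put, Cmd.wp_seq, Cmd.wp_ite, Arith.Small,
    Arith.eval, Arith.eval_order, Arith.eval_srcCol, Arith.eval_tgtCol, Arith.eval_offset,
    Arith.eval_nbr, Arith.small_order, Arith.small_srcCol, Arith.small_tgtCol,
    Arith.small_offset, Arith.small_nbr, Arith.cell, Store.tick, Function.update_self, ne_eq,
    reduceCtorEq, not_false_eq_true, Function.update_of_ne, true_and, histCmd, Arith.base, ha,
    hb']
  refine ⟨by omega, by omega, by omega, by omega, ?_⟩
  rw [← hbase, show b - a + (b - a + (b - a)) = 3 * (b - a) by omega]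
  obtain ⟨k₀, hk₀⟩ : ∃ k₀, baseLevel I - 3 * (b - a) = k₀ := ⟨_, rfl⟩
  obtain ⟨hi, hhi⟩ : ∃ hi, baseLevel I + 3 * (b - a) = hi := ⟨_, rfl⟩
  rw [hk₀, hhi] at hQ ⊢
  refine Cmd.wp_loop (fun s' => (∀ k, k ≠ .hist → s'.arr k = s.arr k) ∧
      s'.var .tl = b ∧ s'.var .hd = s.var .hd ∧ s'.var .r = s.var .r ∧
      s'.var .tot = s.var .tot ∧ s'.var .sz = b - a ∧ s'.var .k = k₀ ∧ s'.var .hi = hi ∧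
      a ≤ s'.var .x ∧ s'.var .x ≤ b ∧
      HistInv a (s'.var .x) k₀ hi f (fun q => s.arr .mark (s.arr .order q) = 0) (s'.var .cost)
        (s'.var .lo) (s'.var .up) (s'.arr .hist) ∧
      s'.time ≤ s.time + 7 + 11 * (s'.var .x - a)) (s.time + 7 + 11 * (b - a)) ?_ ?_ ?_ ?_
  · simp only [Cmd.wp_skip, Cmd.wp_set, Cmd.wp_put, Cmd.wp_seq, Cmd.wp_ite, Arith.Small,
    Arith.eval, Arith.eval_order, Arith.eval_srcCol, Arith.eval_tgtCol, Arith.eval_offset,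
    Arith.eval_nbr, Arith.small_order, Arith.small_srcCol, Arith.small_tgtCol,
    Arith.small_offset, Arith.small_nbr, Arith.cell, Store.tick, Function.update_self, ne_eq,
    reduceCtorEq, not_false_eq_true, Function.update_of_ne, true_and, hb']
    refine ⟨fun k _ => trivial, le_rfl, hab, ⟨by simp, fun K hK => ?_, fun y => ?_⟩, by omega⟩
    · simpa using hK
    · simpa using hhist y
  · rintro s1 ⟨-, -, -, -, -, -, -, -, -, h1, -, h2⟩
    omega
  · rintro s1 ⟨hfr, htl, hhd, hr, htot, hsz, hk, hhi1, hax, hxb, hinv, htime⟩ hlt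
    obtain ⟨p, hp⟩ : ∃ p, s1.var .x = p := ⟨_, rfl⟩
    obtain ⟨v, hv⟩ : ∃ v, s1.arr .order p = v := ⟨_, rfl⟩
    have hfp : s1.arr .level v = f p := by
      rw [← hv, hfr _ (by simp), hfr _ (by simp), hf]
    have hm : s1.arr .mark v = s.arr .mark (s.arr .order p) := by
      rw [← hv, hfr _ (by simp), hfr _ (by simp)]
    simp only [Arith.eval, htl, hp] at hlt
    rw [hp] at hax hxb hinv htime
    obtain ⟨hcost, hwin, hhist1⟩ := hinv
    have hfp' := hfle p (Finset.mem_Ico.2 ⟨hax, hlt⟩)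
    have hsum := sum_Ico_le (a := a) (p := p + 1) (n := I 0) (c := 6 * I 0) (by omega)
      (fun q => f q - k₀) (fun q hq => by
        have hq := Finset.mem_Ico.1 hq
        have := hfle q (Finset.mem_Ico.2 ⟨hq.1, by omega⟩)
        omega)
    rw [Finset.sum_Ico_succ_top hax] at hsum
    have hle : (Finset.filter (fun q => f q = f p) (Finset.Ico a p)).card ≤ p - a := by
      refine (Finset.card_filter_le _ _).trans ?_
      rw [Nat.card_Ico]
    simp only [Cmd.wp_skip, Cmd.wp_set, Cmd.wp_put, Cmd.wp_seq, Cmd.wp_ite, Arith.Small,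
      Arith.eval, Arith.eval_order, Arith.eval_srcCol, Arith.eval_tgtCol, Arith.eval_offset,
      Arith.eval_nbr, Arith.small_order, Arith.small_srcCol, Arith.small_tgtCol,
      Arith.small_offset, Arith.small_nbr, Arith.cell, Store.tick, Function.update_self,
      ne_eq, reduceCtorEq, not_false_eq_true, Function.update_of_ne, true_and, hp, hv, hfp,
      hk, hm]
    have hcost' : s1.var .cost + (f p - k₀) = ∑ q ∈ Finset.Ico a (p + 1), (f q - k₀) := by
      rw [Finset.sum_Ico_succ_top hax, hcost]
    have hhist' : ∀ y, Function.update (s1.arr .hist) (f p) (s1.arr .hist (f p) + 1) y =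
        ((Finset.Ico a (p + 1)).filter fun q => f q = y).card := by
      intro y
      rw [card_filter_Ico_succ hax]
      by_cases hy : y = f p
      · subst hy
        rw [Function.update_self, hhist1, if_pos rfl]
      · rw [Function.update_of_ne hy, hhist1, if_neg (Ne.symm hy), add_zero]
    -- Up to the initial values 0 and hi, lo is the largest and up the smallest level of a frozen
    -- vertex; the window is one level if they agree and empty if not.
    have hwin' : ∀ lo up, (∀ K ≤ hi, (lo ≤ K ∧ K ≤ up) ↔ (s1.var .lo ≤ K ∧ K ≤ s1.var .up) ∧
        (s.arr .mark (s.arr .order p) = 0 → f p = K)) → ∀ K ≤ hi, (lo ≤ K ∧ K ≤ up) ↔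
        ∀ q ∈ Finset.Ico a (p + 1), s.arr .mark (s.arr .order q) = 0 → f q = K := by
      intro lo up h K hK
      rw [h K hK, hwin K hK, ← Nat.succ_eq_add_one, Nat.Ico_succ_right_eq_insert_Ico hax]
      simp only [Finset.mem_insert, forall_eq_or_imp, and_comm]
    have hfr' : ∀ k, k ≠ Arr.hist → ∀ g, Function.update s1.arr .hist g k = s.arr k :=
      fun k hk g => by rw [Function.update_of_ne hk, hfr k hk]
    refine ⟨by rw [hhist1]; omega, by omega, fun hc => ⟨fun hlo => ⟨fun hup => ⟨by omega,
      fun k hk => hfr' k hk _, htl, hhd, hr, htot, hsz, hhi1, by omega, by omega,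
      ⟨hcost', hwin' _ _ fun K hK => by omega, hhist'⟩, by omega⟩, fun hup => ⟨by omega,
      fun k hk => hfr' k hk _, htl, hhd, hr, htot, hsz, hhi1, by omega, by omega,
      ⟨hcost', hwin' _ _ fun K hK => by omega, hhist'⟩, by omega⟩⟩, fun hlo => ⟨fun hup =>
      ⟨by omega,
      fun k hk => hfr' k hk _, htl, hhd, hr, htot, hsz, hhi1, by omega, by omega,
      ⟨hcost', hwin' _ _ fun K hK => by omega, hhist'⟩, by omega⟩, fun hup => ⟨by omega,
      fun k hk => hfr' k hk _, htl, hhd, hr, htot, hsz, hhi1, by omega, by omega,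
      ⟨hcost', hwin' _ _ fun K hK => by omega, hhist'⟩, by omega⟩⟩⟩, fun hc => ⟨by omega,
      fun k hk => hfr' k hk _, htl, hhd, hr, htot, hsz, hhi1, by omega, by omega,
      ⟨hcost', hwin' _ _ fun K hK => by omega, hhist'⟩, by omega⟩⟩
  · rintro s1 ⟨hfr, htl, hhd, hr, htot, hsz, hk, hhi1, hax, hxb, hinv, htime⟩ hlt
    simp only [Arith.eval, htl] at hlt
    have e : s1.var .x = b := by omega
    rw [e] at hinv htime
    exact hQ s1 hfr htl hhd hr htot hsz hk hhi1 hinv htime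

/-- The initial value ℓ + 1 means that no admissible level of cost at most ℓ has been found;
therefore the result is characterised only through its comparison with bounds L ≤ ℓ. -/
theorem bestCmd_wp {S : Finset ℕ} {f : ℕ → ℕ} {k₀ hi n : ℕ} (hS : S.card ≤ n)
    (hkhi : k₀ + 6 * S.card = hi) (h3 : 3 ∣ k₀) (hhin : hi ≤ 6 * n + 3)
    (hM : n * (6 * n + 6) + 20 * n + 20 + I 1 ≤ M) {Q : Store → Prop} {s : Store}
    (hf : ∀ q ∈ S, k₀ ≤ f q ∧ f q ≤ hi)
    {frozen : ℕ → Prop} (hsz : s.var .sz = S.card) (hk : s.var .k = k₀) (hhi : s.var .hi = hi)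
    (hcost : s.var .cost = ∑ q ∈ S, (f q - k₀))
    (hwin : ∀ K ≤ hi, (s.var .lo ≤ K ∧ K ≤ s.var .up) ↔ ∀ q ∈ S, frozen q → f q = K)
    (hhist : ∀ y, s.arr .hist y = (S.filter fun q => f q = y).card)
    (hQ : ∀ s' : Store, (∀ k, k ≠ .hist → s'.arr k = s.arr k) → (∀ y, s'.arr .hist y = 0) →
      (∀ i, i ≠ .cnt → i ≠ .cost → i ≠ .k → i ≠ .best → s'.var i = s.var i) →
      s'.var .best ≤ I 1 + 1 → (∀ L ≤ I 1, s'.var .best ≤ L ↔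
        ∃ K, 3 ∣ K ∧ k₀ ≤ K ∧ K ≤ hi ∧ (∀ q ∈ S, frozen q → f q = K) ∧
          ∑ q ∈ S, gap (f q) K ≤ L) →
      s'.time ≤ s.time + 2 + 20 * (6 * S.card + 3) → Q s'.tick) :
    bestCmd.wp I M Q s := by
  -- At most n terms, each linear in n: this is where quadratic numbers arise.
  have hgap : ∀ K, k₀ ≤ K → K ≤ hi + 3 → ∑ q ∈ S, gap (f q) K ≤ n * (6 * n + 6) := by
    intro K h1 h2
    have : ∀ q ∈ S, gap (f q) K ≤ 6 * n + 6 := fun q hq => by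
      have := hf q hq
      unfold gap
      omega
    refine (Finset.sum_le_card_nsmul _ _ _ this).trans ?_
    rw [smul_eq_mul]
    exact Nat.mul_le_mul_right _ hS
  simp only [Cmd.wp_skip, Cmd.wp_set, Cmd.wp_put, Cmd.wp_seq, Cmd.wp_ite, Arith.Small,
    Arith.eval, Arith.eval_order, Arith.eval_srcCol, Arith.eval_tgtCol, Arith.eval_offset,
    Arith.eval_nbr, Arith.small_order, Arith.small_srcCol, Arith.small_tgtCol,
    Arith.small_offset, Arith.small_nbr, Arith.cell, Store.tick, Function.update_self, ne_eq,
    reduceCtorEq, not_false_eq_true, Function.update_of_ne, true_and, bestCmd]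
  refine ⟨by omega, by omega, ?_⟩
  refine Cmd.wp_loop (fun s' => (∀ k, k ≠ .hist → s'.arr k = s.arr k) ∧
      (∀ i, i ≠ .cnt → i ≠ .cost → i ≠ .k → i ≠ .best → s'.var i = s.var i) ∧
      s'.var .best ≤ I 1 + 1 ∧ k₀ ≤ s'.var .k ∧ s'.var .k ≤ hi + 3 ∧ 3 ∣ s'.var .k ∧
      (∀ L ≤ I 1, s'.var .best ≤ L ↔ ∃ K, 3 ∣ K ∧ k₀ ≤ K ∧ K < s'.var .k ∧
        (∀ q ∈ S, frozen q → f q = K) ∧ ∑ q ∈ S, gap (f q) K ≤ L) ∧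
      LevelInv S f (s'.var .k) (s'.var .cnt) (s'.var .cost) (s'.arr .hist) ∧
      s'.time ≤ s.time + 2 + 20 * (s'.var .k - k₀)) (s.time + 2 + 20 * (6 * S.card + 3)) ?_ ?_ ?_ ?_
  · simp only [Cmd.wp_skip, Cmd.wp_set, Cmd.wp_put, Cmd.wp_seq, Cmd.wp_ite, Arith.Small,
    Arith.eval, Arith.eval_order, Arith.eval_srcCol, Arith.eval_tgtCol, Arith.eval_offset,
    Arith.eval_nbr, Arith.small_order, Arith.small_srcCol, Arith.small_tgtCol,
    Arith.small_offset, Arith.small_nbr, Arith.cell, Store.tick, Function.update_self, ne_eq,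
    reduceCtorEq, not_false_eq_true, Function.update_of_ne, true_and, hk]
    refine ⟨fun k _ => trivial, fun i i1 i2 i3 i4 => ?_, le_rfl, le_rfl, by omega, h3,
      fun L hL => ?_, ⟨?_, ?_, fun y => ?_⟩, by omega⟩
    · simp only [Cmd.wp_skip, Cmd.wp_set, Cmd.wp_put, Cmd.wp_seq, Cmd.wp_ite, Arith.Small,
      Arith.eval, Arith.eval_order, Arith.eval_srcCol, Arith.eval_tgtCol, Arith.eval_offset,
      Arith.eval_nbr, Arith.small_order, Arith.small_srcCol, Arith.small_tgtCol,
      Arith.small_offset, Arith.small_nbr, Arith.cell, Store.tick, Function.update_self,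
      ne_eq, reduceCtorEq, not_false_eq_true, Function.update_of_ne, true_and, i4, i1]
    · constructor
      · intro h
        omega
      · rintro ⟨K, -, h1, h2, -⟩
        omega
    · rw [Finset.filter_false_of_mem fun q hq => by have := hf q hq; omega]
      rfl
    · rw [hcost]
      refine Finset.sum_congr rfl fun q hq => ?_
      have := hf q hq
      unfold gap
      omega
    · rw [hhist]
      split_ifs with hy
      · rw [Finset.filter_false_of_mem fun q hq => by have := hf q hq; omega]
        rfl
      · rfl
  · rintro s1 ⟨-, -, -, h1, h2, -, -, -, h4⟩
    omega
  · rintro s1 ⟨hfr, hvar, hbest, hk1, hk2, hk3, hopt, hlev, htime⟩ hlt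
    obtain ⟨K, hK⟩ : ∃ K, s1.var .k = K := ⟨_, rfl⟩
    have hhi1 : s1.var .hi = hi := (hvar .hi (by simp) (by simp) (by simp) (by simp)).trans hhi
    have hlo1 := hvar .lo (by simp) (by simp) (by simp) (by simp)
    have hup1 := hvar .up (by simp) (by simp) (by simp) (by simp)
    have hsz1 := (hvar .sz (by simp) (by simp) (by simp) (by simp)).trans hsz
    simp only [Arith.eval, hhi1, hK] at hlt
    rw [hK] at hk1 hk2 hk3 hopt hlev htime
    have hwinK := hwin K (by omega)
    have hcostK := hlev.cost_eq
    -- All branches of the body continue with the same three level moves and differ only in whether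
    -- `best` has been lowered to the current cost.
    have hrest : ∀ s2 : Store, (∀ i, i ≠ .best → s2.var i = s1.var i) → s2.arr = s1.arr →
        s2.time ≤ s1.time + 5 → s2.var .best ≤ I 1 + 1 →
        (∀ L ≤ I 1, s2.var .best ≤ L ↔ s1.var .best ≤ L ∨
          ((s1.var .lo ≤ K ∧ K ≤ s1.var .up) ∧ s1.var .cost ≤ L)) →
        (levelCmd ;; levelCmd ;; levelCmd).wp I M (fun s' =>
          (∀ k, k ≠ .hist → s'.arr k = s.arr k) ∧
          (∀ i, i ≠ .cnt → i ≠ .cost → i ≠ .k → i ≠ .best → s'.var i = s.var i) ∧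
          s'.var .best ≤ I 1 + 1 ∧ k₀ ≤ s'.var .k ∧ s'.var .k ≤ hi + 3 ∧ 3 ∣ s'.var .k ∧
          (∀ L ≤ I 1, s'.var .best ≤ L ↔ ∃ K, 3 ∣ K ∧ k₀ ≤ K ∧ K < s'.var .k ∧
            (∀ q ∈ S, frozen q → f q = K) ∧ ∑ q ∈ S, gap (f q) K ≤ L) ∧
          LevelInv S f (s'.var .k) (s'.var .cnt) (s'.var .cost) (s'.arr .hist) ∧
          s'.time ≤ s.time + 2 + 20 * (s'.var .k - k₀)) s2 := by
      intro s2 hv2 ha2 ht2 hb2 hopt2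
      have g0 := hgap K hk1 hk2
      have g1 := hgap (K + 1) (by omega) (by omega)
      have g2 := hgap (K + 2) (by omega) (by omega)
      rw [Cmd.wp_seq]
      refine levelCmd_wp (K := K) (S := S) (f := f) ?_ ?_ ?_ (by omega) fun s3 a3 v3 k3 t3 l3 => ?_
      · rw [hv2 _ (by simp), hK]
      · rw [hv2 _ (by simp), hsz1]
      · rwa [hv2 _ (by simp), hv2 _ (by simp), ha2]
      rw [Cmd.wp_seq]
      refine levelCmd_wp (K := K + 1) (S := S) (f := f) k3 ?_ l3 (by omega)
        fun s4 a4 v4 k4 t4 l4 => ?_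
      · rw [v3 _ (by simp) (by simp) (by simp), hv2 _ (by simp), hsz1]
      refine levelCmd_wp (K := K + 2) (S := S) (f := f) k4 ?_ l4 (by omega)
        fun s5 a5 v5 k5 t5 l5 => ?_
      · rw [v4 _ (by simp) (by simp) (by simp), v3 _ (by simp) (by simp) (by simp),
          hv2 _ (by simp), hsz1]
      have hv5 : ∀ i, i ≠ .cnt → i ≠ .cost → i ≠ .k → s5.var i = s2.var i := fun i i1 i2 i3 => by
        rw [v5 i i1 i2 i3, v4 i i1 i2 i3, v3 i i1 i2 i3]
      rw [k5]
      refine ⟨fun k hk => ?_, fun i i1 i2 i3 i4 => ?_, ?_, by omega, by omega, by omega,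
        fun L hL => ?_, l5, by omega⟩
      · rw [a5 k hk, a4 k hk, a3 k hk, ha2, hfr k hk]
      · rw [hv5 i i1 i2 i3, hv2 i i4, hvar i i1 i2 i3 i4]
      · rwa [hv5 _ (by simp) (by simp) (by simp)]
      · rw [hv5 _ (by simp) (by simp) (by simp), hopt2 L hL, hopt L hL, hlo1, hup1, hwinK, hcostK]
        constructor
        · rintro (⟨K', j1, j2, j3, j4⟩ | ⟨j1, j2⟩)
          · exact ⟨K', j1, j2, by omega, j4⟩
          · exact ⟨K, hk3, hk1, by omega, j1, j2⟩
        · rintro ⟨K', j1, j2, j3, j4⟩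
          by_cases hKK : K' = K
          · subst hKK
            exact Or.inr j4
          · exact Or.inl ⟨K', j1, j2, by omega, j4⟩
    simp only [Cmd.wp_skip, Cmd.wp_set, Cmd.wp_put, Cmd.wp_seq, Cmd.wp_ite, Arith.Small,
      Arith.eval, Arith.eval_order, Arith.eval_srcCol, Arith.eval_tgtCol, Arith.eval_offset,
      Arith.eval_nbr, Arith.small_order, Arith.small_srcCol, Arith.small_tgtCol,
      Arith.small_offset, Arith.small_nbr, Arith.cell, Store.tick, Function.update_self,
      ne_eq, reduceCtorEq, not_false_eq_true, Function.update_of_ne, true_and, hK]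
    refine ⟨fun hc => hrest _ (fun i hi => ?_) rfl (by dsimp only; omega) hbest fun L hL => ?_,
      fun hc => ⟨fun hc1 => hrest _ (fun i hi => ?_) rfl (by dsimp only; omega) hbest
        fun L hL => ?_, fun hc1 => ⟨fun hc2 => hrest _ (fun i hi => ?_) rfl (by dsimp only; omega)
        ?_ fun L hL => ?_, fun hc2 => hrest _ (fun i hi => ?_) rfl (by dsimp only; omega) hbest
        fun L hL => ?_⟩⟩⟩
    · rfl
    · dsimp only
      omega
    · rfl
    · dsimp only
      omega
    · simp only [Cmd.wp_skip, Cmd.wp_set, Cmd.wp_put, Cmd.wp_seq, Cmd.wp_ite, Arith.Small,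
      Arith.eval, Arith.eval_order, Arith.eval_srcCol, Arith.eval_tgtCol, Arith.eval_offset,
      Arith.eval_nbr, Arith.small_order, Arith.small_srcCol, Arith.small_tgtCol,
      Arith.small_offset, Arith.small_nbr, Arith.cell, Store.tick, Function.update_self,
      ne_eq, reduceCtorEq, not_false_eq_true, Function.update_of_ne, true_and, hi]
    · simp only [Cmd.wp_skip, Cmd.wp_set, Cmd.wp_put, Cmd.wp_seq, Cmd.wp_ite, Arith.Small,
      Arith.eval, Arith.eval_order, Arith.eval_srcCol, Arith.eval_tgtCol, Arith.eval_offset,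
      Arith.eval_nbr, Arith.small_order, Arith.small_srcCol, Arith.small_tgtCol,
      Arith.small_offset, Arith.small_nbr, Arith.cell, Store.tick, Function.update_self,
      ne_eq, reduceCtorEq, not_false_eq_true, Function.update_of_ne, true_and]
      omega
    · simp only [Cmd.wp_skip, Cmd.wp_set, Cmd.wp_put, Cmd.wp_seq, Cmd.wp_ite, Arith.Small,
      Arith.eval, Arith.eval_order, Arith.eval_srcCol, Arith.eval_tgtCol, Arith.eval_offset,
      Arith.eval_nbr, Arith.small_order, Arith.small_srcCol, Arith.small_tgtCol,
      Arith.small_offset, Arith.small_nbr, Arith.cell, Store.tick, Function.update_self,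
      ne_eq, reduceCtorEq, not_false_eq_true, Function.update_of_ne, true_and]
      omega
    · rfl
    · dsimp only
      omega
  · rintro s1 ⟨hfr, hvar, hbest, hk1, hk2, hk3, hopt, hlev, htime⟩ hlt
    have hhi1 : s1.var .hi = hi := (hvar .hi (by simp) (by simp) (by simp) (by simp)).trans hhi
    simp only [Arith.eval, hhi1] at hlt
    -- Both k and hi are divisible by 3, so the sweep stops exactly three beyond hi and has erased
    -- the whole histogram.
    have e : s1.var .k = hi + 3 := by omega
    rw [e] at hopt hlev htime
    refine hQ s1 hfr (fun y => ?_) hvar hbest (fun L hL => ?_) (by omega)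
    · rw [hlev.hist_eq]
      split_ifs with hy
      · rfl
      · rw [Finset.filter_false_of_mem fun q hq => by have := hf q hq; omega]
        rfl
    · rw [hopt L hL]
      constructor
      · rintro ⟨K, j1, j2, j3, j4⟩
        exact ⟨K, j1, j2, by omega, j4⟩
      · rintro ⟨K, j1, j2, j3, j4⟩
        exact ⟨K, j1, j2, by omega, j4⟩

end Cost

/-! ### Shifts of closed sets of vertices -/

section Shifts

variable {I : ℕ → ℕ}

/-- The restriction to `U` of a shift between the colourings that vanishes on the core. -/
structure IsValidOn (I : ℕ → ℕ) (U : Finset ℕ) (E : ℕ → ℤ) : Prop where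
  dvd : ∀ v ∈ U, (3 : ℤ) ∣ E v - ((srcCol I v : ℤ) - tgtCol I v)
  step : ∀ v ∈ U, ∀ k ∈ slots I v, E (nbr I k) - E v = shiftStep I v (nbr I k)
  core : ∀ v ∈ U, v ∈ core I → E v = 0

/-- There is a shift of `U` with total displacement at most `L`. -/
def Affords (I : ℕ → ℕ) (U : Finset ℕ) (L : ℕ) : Prop :=
  ∃ E, IsValidOn I U E ∧ ∑ v ∈ U, (E v).natAbs ≤ L

/-- The neighbours of the vertices in `U` belong to `U`. -/
def IsClosedSet (I : ℕ → ℕ) (U : Finset ℕ) : Prop :=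
  ∀ u ∈ U, ∀ k ∈ slots I u, nbr I k ∈ U

/-- No edge joins two disjoint closed sets, so shifts can be chosen independently on them and their
costs add. -/
theorem affords_union {U C : Finset ℕ} (hU : IsClosedSet I U) (hC : IsClosedSet I C)
    (h : Disjoint U C) (L : ℕ) :
    Affords I (U ∪ C) L ↔ ∃ a b, a + b ≤ L ∧ Affords I U a ∧ Affords I C b := by
  constructor
  · rintro ⟨E, hE, hs⟩
    rw [Finset.sum_union h] at hs
    refine ⟨_, _, hs, ⟨E, ⟨fun v hv => ?_, fun v hv => ?_, fun v hv => ?_⟩, le_rfl⟩,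
      ⟨E, ⟨fun v hv => ?_, fun v hv => ?_, fun v hv => ?_⟩, le_rfl⟩⟩
    · exact hE.dvd v (Finset.mem_union_left _ hv)
    · exact hE.step v (Finset.mem_union_left _ hv)
    · exact hE.core v (Finset.mem_union_left _ hv)
    · exact hE.dvd v (Finset.mem_union_right _ hv)
    · exact hE.step v (Finset.mem_union_right _ hv)
    · exact hE.core v (Finset.mem_union_right _ hv)
  · rintro ⟨a, b, hab, ⟨E, hE, ha⟩, ⟨F, hF, hb⟩⟩
    obtain ⟨D, e1, e2⟩ : ∃ D : ℕ → ℤ, (∀ v ∈ U, D v = E v) ∧ ∀ v ∈ C, D v = F v :=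
      ⟨fun v => if v ∈ U then E v else F v, fun v hv => if_pos hv, fun v hv =>
        if_neg (Finset.disjoint_right.1 h hv)⟩
    refine ⟨D, ⟨fun v hv => ?_, fun v hv k hk => ?_,
      fun v hv hc => ?_⟩, ?_⟩
    · rcases Finset.mem_union.1 hv with hv | hv
      · rw [e1 v hv]
        exact hE.dvd v hv
      · rw [e2 v hv]
        exact hF.dvd v hv
    · rcases Finset.mem_union.1 hv with hv | hv
      · rw [e1 v hv, e1 _ (hU v hv k hk)]
        exact hE.step v hv k hk
      · rw [e2 v hv, e2 _ (hC v hv k hk)]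
        exact hF.step v hv k hk
    · rcases Finset.mem_union.1 hv with hv | hv
      · rw [e1 v hv]
        exact hE.core v hv hc
      · rw [e2 v hv]
        exact hF.core v hv hc
    · rw [Finset.sum_union h, Finset.sum_congr rfl fun v hv => congrArg Int.natAbs (e1 v hv),
        Finset.sum_congr rfl fun v hv => congrArg Int.natAbs (e2 v hv)]
      omega

theorem IsNet.isClosedSet_sdiff (hI : IsNet I) {U L : Finset ℕ} (hU : IsClosedSet I U)
    (hL : IsClosedSet I L) (hlt : ∀ v ∈ L, v < I 0) : IsClosedSet I (L \ U) := by
  intro u hu k hk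
  obtain ⟨h1, h2⟩ := Finset.mem_sdiff.1 hu
  refine Finset.mem_sdiff.2 ⟨hL u h1 k hk, fun hc => h2 ?_⟩
  obtain ⟨i, hi, hiu⟩ := hI.symm u (hlt u h1) k hk
  exact hiu ▸ hU _ hc i hi

/-- Since both colourings are proper on the edge, the prescribed increment of E has the residue of
the increment of α - β. A correct residue at the root thus propagates. -/
theorem IsNet.dvd_shiftStep (hI : IsNet I) {v : ℕ} (hv : v < I 0) {k : ℕ} (hk : k ∈ slots I v) :
    (3 : ℤ) ∣ shiftStep I v (nbr I k) - (((srcCol I (nbr I k) : ℤ) - tgtCol I (nbr I k)) -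
      ((srcCol I v : ℤ) - tgtCol I v)) := by
  have hw := hI.nbr_lt v hv k hk
  have h1 := hI.src_lt v hv
  have h2 := hI.tgt_lt v hv
  have h3 := hI.src_lt _ hw
  have h4 := hI.tgt_lt _ hw
  have h5 := hI.src_ne v hv k hk
  have h6 := hI.tgt_ne v hv k hk
  unfold shiftStep rise
  split_ifs <;> omega

variable {U : Finset ℕ} {st r tot₀ tl tot : ℕ} {seen order level : ℕ → ℕ}

/-- The edges with first end in the part of the list outside `U`. -/
def edgesOutside (I : ℕ → ℕ) (U : Finset ℕ) (order : ℕ → ℕ) (tl u w : ℕ) : Prop :=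
  u ∈ firsts order tl ∧ u ∉ U ∧ ∃ k ∈ slots I u, nbr I k = w

theorem ExploreInv.subset
    (h : ExploreInv I U st r tot₀ (edgesOutside I U order tl) seen order level tl tot) :
    U ⊆ firsts order tl := by
  rw [← h.firsts_st]
  exact firsts_mono _ h.st_lt.le

theorem ExploreInv.isClosedSet (hU : IsClosedSet I U)
    (h : ExploreInv I U st r tot₀ (edgesOutside I U order tl) seen order level tl tot) :
    IsClosedSet I (firsts order tl) := by
  intro u hu k hk
  by_cases huU : u ∈ U
  · exact h.subset (hU u huU k hk)
  · exact (h.arcs u _ ⟨hu, huU, k, hk, rfl⟩).2.2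

theorem ExploreInv.sdiff_eq
    (h : ExploreInv I U st r tot₀ (edgesOutside I U order tl) seen order level tl tot) :
    firsts order tl \ U = (Finset.Ico st tl).image order := by
  rw [← h.firsts_st]
  ext v
  simp only [Finset.mem_sdiff, mem_firsts, Finset.mem_image, Finset.mem_Ico]
  constructor
  · rintro ⟨⟨i, hi, rfl⟩, h2⟩
    refine ⟨i, ⟨?_, hi⟩, rfl⟩
    by_contra hc
    exact h2 ⟨i, by omega, rfl⟩
  · rintro ⟨i, ⟨h1, h2⟩, rfl⟩
    refine ⟨⟨i, h2, rfl⟩, ?_⟩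
    rintro ⟨k, hk, hki⟩
    have := h.isQueue.injOn (by simp; omega) (by simp; omega) hki
    omega

theorem ExploreInv.sum_sdiff
    (h : ExploreInv I U st r tot₀ (edgesOutside I U order tl) seen order level tl tot)
    (g : ℕ → ℕ) : ∑ v ∈ firsts order tl \ U, g v = ∑ q ∈ Finset.Ico st tl, g (order q) := by
  rw [h.sdiff_eq, Finset.sum_image]
  intro x hx y hy hxy
  simp only [Finset.coe_Ico, Set.mem_Ico] at hx hy
  exact h.isQueue.injOn (by simp; omega) (by simp; omega) hxy

/-- All levels of the component have the correct residue modulo three. -/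
theorem ExploreInv.dvd_level (hI : IsNet I)
    (h : ExploreInv I U st r tot₀ (edgesOutside I U order tl) seen order level tl tot)
    (hstep : ∀ u w, edgesOutside I U order tl u w → (level w : ℤ) - level u = shiftStep I u w)
    {u : ℕ} (hu : u ∈ firsts order tl) (huU : u ∉ U) :
    (3 : ℤ) ∣ (level u : ℤ) - ((srcCol I u : ℤ) - tgtCol I u) := by
  classical
  have hr := h.level_root
  have hb : baseLevel I = 3 + (I 0 + (I 0 + I 0)) := rfl
  have hroot : (3 : ℤ) ∣ (level r : ℤ) - ((srcCol I r : ℤ) - tgtCol I r) := by omega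
  -- Rigidity replaces an induction along the search: the indicator of a wrong residue is constant
  -- along edges, so the levels plus this indicator also solve the step equations. Hence it is as at
  -- the root, namely zero.
  have key := h.rigid (fun u => (level u : ℤ) +
    if (3 : ℤ) ∣ (level u : ℤ) - ((srcCol I u : ℤ) - tgtCol I u) then 0 else 1) (by
      rintro u w huw
      have h1 := hstep u w huw
      obtain ⟨hu, huU, k, hk, rfl⟩ := huw
      have h2 := hI.dvd_shiftStep (h.isQueue.lt u hu) hk
      split_ifs <;> omega) u hu huU
  rw [if_pos hroot] at key
  by_contra hc
  rw [if_neg hc] at key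
  omega

/-- A shift of the component equals the levels minus a constant, and the residues say that 3 divides
the constant. It remains to confine the constant to the finite window of the sweep. -/
theorem ExploreInv.affords_iff (hI : IsNet I)
    (h : ExploreInv I U st r tot₀ (edgesOutside I U order tl) seen order level tl tot) (L : ℕ) :
    Affords I (firsts order tl \ U) L ↔
      (∀ u w, edgesOutside I U order tl u w → (level w : ℤ) - level u = shiftStep I u w) ∧
      ∃ K, 3 ∣ K ∧ baseLevel I - 3 * (tl - st) ≤ K ∧ K ≤ baseLevel I + 3 * (tl - st) ∧
        (∀ q ∈ Finset.Ico st tl, order q ∈ _root_.core I → level (order q) = K) ∧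
        ∑ q ∈ Finset.Ico st tl, gap (level (order q)) K ≤ L := by
  have hb : baseLevel I = 3 + (I 0 + (I 0 + I 0)) := rfl
  have htl := h.isQueue.le
  have hst := h.st_lt
  have hmem : ∀ q ∈ Finset.Ico st tl, order q ∈ firsts order tl \ U := fun q hq => by
    rw [h.sdiff_eq]
    exact Finset.mem_image_of_mem _ hq
  have hbound : ∀ q ∈ Finset.Ico st tl, baseLevel I + st ≤ level (order q) + tl + 1 ∧
      level (order q) + st ≤ baseLevel I + tl + 1 := fun q hq =>
    h.bound _ (Finset.mem_sdiff.1 (hmem q hq)).1 (Finset.mem_sdiff.1 (hmem q hq)).2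
  constructor
  · rintro ⟨E, hE, hs⟩
    have hR : ∀ u w, edgesOutside I U order tl u w → E w - E u = shiftStep I u w := by
      rintro u _ ⟨hu, huU, k, hk, rfl⟩
      exact hE.step u (Finset.mem_sdiff.2 ⟨hu, huU⟩) k hk
    have hrig := h.rigid E hR
    refine ⟨?_, ?_⟩
    · rcases h.tot_eq with ⟨-, h2⟩ | ⟨-, h2⟩
      · exact h2
      · exact absurd hR (h2 E)
    · have hroot := h.root
      have hd := hE.dvd r (Finset.mem_sdiff.2 hroot)
      have hlr := h.level_root
      -- The constant is read off at the root; it is divisible by 3 because the base is and the root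
      -- level has the right residue.
      obtain ⟨j, hj⟩ : ∃ j : ℤ, (level r : ℤ) - E r = j := ⟨_, rfl⟩
      have h3 : (3 : ℤ) ∣ j := by omega
      have hEj : ∀ q ∈ Finset.Ico st tl, E (order q) = level (order q) - j := fun q hq => by
        have := hrig _ (Finset.mem_sdiff.1 (hmem q hq)).1 (Finset.mem_sdiff.1 (hmem q hq)).2
        omega
      have hcore : ∀ q ∈ Finset.Ico st tl, order q ∈ _root_.core I → (level (order q) : ℤ) = j :=
        fun q hq hc => by
          have h1 := hE.core _ (hmem q hq) hc
          have h2 := hEj q hq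
          omega
      rw [h.sum_sdiff] at hs
      -- A constant outside the window is moved to the nearer end. All levels lie inside, so no term
      -- of the cost increases. A core vertex would have level j, so there is none in this case.
      by_cases h1 : j < (baseLevel I - 3 * (tl - st) : ℕ)
      · refine ⟨baseLevel I - 3 * (tl - st), by omega, le_rfl, by omega, fun q hq hc => ?_,
          (Finset.sum_le_sum fun q hq => ?_).trans hs⟩
        · have h2 := hcore q hq hc
          have h4 := hbound q hq
          omega
        · have h2 := hEj q hq
          have h4 := hbound q hq
          unfold gap
          omega
      · by_cases h5 : (baseLevel I + 3 * (tl - st) : ℕ) < j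
        · refine ⟨baseLevel I + 3 * (tl - st), by omega, by omega, le_rfl, fun q hq hc => ?_,
            (Finset.sum_le_sum fun q hq => ?_).trans hs⟩
          · have h2 := hcore q hq hc
            have h4 := hbound q hq
            omega
          · have h2 := hEj q hq
            have h4 := hbound q hq
            unfold gap
            omega
        · refine ⟨j.toNat, by omega, by omega, by omega, fun q hq hc => ?_,
            (Finset.sum_le_sum fun q hq => ?_).trans hs⟩
          · have h2 := hcore q hq hc
            omega
          · have h2 := hEj q hq
            unfold gap
            omega
  · rintro ⟨hstep, K, h3, h1, h2, hcore, hs⟩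
    refine ⟨fun v => (level v : ℤ) - K,
      ⟨fun v hv => ?_, fun v hv k hk => ?_, fun v hv hc => ?_⟩, ?_⟩
    · obtain ⟨hv, hvU⟩ := Finset.mem_sdiff.1 hv
      have := h.dvd_level hI hstep hv hvU
      omega
    · obtain ⟨hv, hvU⟩ := Finset.mem_sdiff.1 hv
      have := hstep v _ ⟨hv, hvU, k, hk, rfl⟩
      omega
    · rw [h.sdiff_eq] at hv
      obtain ⟨q, hq, rfl⟩ := Finset.mem_image.1 hv
      have := hcore q hq hc
      omega
    · rw [h.sum_sdiff]
      refine (Finset.sum_le_sum fun q hq => ?_).trans hs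
      unfold gap
      dsimp only
      omega

end Shifts

/-! ### The main program -/

/-- Process the component of the vertex `r`, adding its cost to `tot`. -/
def componentCmd : Cmd :=
  exploreCmd ;; histCmd ;; bestCmd ;; .set .tot (.add (.var .tot) (.var .best)) ;;
  .ite (.inp (.lit 1)) (.var .tot) .reject .skip

/-- Compute the distance of the two colourings in `tot`, replaced by `ℓ + 1` if it exceeds `ℓ`. -/
def distanceCmd : Cmd :=
  .put .table (.lit 1) (.lit 1) ;; .put .table (.lit 4) (.lit 1) ;; countCmd ;; pruneCmd ;;
  .set .hd (.lit 0) ;; .set .tl (.lit 0) ;; .set .tot (.lit 0) ;; .set .r (.lit 0) ;;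
  .loop (.var .r) .order
    (.ite (.arr .seen (.var .r)) (.lit 1) componentCmd .skip ;;
      .set .r (.add (.var .r) (.lit 1)))

section Main

variable {I : ℕ → ℕ} {M : ℕ}

/-- The invariant of the main loop. -/
structure MainInv (I : ℕ → ℕ) (s : Store) : Prop where
  table : ∀ x y, s.arr .table (y + 3 - x) = rise x y
  mark : ∀ v < I 0, s.arr .mark v = 0 ↔ v ∈ core I
  hist : ∀ y, s.arr .hist y = 0
  hd : s.var .hd = s.var .tl
  isQueue : IsQueue (I 0) (s.arr .seen) (s.arr .order) (s.var .tl)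
  closed : IsClosedSet I (firsts (s.arr .order) (s.var .tl))
  tot_le : s.var .tot ≤ I 1 + 1
  affords : ∀ L ≤ I 1, s.var .tot ≤ L ↔ Affords I (firsts (s.arr .order) (s.var .tl)) L

/-- Without an inconsistent edge the costs of the old list and of the new component add; with one
the total is already ℓ + 1 and the component affords nothing. -/
theorem ExploreInv.tot_add_le_iff (hI : IsNet I) {U : Finset ℕ} {st r tot₀ tl tot best : ℕ}
    {seen order level : ℕ → ℕ}
    (h : ExploreInv I U st r tot₀ (edgesOutside I U order tl) seen order level tl tot)
    (hU : IsClosedSet I U) (htot : ∀ L ≤ I 1, tot₀ ≤ L ↔ Affords I U L)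
    (hbest : ∀ L ≤ I 1, best ≤ L ↔ ∃ K, 3 ∣ K ∧ baseLevel I - 3 * (tl - st) ≤ K ∧
      K ≤ baseLevel I + 3 * (tl - st) ∧
      (∀ q ∈ Finset.Ico st tl, order q ∈ core I → level (order q) = K) ∧
      ∑ q ∈ Finset.Ico st tl, gap (level (order q)) K ≤ L) {L : ℕ} (hL : L ≤ I 1) :
    tot + best ≤ L ↔ Affords I (firsts order tl) L := by
  have hcl := h.isClosedSet hU
  have e : U ∪ (firsts order tl \ U) = firsts order tl := Finset.union_sdiff_of_subset h.subset
  rw [← e, affords_union hU (hI.isClosedSet_sdiff hU hcl h.isQueue.lt) Finset.disjoint_sdiff]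
  rcases h.tot_eq with ⟨h1, h2⟩ | ⟨h1, h2⟩
  · constructor
    · intro hs
      refine ⟨tot, best, hs, ?_, ?_⟩
      · rw [← htot _ (by omega)]
        omega
      · rw [h.affords_iff hI]
        exact ⟨h2, (hbest _ (by omega)).1 le_rfl⟩
    · rintro ⟨a, b, hab, ha, hb⟩
      rw [← htot a (by omega)] at ha
      rw [h.affords_iff hI] at hb
      have := (hbest b (by omega)).2 hb.2
      omega
  · constructor
    · intro hs
      omega
    · rintro ⟨a, b, -, -, hb⟩
      rw [h.affords_iff hI] at hb
      -- If the levels satisfied all step equations, they would be a solution E of the kind just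
      -- excluded.
      exact absurd hb.1 (h2 fun u => level u)

theorem componentCmd_wp (hI : IsNet I)
    (hM : I 0 * (6 * I 0 + 6) + 20 * I 0 + 20 + offset I (I 0) + 2 * I 1 ≤ M)
    {Q : Store → Prop} {s : Store} (h : MainInv I s) (hr : s.var .r < I 0)
    (hseen : s.arr .seen (s.var .r) = 0)
    (hQ : ∀ s' : Store, MainInv I s' → s'.var .r = s.var .r →
      firsts (s.arr .order) (s.var .tl) ⊆ firsts (s'.arr .order) (s'.var .tl) →
      s.var .r ∈ firsts (s'.arr .order) (s'.var .tl) →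
      s'.time ≤ s.time + 300 * ∑ v ∈ firsts (s'.arr .order) (s'.var .tl) \
        firsts (s.arr .order) (s.var .tl), ((slots I v).card + 1) → Q s') :
    componentCmd.wp I M Q s := by
  have hb : baseLevel I = 3 + (I 0 + (I 0 + I 0)) := rfl
  have hM1 : I 0 * (6 * I 0 + 6) = I 0 * (6 * I 0) + 6 * I 0 := by ring
  obtain ⟨U, hU⟩ : ∃ U, firsts (s.arr .order) (s.var .tl) = U := ⟨_, rfl⟩
  obtain ⟨st, hst⟩ : ∃ st, s.var .tl = st := ⟨_, rfl⟩
  rw [componentCmd, Cmd.wp_seq]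
  refine exploreCmd_wp hI (by omega) h.table hr hseen h.hd h.isQueue h.closed
    fun s1 fr1 r1 st1 hd1 inv1 t1 => ?_
  rw [hU] at inv1 t1 hQ
  rw [hst] at inv1 st1
  change ExploreInv I U st _ _ (edgesOutside I U (s1.arr .order) (s1.var .tl)) _ _ _ _ _ at inv1
  have hcl := h.closed
  have haff := h.affords
  rw [hU] at hcl haff
  obtain ⟨tl, htl⟩ : ∃ tl, s1.var .tl = tl := ⟨_, rfl⟩
  rw [htl] at inv1 t1 hd1
  have hle := inv1.isQueue.le
  have hlt := inv1.st_lt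
  have hmem : ∀ q ∈ Finset.Ico st tl, s1.arr .order q ∈ firsts (s1.arr .order) tl \ U :=
    fun q hq => by
      rw [inv1.sdiff_eq]
      exact Finset.mem_image_of_mem _ hq
  have hbound : ∀ q ∈ Finset.Ico st tl,
      baseLevel I + st ≤ s1.arr .level (s1.arr .order q) + tl + 1 ∧
      s1.arr .level (s1.arr .order q) + st ≤ baseLevel I + tl + 1 := fun q hq =>
    inv1.bound _ (Finset.mem_sdiff.1 (hmem q hq)).1 (Finset.mem_sdiff.1 (hmem q hq)).2
  have hhist1 : ∀ y, s1.arr .hist y = 0 := by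
    rw [fr1 _ (by simp) (by simp) (by simp)]
    exact h.hist
  have hmark1 : ∀ q ∈ Finset.Ico st tl,
      s1.arr .mark (s1.arr .order q) = 0 ↔ s1.arr .order q ∈ core I := fun q hq => by
    rw [fr1 .mark (by simp) (by simp) (by simp)]
    exact h.mark _ (inv1.isQueue.lt _ (Finset.mem_sdiff.1 (hmem q hq)).1)
  rw [Cmd.wp_seq]
  refine histCmd_wp (s := s1.tick) hlt.le hle (by omega) st1 htl
    (f := fun q => s1.arr .level (s1.arr .order q))
    (fun q => rfl) (fun q hq => by have := hbound q hq; omega) hhist1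
    fun s2 fr2 tl2 hd2 r2 tot2 sz2 k2 hi2 inv2 t2 => ?_
  have hcard : (Finset.Ico st tl).card = tl - st := Nat.card_Ico _ _
  rw [Cmd.wp_seq]
  refine bestCmd_wp (S := Finset.Ico st tl) (n := I 0) (s := s2.tick) (by omega) (by omega)
    (by omega) (by omega)
    (by omega) (fun q hq => by have := hbound q hq; omega) (sz2.trans hcard.symm)
    k2 hi2 inv2.cost_eq inv2.window inv2.hist_eq fun s3 fr3 hist3 v3 best3 opt3 t3 => ?_
  have ord3 : ∀ k, k ≠ .hist → s3.arr k = s1.arr k := fun k hk => by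
    rw [fr3 k hk]
    exact fr2 k hk
  have hopt : ∀ L ≤ I 1, s3.var .best ≤ L ↔ ∃ K, 3 ∣ K ∧ baseLevel I - 3 * (tl - st) ≤ K ∧
      K ≤ baseLevel I + 3 * (tl - st) ∧
      (∀ q ∈ Finset.Ico st tl, s1.arr .order q ∈ core I →
        s1.arr .level (s1.arr .order q) = K) ∧
      ∑ q ∈ Finset.Ico st tl, gap (s1.arr .level (s1.arr .order q)) K ≤ L := by
    intro L hL
    rw [opt3 L hL]
    refine exists_congr fun K => and_congr_right fun _ => and_congr_right fun _ =>
      and_congr_right fun _ => and_congr_left fun _ => forall₂_congr fun q hq => ?_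
    exact imp_congr_left (hmark1 q hq)
  have htot3 : s3.var .tot = s1.var .tot :=
    (v3 .tot (by simp) (by simp) (by simp) (by simp)).trans tot2
  have htl3 : s3.var .tl = tl := (v3 .tl (by simp) (by simp) (by simp) (by simp)).trans tl2
  have hhd3 : s3.var .hd = tl :=
    (v3 .hd (by simp) (by simp) (by simp) (by simp)).trans (hd2.trans hd1)
  have hr3 : s3.var .r = s.var .r :=
    (v3 .r (by simp) (by simp) (by simp) (by simp)).trans (r2.trans r1)
  have htot1 : s1.var .tot ≤ I 1 + 1 := by
    have := h.tot_le
    rcases inv1.tot_eq with ⟨e, -⟩ | ⟨e, -⟩ <;> omega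
  -- Both outcomes of the last test leave a total that agrees with tot + best up to ℓ and is capped
  -- at ℓ + 1; the cap keeps the numbers small over many components.
  have hfinal : ∀ s4 : Store, s4.arr = s3.arr → (∀ i, i ≠ .tot → s4.var i = s3.var i) →
      s4.var .tot ≤ I 1 + 1 → (∀ L ≤ I 1, s4.var .tot ≤ L ↔ s3.var .tot + s3.var .best ≤ L) →
      s4.time ≤ s3.time + 5 → Q s4 := by
    intro s4 a4 v4 tot4 opt4 t4
    have htl4 : s4.var .tl = tl := (v4 .tl (by simp)).trans htl3
    have hord4 : s4.arr .order = s1.arr .order := by rw [a4, ord3 _ (by simp)]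
    refine hQ s4 ⟨?_, ?_, ?_, ?_, ?_, ?_, tot4, ?_⟩ ?_ ?_ ?_ ?_
    · rw [a4, ord3 _ (by simp), fr1 _ (by simp) (by simp) (by simp)]
      exact h.table
    · rw [a4, ord3 _ (by simp), fr1 _ (by simp) (by simp) (by simp)]
      exact h.mark
    · rw [a4]
      exact hist3
    · rw [htl4, v4 _ (by simp), hhd3]
    · rw [htl4, hord4, a4, ord3 _ (by simp)]
      exact inv1.isQueue
    · rw [htl4, hord4]
      exact inv1.isClosedSet hcl
    · intro L hL
      rw [htl4, hord4, opt4 L hL, htot3]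
      exact inv1.tot_add_le_iff hI hcl haff hopt hL
    · rw [v4 _ (by simp), hr3]
    · rw [htl4, hord4]
      exact inv1.subset
    · rw [htl4, hord4]
      exact inv1.root.1
    · rw [htl4, hord4]
      -- The histogram and the sweep cost time proportional to the number of vertices of the
      -- component, which its sum of degrees plus one absorbs.
      have hm : tl - st ≤ ∑ v ∈ firsts (s1.arr .order) tl \ U, ((slots I v).card + 1) := by
        rw [inv1.sum_sdiff fun v => (slots I v).card + 1, ← hcard, Finset.card_eq_sum_ones]
        exact Finset.sum_le_sum fun q _ => Nat.le_add_left _ _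
      simp only [Store.tick] at t2 t3
      omega
  simp only [Cmd.wp_skip, Cmd.wp_set, Cmd.wp_put, Cmd.wp_seq, Cmd.wp_ite, Arith.Small,
    Arith.eval, Arith.eval_order, Arith.eval_srcCol, Arith.eval_tgtCol, Arith.eval_offset,
    Arith.eval_nbr, Arith.small_order, Arith.small_srcCol, Arith.small_tgtCol,
    Arith.small_offset, Arith.small_nbr, Arith.cell, Store.tick, Function.update_self, ne_eq,
    reduceCtorEq, not_false_eq_true, Function.update_of_ne, true_and, Cmd.reject]
  refine ⟨by omega, fun hc => ⟨by omega, hfinal _ rfl (fun i hi => ?_) ?_ (fun L hL => ?_)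
    (by dsimp only; omega)⟩, fun hc => hfinal _ rfl (fun i hi => ?_) ?_ (fun L hL => ?_)
    (by dsimp only; omega)⟩
  · simp only [Cmd.wp_skip, Cmd.wp_set, Cmd.wp_put, Cmd.wp_seq, Cmd.wp_ite, Arith.Small,
    Arith.eval, Arith.eval_order, Arith.eval_srcCol, Arith.eval_tgtCol, Arith.eval_offset,
    Arith.eval_nbr, Arith.small_order, Arith.small_srcCol, Arith.small_tgtCol,
    Arith.small_offset, Arith.small_nbr, Arith.cell, Store.tick, Function.update_self, ne_eq,
    reduceCtorEq, not_false_eq_true, Function.update_of_ne, true_and, hi]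
  · simp only [Cmd.wp_skip, Cmd.wp_set, Cmd.wp_put, Cmd.wp_seq, Cmd.wp_ite, Arith.Small,
    Arith.eval, Arith.eval_order, Arith.eval_srcCol, Arith.eval_tgtCol, Arith.eval_offset,
    Arith.eval_nbr, Arith.small_order, Arith.small_srcCol, Arith.small_tgtCol,
    Arith.small_offset, Arith.small_nbr, Arith.cell, Store.tick, Function.update_self, ne_eq,
    reduceCtorEq, not_false_eq_true, Function.update_of_ne, true_and]
    omega
  · simp only [Cmd.wp_skip, Cmd.wp_set, Cmd.wp_put, Cmd.wp_seq, Cmd.wp_ite, Arith.Small,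
    Arith.eval, Arith.eval_order, Arith.eval_srcCol, Arith.eval_tgtCol, Arith.eval_offset,
    Arith.eval_nbr, Arith.small_order, Arith.small_srcCol, Arith.small_tgtCol,
    Arith.small_offset, Arith.small_nbr, Arith.cell, Store.tick, Function.update_self, ne_eq,
    reduceCtorEq, not_false_eq_true, Function.update_of_ne, true_and]
    omega
  · simp only [Cmd.wp_skip, Cmd.wp_set, Cmd.wp_put, Cmd.wp_seq, Cmd.wp_ite, Arith.Small,
    Arith.eval, Arith.eval_order, Arith.eval_srcCol, Arith.eval_tgtCol, Arith.eval_offset,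
    Arith.eval_nbr, Arith.small_order, Arith.small_srcCol, Arith.small_tgtCol,
    Arith.small_offset, Arith.small_nbr, Arith.cell, Store.tick, Function.update_self, ne_eq,
    reduceCtorEq, not_false_eq_true, Function.update_of_ne, true_and, hi]
  · simp only [Cmd.wp_skip, Cmd.wp_set, Cmd.wp_put, Cmd.wp_seq, Cmd.wp_ite, Arith.Small,
    Arith.eval, Arith.eval_order, Arith.eval_srcCol, Arith.eval_tgtCol, Arith.eval_offset,
    Arith.eval_nbr, Arith.small_order, Arith.small_srcCol, Arith.small_tgtCol,
    Arith.small_offset, Arith.small_nbr, Arith.cell, Store.tick, Function.update_self, ne_eq,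
    reduceCtorEq, not_false_eq_true, Function.update_of_ne, true_and]
    omega
  · simp only [Cmd.wp_skip, Cmd.wp_set, Cmd.wp_put, Cmd.wp_seq, Cmd.wp_ite, Arith.Small,
    Arith.eval, Arith.eval_order, Arith.eval_srcCol, Arith.eval_tgtCol, Arith.eval_offset,
    Arith.eval_nbr, Arith.small_order, Arith.small_srcCol, Arith.small_tgtCol,
    Arith.small_offset, Arith.small_nbr, Arith.cell, Store.tick, Function.update_self, ne_eq,
    reduceCtorEq, not_false_eq_true, Function.update_of_ne, true_and]

theorem distanceCmd_wp (hI : IsNet I)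
    (hM : I 0 * (6 * I 0 + 6) + 20 * I 0 + 20 + offset I (I 0) + 2 * I 1 ≤ M) :
    distanceCmd.wp I M (fun s => s.time ≤ 400 * (I 0 + offset I (I 0) + 1) ∧
      (I 1 < s.var .tot ↔ ¬ Affords I (Finset.range (I 0)) (I 1)))
      ⟨fun _ => 0, fun _ _ => 0, 0⟩ := by
  have hM1 : I 0 * (6 * I 0 + 6) = I 0 * (6 * I 0) + 6 * I 0 := by ring
  simp only [Cmd.wp_skip, Cmd.wp_set, Cmd.wp_put, Cmd.wp_seq, Cmd.wp_ite, Arith.Small,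
    Arith.eval, Arith.eval_order, Arith.eval_srcCol, Arith.eval_tgtCol, Arith.eval_offset,
    Arith.eval_nbr, Arith.small_order, Arith.small_srcCol, Arith.small_tgtCol,
    Arith.small_offset, Arith.small_nbr, Arith.cell, Store.tick, Function.update_self, ne_eq,
    reduceCtorEq, not_false_eq_true, Function.update_of_ne, true_and, distanceCmd]
  refine ⟨by omega, by omega, ?_⟩
  refine countCmd_wp hI (by omega) (fun i => ?_) (fun i => ?_) fun s1 fr1 inv1 => ?_
  · simp only [Cmd.wp_skip, Cmd.wp_set, Cmd.wp_put, Cmd.wp_seq, Cmd.wp_ite, Arith.Small,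
    Arith.eval, Arith.eval_order, Arith.eval_srcCol, Arith.eval_tgtCol, Arith.eval_offset,
    Arith.eval_nbr, Arith.small_order, Arith.small_srcCol, Arith.small_tgtCol,
    Arith.small_offset, Arith.small_nbr, Arith.cell, Store.tick, Function.update_self, ne_eq,
    reduceCtorEq, not_false_eq_true, Function.update_of_ne, true_and]
  · simp only [Cmd.wp_skip, Cmd.wp_set, Cmd.wp_put, Cmd.wp_seq, Cmd.wp_ite, Arith.Small,
    Arith.eval, Arith.eval_order, Arith.eval_srcCol, Arith.eval_tgtCol, Arith.eval_offset,
    Arith.eval_nbr, Arith.small_order, Arith.small_srcCol, Arith.small_tgtCol,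
    Arith.small_offset, Arith.small_nbr, Arith.cell, Store.tick, Function.update_self, ne_eq,
    reduceCtorEq, not_false_eq_true, Function.update_of_ne, true_and]
  have ht1 := inv1.time_le
  refine pruneCmd_wp hI (by omega) ⟨inv1.isQueue, inv1.count_eq, inv1.alive,
    fun u hu => (inv1.notMem_core u hu).2⟩
    fun s2 fr2 mark2 t2 => ?_
  have hfr : ∀ k, k ≠ .count → k ≠ .mark → k ≠ .queue → s2.arr k = _ := fun k k1 k2 k3 =>
    (fr2 k k1 k2 k3).trans (fr1 k k1 k2 k3)
  simp only [Cmd.wp_skip, Cmd.wp_set, Cmd.wp_put, Cmd.wp_seq, Cmd.wp_ite, Arith.Small,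
    Arith.eval, Arith.eval_order, Arith.eval_srcCol, Arith.eval_tgtCol, Arith.eval_offset,
    Arith.eval_nbr, Arith.small_order, Arith.small_srcCol, Arith.small_tgtCol,
    Arith.small_offset, Arith.small_nbr, Arith.cell, Store.tick, Function.update_self, ne_eq,
    reduceCtorEq, not_false_eq_true, Function.update_of_ne, true_and]
  refine ⟨by omega, by omega, by omega, by omega, ?_⟩
  -- The coefficient 33 collects 20 per vertex from counting and 13 from peeling; each component is
  -- charged 300 per vertex and list entry.
  refine Cmd.wp_loop (fun s' => MainInv I s' ∧ s'.var .r ≤ I 0 ∧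
      (∀ v < s'.var .r, v ∈ firsts (s'.arr .order) (s'.var .tl)) ∧
      s'.time ≤ 20 + 33 * (I 0 + offset I (I 0)) + 3 * s'.var .r +
        300 * ∑ v ∈ firsts (s'.arr .order) (s'.var .tl), ((slots I v).card + 1))
    (20 + 33 * (I 0 + offset I (I 0)) + 3 * I 0 + 300 * (offset I (I 0) + I 0)) ?_ ?_ ?_ ?_
  · have hfirsts : ∀ q : ℕ → ℕ, firsts q 0 = ∅ := fun q => by simp [firsts]
    simp only [Cmd.wp_skip, Cmd.wp_set, Cmd.wp_put, Cmd.wp_seq, Cmd.wp_ite, Arith.Small,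
      Arith.eval, Arith.eval_order, Arith.eval_srcCol, Arith.eval_tgtCol, Arith.eval_offset,
      Arith.eval_nbr, Arith.small_order, Arith.small_srcCol, Arith.small_tgtCol,
      Arith.small_offset, Arith.small_nbr, Arith.cell, Store.tick, Function.update_self,
      ne_eq, reduceCtorEq, not_false_eq_true, Function.update_of_ne, true_and, hfirsts]
    refine ⟨⟨?_, ?_, ?_, ?_, ?_, ?_, ?_, ?_⟩, Nat.zero_le _,
      fun v hv => absurd hv (Nat.not_lt_zero _),
      ?_⟩
    any_goals simp only [Cmd.wp_skip, Cmd.wp_set, Cmd.wp_put, Cmd.wp_seq, Cmd.wp_ite,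
      Arith.Small, Arith.eval, Arith.eval_order, Arith.eval_srcCol, Arith.eval_tgtCol,
      Arith.eval_offset, Arith.eval_nbr, Arith.small_order, Arith.small_srcCol,
      Arith.small_tgtCol, Arith.small_offset, Arith.small_nbr, Arith.cell, Store.tick,
      Function.update_self, ne_eq, reduceCtorEq, not_false_eq_true, Function.update_of_ne,
      true_and, hfirsts]
    · intro x y
      rw [hfr _ (by simp) (by simp) (by simp)]
      simp only [Cmd.wp_skip, Cmd.wp_set, Cmd.wp_put, Cmd.wp_seq, Cmd.wp_ite, Arith.Small,
        Arith.eval, Arith.eval_order, Arith.eval_srcCol, Arith.eval_tgtCol,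
        Arith.eval_offset, Arith.eval_nbr, Arith.small_order, Arith.small_srcCol,
        Arith.small_tgtCol, Arith.small_offset, Arith.small_nbr, Arith.cell, Store.tick,
        Function.update_self, ne_eq, reduceCtorEq, not_false_eq_true, Function.update_of_ne,
        true_and, Function.update_apply, rise]
      split_ifs <;> simp_all
    · exact mark2
    · intro y
      rw [hfr _ (by simp) (by simp) (by simp)]
      simp only [Cmd.wp_skip, Cmd.wp_set, Cmd.wp_put, Cmd.wp_seq, Cmd.wp_ite, Arith.Small,
        Arith.eval, Arith.eval_order, Arith.eval_srcCol, Arith.eval_tgtCol,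
        Arith.eval_offset, Arith.eval_nbr, Arith.small_order, Arith.small_srcCol,
        Arith.small_tgtCol, Arith.small_offset, Arith.small_nbr, Arith.cell, Store.tick,
        Function.update_self, ne_eq, reduceCtorEq, not_false_eq_true, Function.update_of_ne,
        true_and]
    · refine ⟨by rw [hfirsts]; rfl, fun u hu => ?_, fun u => ?_⟩
      · rw [hfirsts] at hu
        exact absurd hu (Finset.notMem_empty u)
      · rw [hfirsts, hfr _ (by simp) (by simp) (by simp)]
        simp only [Cmd.wp_skip, Cmd.wp_set, Cmd.wp_put, Cmd.wp_seq, Cmd.wp_ite,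
          Arith.Small, Arith.eval, Arith.eval_order, Arith.eval_srcCol, Arith.eval_tgtCol,
          Arith.eval_offset, Arith.eval_nbr, Arith.small_order, Arith.small_srcCol,
          Arith.small_tgtCol, Arith.small_offset, Arith.small_nbr, Arith.cell, Store.tick,
          Function.update_self, ne_eq, reduceCtorEq, not_false_eq_true,
          Function.update_of_ne, true_and, Finset.notMem_empty, if_false]
    · exact fun u hu => absurd hu (Finset.notMem_empty u)
    · exact Nat.zero_le _
    · exact fun L hL => ⟨fun _ => ⟨0, ⟨by simp, by simp, by simp⟩, by simp⟩, fun _ => Nat.zero_le _⟩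
    · simp only [Store.tick] at t2 ht1
      rw [Finset.sum_empty]
      omega
  · rintro s3 ⟨inv3, hr, -, ht⟩
    have := hI.sum_card_slots_le inv3.isQueue.lt
    omega
  · rintro s3 ⟨inv3, hr, hv, ht⟩ hlt
    simp only [Cmd.wp_skip, Cmd.wp_set, Cmd.wp_put, Cmd.wp_seq, Cmd.wp_ite, Arith.Small,
      Arith.eval, Arith.eval_order, Arith.eval_srcCol, Arith.eval_tgtCol, Arith.eval_offset,
      Arith.eval_nbr, Arith.small_order, Arith.small_srcCol, Arith.small_tgtCol,
      Arith.small_offset, Arith.small_nbr, Arith.cell, Store.tick, Function.update_self,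
      ne_eq, reduceCtorEq, not_false_eq_true, Function.update_of_ne, true_and] at hlt
    obtain ⟨r, hr'⟩ : ∃ r, s3.var .r = r := ⟨_, rfl⟩
    rw [hr'] at hr hv ht hlt
    simp only [Cmd.wp_skip, Cmd.wp_set, Cmd.wp_put, Cmd.wp_seq, Cmd.wp_ite, Arith.Small,
      Arith.eval, Arith.eval_order, Arith.eval_srcCol, Arith.eval_tgtCol, Arith.eval_offset,
      Arith.eval_nbr, Arith.small_order, Arith.small_srcCol, Arith.small_tgtCol,
      Arith.small_offset, Arith.small_nbr, Arith.cell, Store.tick, Function.update_self,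
      ne_eq, reduceCtorEq, not_false_eq_true, Function.update_of_ne, true_and, hr']
    refine ⟨fun hs => ?_, fun hs => ?_⟩
    · refine componentCmd_wp (s := s3.tick.tick) hI hM
        ⟨inv3.1, inv3.2, inv3.3, inv3.4, inv3.5, inv3.6, inv3.7, inv3.8⟩
        (by rw [← hr'] at hlt; exact hlt) (by rw [← hr'] at hs; exact Nat.lt_one_iff.1 hs)
        fun s4 inv4 r4 sub4 mem4 t4 => ?_
      have e4 : s4.var .r = r := r4.trans hr'
      have hsum := Finset.sum_sdiff (f := fun v => (slots I v).card + 1) sub4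
      simp only [Store.tick] at t4 mem4 hsum sub4
      rw [hr'] at mem4
      simp only [Cmd.wp_skip, Cmd.wp_set, Cmd.wp_put, Cmd.wp_seq, Cmd.wp_ite, Arith.Small,
        Arith.eval, Arith.eval_order, Arith.eval_srcCol, Arith.eval_tgtCol,
        Arith.eval_offset, Arith.eval_nbr, Arith.small_order, Arith.small_srcCol,
        Arith.small_tgtCol, Arith.small_offset, Arith.small_nbr, Arith.cell, Store.tick,
        Function.update_self, ne_eq, reduceCtorEq, not_false_eq_true, Function.update_of_ne,
        true_and, e4]
      refine ⟨by omega, ⟨?_, ?_, ?_, ?_, ?_, ?_, ?_, ?_⟩, by omega, fun v hvr => ?_, by omega⟩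
      any_goals simp only [Cmd.wp_skip, Cmd.wp_set, Cmd.wp_put, Cmd.wp_seq, Cmd.wp_ite,
        Arith.Small, Arith.eval, Arith.eval_order, Arith.eval_srcCol, Arith.eval_tgtCol,
        Arith.eval_offset, Arith.eval_nbr, Arith.small_order, Arith.small_srcCol,
        Arith.small_tgtCol, Arith.small_offset, Arith.small_nbr, Arith.cell, Store.tick,
        Function.update_self, ne_eq, reduceCtorEq, not_false_eq_true, Function.update_of_ne,
        true_and]
      · exact inv4.table
      · exact inv4.mark
      · exact inv4.hist
      · exact inv4.hd
      · exact inv4.isQueue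
      · exact inv4.closed
      · exact inv4.tot_le
      · exact inv4.affords
      · rcases Nat.lt_succ_iff_lt_or_eq.1 hvr with hvr | rfl
        · exact sub4 (hv v hvr)
        · exact mem4
    · refine ⟨by omega, ⟨?_, ?_, ?_, ?_, ?_, ?_, ?_, ?_⟩, by omega, fun v hvr => ?_, by omega⟩
      any_goals simp only [Cmd.wp_skip, Cmd.wp_set, Cmd.wp_put, Cmd.wp_seq, Cmd.wp_ite,
        Arith.Small, Arith.eval, Arith.eval_order, Arith.eval_srcCol, Arith.eval_tgtCol,
        Arith.eval_offset, Arith.eval_nbr, Arith.small_order, Arith.small_srcCol,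
        Arith.small_tgtCol, Arith.small_offset, Arith.small_nbr, Arith.cell, Store.tick,
        Function.update_self, ne_eq, reduceCtorEq, not_false_eq_true, Function.update_of_ne,
        true_and]
      · exact inv3.table
      · exact inv3.mark
      · exact inv3.hist
      · exact inv3.hd
      · exact inv3.isQueue
      · exact inv3.closed
      · exact inv3.tot_le
      · exact inv3.affords
      · rcases Nat.lt_succ_iff_lt_or_eq.1 hvr with hvr | rfl
        · exact hv v hvr
        · rw [inv3.isQueue.mem_iff]
          omega
  · rintro s3 ⟨inv3, hr, hv, ht⟩ hlt
    simp only [Cmd.wp_skip, Cmd.wp_set, Cmd.wp_put, Cmd.wp_seq, Cmd.wp_ite, Arith.Small,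
      Arith.eval, Arith.eval_order, Arith.eval_srcCol, Arith.eval_tgtCol, Arith.eval_offset,
      Arith.eval_nbr, Arith.small_order, Arith.small_srcCol, Arith.small_tgtCol,
      Arith.small_offset, Arith.small_nbr, Arith.cell, Store.tick, Function.update_self,
      ne_eq, reduceCtorEq, not_false_eq_true, Function.update_of_ne, true_and] at hlt
    have hsum := hI.sum_card_slots_le inv3.isQueue.lt
    have hall : firsts (s3.arr .order) (s3.var .tl) = Finset.range (I 0) := by
      ext v
      rw [Finset.mem_range]
      exact ⟨inv3.isQueue.lt v, fun h => hv v (by omega)⟩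
    have := inv3.affords (I 1) le_rfl
    rw [hall] at this
    simp only [Store.tick]
    refine ⟨by omega, ?_⟩
    rw [← this, not_le]

end Main

/-! ### Reading encoded instances -/

theorem List.getD_append_add {γ : Type*} (l l' : List γ) (k : ℕ) (d : γ) :
    (l ++ l').getD (l.length + k) d = l'.getD k d := by
  rw [List.getD_append_right _ _ _ _ (Nat.le_add_right _ _), Nat.add_sub_cancel_left]

section Encoding

variable {n : ℕ} {G : SimpleGraph (Fin n)} (A : AdjLists G) (α β : G.Coloring (Fin 3)) (ℓ : ℕ)

theorem AdjLists.offset_succ (v : Fin n) :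
    A.offset (v + 1) = A.offset v + (A.nbrs v).length := by
  unfold AdjLists.offset
  have : (Finset.univ.filter fun u : Fin n => u.val < v + 1) =
      insert v (Finset.univ.filter fun u : Fin n => u.val < v) := by
    ext u
    simp only [Finset.mem_filter, Finset.mem_univ, true_and, Finset.mem_insert, Fin.ext_iff]
    omega
  rw [this, Finset.sum_insert (by simp), add_comm]

theorem AdjLists.offset_mono {i j : ℕ} (h : i ≤ j) : A.offset i ≤ A.offset j := by
  unfold AdjLists.offset
  refine Finset.sum_le_sum_of_subset fun u hu => ?_
  simp only [Finset.mem_filter, Finset.mem_univ, true_and] at hu ⊢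
  omega

theorem AdjLists.length_flatMap_take {i : ℕ} (hi : i ≤ n) :
    (((List.finRange n).take i).flatMap fun v => (A.nbrs v).map Fin.val).length = A.offset i := by
  induction i with
  | zero => simp [AdjLists.offset]
  | succ i ih =>
    have h : i < (List.finRange n).length := by simpa using hi
    have := A.offset_succ ⟨i, hi⟩
    rw [← List.take_concat_get' _ _ h, List.flatMap_append, List.length_append, ih (by omega)]
    simp only [List.getElem_finRange, List.flatMap_singleton, List.length_map]
    exact this.symm

/-- The number of entries of the adjacency lists is twice the number of edges. -/
theorem AdjLists.offset_card : A.offset n = 2 * G.edgeSet.ncard := by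
  classical
  have h : ∀ v, (A.nbrs v).length = G.degree v := fun v => by
    rw [← List.toFinset_card_of_nodup (A.nodup v), ← SimpleGraph.card_neighborFinset_eq_degree]
    congr 1
    ext w
    simp [A.mem_nbrs]
  unfold AdjLists.offset
  rw [Finset.filter_true_of_mem fun v _ => v.isLt, Finset.sum_congr rfl fun v _ => h v,
    SimpleGraph.sum_degrees_eq_twice_card_edges, ← SimpleGraph.coe_edgeFinset,
    Set.ncard_coe_finset]

/-- The contents of the memory at the start. -/
def instanceMemory (a : ℕ) : ℕ := (encodeInstance A α β ℓ).getD a 0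

theorem length_encodeInstance : (encodeInstance A α β ℓ).length = 3 * n + 3 + A.offset n := by
  have := A.length_flatMap_take le_rfl
  rw [List.take_of_length_le (by simp)] at this
  simp only [encodeInstance, List.length_append, this]
  simp
  omega

theorem instanceMemory_eq_zero {a : ℕ} (h : 3 * n + 3 + A.offset n ≤ a) :
    instanceMemory A α β ℓ a = 0 :=
  List.getD_eq_default _ _ (by rwa [length_encodeInstance])

theorem instanceMemory_zero : instanceMemory A α β ℓ 0 = n := by
  simp [instanceMemory, encodeInstance]

theorem instanceMemory_one : instanceMemory A α β ℓ 1 = ℓ := by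
  simp [instanceMemory, encodeInstance]

theorem srcCol_instanceMemory (v : Fin n) : srcCol (instanceMemory A α β ℓ) v = α v := by
  unfold srcCol instanceMemory encodeInstance
  simp only [List.append_assoc]
  have e : 2 + (v : ℕ) = [n, ℓ].length + v := rfl
  rw [e, List.getD_append_add, List.getD_append _ _ _ _ (by simp)]
  simp [List.getD_eq_getElem]

theorem tgtCol_instanceMemory (v : Fin n) : tgtCol (instanceMemory A α β ℓ) v = β v := by
  rw [tgtCol, instanceMemory_zero]
  unfold instanceMemory encodeInstance
  simp only [List.append_assoc]
  have e : 2 + n + (v : ℕ) = [n, ℓ].length + (((List.finRange n).map fun v => (α v).val).length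
    + v) := by simp; omega
  rw [e, List.getD_append_add, List.getD_append_add, List.getD_append _ _ _ _ (by simp)]
  simp [List.getD_eq_getElem]

theorem offset_instanceMemory {i : ℕ} (hi : i ≤ n) :
    offset (instanceMemory A α β ℓ) i = A.offset i := by
  rw [offset, instanceMemory_zero]
  unfold instanceMemory encodeInstance
  simp only [List.append_assoc]
  have e : 2 + (n + n) + i = [n, ℓ].length + (((List.finRange n).map fun v => (α v).val).length
    + (((List.finRange n).map fun v => (β v).val).length + i)) := by simp; omega
  rw [e, List.getD_append_add, List.getD_append_add, List.getD_append_add,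
    List.getD_append _ _ _ _ (by simp; omega)]
  simp [List.getD_eq_getElem, Nat.lt_succ_iff.2 hi]

/-- Four blocks precede the lists, and the lists of the vertices before v have total length the
offset of v; dropping all these leaves the list of v in front. -/
theorem nbr_instanceMemory (v : Fin n) {k : ℕ} (hk : k < (A.nbrs v).length) :
    nbr (instanceMemory A α β ℓ) (A.offset v + k) = (A.nbrs v)[k] := by
  rw [nbr, instanceMemory_zero]
  unfold instanceMemory encodeInstance
  simp only [List.append_assoc]
  have e : 3 + (n + (n + n)) + (A.offset v + k) = [n, ℓ].length +
    (((List.finRange n).map fun v => (α v).val).length +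
    (((List.finRange n).map fun v => (β v).val).length +
    (((List.range (n + 1)).map A.offset).length + (A.offset v + k)))) := by simp; omega
  have hv : (v : ℕ) < (List.finRange n).length := by simp
  rw [e, List.getD_append_add, List.getD_append_add, List.getD_append_add, List.getD_append_add,
    ← List.take_append_drop v (List.finRange n), List.flatMap_append,
    ← A.length_flatMap_take v.isLt.le, List.getD_append_add, List.drop_eq_getElem_cons hv,
    List.flatMap_cons, List.getD_append _ _ _ _ (by simpa using hk)]
  simp [List.getD_eq_getElem, hk]

theorem mem_slots_instanceMemory (v : Fin n) (j : ℕ) :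
    j ∈ slots (instanceMemory A α β ℓ) v ↔ ∃ k < (A.nbrs v).length, j = A.offset v + k := by
  rw [slots, offset_instanceMemory _ _ _ _ v.isLt.le, offset_instanceMemory _ _ _ _ v.isLt,
    A.offset_succ, Finset.mem_Ico]
  constructor
  · rintro ⟨h1, h2⟩
    exact ⟨j - A.offset v, by omega, by omega⟩
  · rintro ⟨k, hk, rfl⟩
    omega

theorem adj_of_mem_slots {v : Fin n} {j : ℕ} (hj : j ∈ slots (instanceMemory A α β ℓ) v) :
    ∃ w, G.Adj v w ∧ nbr (instanceMemory A α β ℓ) j = w := by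
  obtain ⟨k, hk, rfl⟩ := (mem_slots_instanceMemory A α β ℓ v j).1 hj
  exact ⟨_, (A.mem_nbrs v _).1 (List.getElem_mem hk), nbr_instanceMemory A α β ℓ v hk⟩

theorem exists_mem_slots_of_adj {v w : Fin n} (h : G.Adj v w) :
    ∃ j ∈ slots (instanceMemory A α β ℓ) v, nbr (instanceMemory A α β ℓ) j = w := by
  obtain ⟨k, hk, rfl⟩ := List.getElem_of_mem ((A.mem_nbrs v w).2 h)
  exact ⟨_, (mem_slots_instanceMemory A α β ℓ v _).2 ⟨k, hk, rfl⟩, nbr_instanceMemory A α β ℓ v hk⟩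

theorem isNet_instanceMemory : IsNet (instanceMemory A α β ℓ) := by
  have h0 := instanceMemory_zero A α β ℓ
  refine ⟨?_, fun v hv => ?_, fun v hv j hj => ?_, fun v hv i hi j hj hij => ?_,
    fun v hv j hj => ?_,
    fun v hv => ?_, fun v hv => ?_, fun v hv j hj => ?_, fun v hv j hj => ?_⟩
  · rw [offset_instanceMemory _ _ _ _ (Nat.zero_le _)]
    simp [AdjLists.offset]
  all_goals
    rw [h0] at hv
    obtain ⟨v, rfl⟩ : ∃ u : Fin n, (u : ℕ) = v := ⟨⟨v, hv⟩, rfl⟩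
  · rw [offset_instanceMemory _ _ _ _ v.isLt.le, offset_instanceMemory _ _ _ _ v.isLt]
    exact A.offset_mono (Nat.le_succ _)
  · obtain ⟨w, -, h⟩ := adj_of_mem_slots A α β ℓ hj
    rw [h, h0]
    exact w.isLt
  · obtain ⟨k, hk, rfl⟩ := (mem_slots_instanceMemory A α β ℓ v i).1 hi
    obtain ⟨l, hl, rfl⟩ := (mem_slots_instanceMemory A α β ℓ v j).1 hj
    rw [nbr_instanceMemory _ _ _ _ v hk, nbr_instanceMemory _ _ _ _ v hl] at hij
    rw [(A.nodup v).getElem_inj_iff.1 (Fin.ext hij)]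
  · obtain ⟨w, hw, h⟩ := adj_of_mem_slots A α β ℓ hj
    rw [h]
    exact exists_mem_slots_of_adj A α β ℓ hw.symm
  · rw [srcCol_instanceMemory]
    exact (α v).isLt
  · rw [tgtCol_instanceMemory]
    exact (β v).isLt
  · obtain ⟨w, hw, h⟩ := adj_of_mem_slots A α β ℓ hj
    rw [h, srcCol_instanceMemory, srcCol_instanceMemory]
    exact fun hc => α.valid hw (Fin.ext hc.symm)
  · obtain ⟨w, hw, h⟩ := adj_of_mem_slots A α β ℓ hj
    rw [h, tgtCol_instanceMemory, tgtCol_instanceMemory]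
    exact fun hc => β.valid hw (Fin.ext hc.symm)

/-- Core sets and frozen sets correspond under the inclusion of `Fin n` in ℕ. -/
theorem mem_core_instanceMemory (v : Fin n) :
    (v : ℕ) ∈ core (instanceMemory A α β ℓ) ↔ v ∈ frozenVertices α := by
  have h0 := instanceMemory_zero A α β ℓ
  constructor
  · rintro ⟨K, hK, hv⟩
    refine ⟨{u | (u : ℕ) ∈ K}, fun u hu i hi => ?_, hv⟩
    obtain ⟨-, h⟩ := hK u hu
    rw [srcCol_instanceMemory] at h
    obtain ⟨j, hj, hjK, hji⟩ := h i i.isLt fun hc => hi (Fin.ext hc)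
    obtain ⟨w, hw, e⟩ := adj_of_mem_slots A α β ℓ hj
    rw [e] at hjK hji
    rw [srcCol_instanceMemory] at hji
    exact ⟨w, hjK, hw, Fin.ext hji⟩
  · rintro ⟨K, hK, hv⟩
    refine ⟨Fin.val '' K, ?_, v, hv, rfl⟩
    rintro _ ⟨u, hu, rfl⟩
    refine ⟨by rw [h0]; exact u.isLt, fun c hc hne => ?_⟩
    rw [srcCol_instanceMemory] at hne
    obtain ⟨w, hwK, hw, hwc⟩ := hK u hu ⟨c, hc⟩ fun h => hne (congrArg Fin.val h)
    obtain ⟨j, hj, e⟩ := exists_mem_slots_of_adj A α β ℓ hw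
    refine ⟨j, hj, ?_, ?_⟩
    · rw [e]
      exact ⟨w, hwK, rfl⟩
    · rw [e, srcCol_instanceMemory, hwc]

theorem edgeWeight_eq_rise (c : G.Coloring (Fin 3)) (u v : Fin n) :
    edgeWeight c u v = 2 * (rise (c u) (c v) : ℤ) - 1 := by
  have : ∀ x y : Fin 3, (if y - x = 1 then 1 else -1 : ℤ) = 2 * (rise x y : ℤ) - 1 := by
    unfold rise
    decide
  exact this _ _

theorem affords_instanceMemory (L : ℕ) :
    Affords (instanceMemory A α β ℓ) (Finset.range n) L ↔
      ∃ E, IsShift α β E ∧ (∀ x ∈ frozenVertices α, E x = 0) ∧ ∑ v, |E v| ≤ L := by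
  constructor
  · rintro ⟨E, hE, hs⟩
    refine ⟨fun v => E v, ⟨fun v => ?_, fun v w hvw => ?_⟩, fun v hv => ?_, ?_⟩
    · have := hE.dvd v (Finset.mem_range.2 v.isLt)
      rwa [srcCol_instanceMemory, tgtCol_instanceMemory] at this
    · obtain ⟨j, hj, e⟩ := exists_mem_slots_of_adj A α β ℓ hvw
      have := hE.step v (Finset.mem_range.2 v.isLt) j hj
      rw [e, shiftStep, srcCol_instanceMemory, tgtCol_instanceMemory, srcCol_instanceMemory,
        tgtCol_instanceMemory] at this
      rw [edgeWeight_eq_rise, edgeWeight_eq_rise]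
      dsimp only
      omega
    · exact hE.core v (Finset.mem_range.2 v.isLt) ((mem_core_instanceMemory A α β ℓ v).2 hv)
    · rw [Finset.sum_range] at hs
      zify at hs
      exact hs
  · rintro ⟨E, hE, hf, hs⟩
    -- Extension by zero to all of ℕ; values outside the vertex set play no role.
    obtain ⟨F, hF⟩ : ∃ F : ℕ → ℤ, ∀ v : Fin n, F v = E v :=
      ⟨fun v => if h : v < n then E ⟨v, h⟩ else 0, fun v => dif_pos v.isLt⟩
    refine ⟨F, ⟨fun v hv => ?_, fun v hv j hj => ?_, fun v hv hc => ?_⟩, ?_⟩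
    any_goals
      rw [Finset.mem_range] at hv
      obtain ⟨v, rfl⟩ : ∃ u : Fin n, (u : ℕ) = v := ⟨⟨v, hv⟩, rfl⟩
    · rw [srcCol_instanceMemory, tgtCol_instanceMemory, hF]
      exact hE.1 v
    · obtain ⟨w, hw, e⟩ := adj_of_mem_slots A α β ℓ hj
      have := hE.2 v w hw
      rw [edgeWeight_eq_rise, edgeWeight_eq_rise] at this
      rw [e, shiftStep, srcCol_instanceMemory, tgtCol_instanceMemory, srcCol_instanceMemory,
        tgtCol_instanceMemory, hF, hF]
      omega
    · rw [hF]
      exact hf v ((mem_core_instanceMemory A α β ℓ v).1 hc)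
    · rw [Finset.sum_range]
      zify
      simpa only [hF] using hs

theorem instanceMemory_le (a : ℕ) : instanceMemory A α β ℓ a ≤ n + ℓ + A.offset n + 2 := by
  have h : ∀ x ∈ encodeInstance A α β ℓ, x ≤ n + ℓ + A.offset n + 2 := by
    intro x hx
    simp only [encodeInstance, List.mem_append, List.mem_cons, List.not_mem_nil, or_false,
      List.mem_map, List.mem_flatMap, List.mem_range, List.mem_finRange, true_and] at hx
    rcases hx with ((((rfl | rfl) | ⟨v, rfl⟩) | ⟨v, rfl⟩) | ⟨i, hi, rfl⟩) | ⟨v, w, -, rfl⟩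
    · omega
    · omega
    · have := (α v).isLt
      omega
    · have := (β v).isLt
      omega
    · have := A.offset_mono (Nat.lt_succ_iff.1 hi)
      omega
    · have := w.isLt
      omega
  unfold instanceMemory
  by_cases ha : a < (encodeInstance A α β ℓ).length
  · rw [List.getD_eq_getElem _ _ ha]
    exact h _ (List.getElem_mem ha)
  · rw [List.getD_eq_default _ _ (not_lt.1 ha)]
    exact Nat.zero_le _

end Encoding

/-! ### Assembly of the theorem -/

/-- The number of steps and the size of the numbers in solving instances of
3-Colouring Reconfiguration. -/
theorem exists_program : ∃ (P : Program) (C : ℕ), ∀ (n : ℕ) (G : SimpleGraph (Fin n))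
    (A : AdjLists G) (α β : G.Coloring (Fin 3)) (ℓ : ℕ),
      (∃ t ≤ C * (n + G.edgeSet.ncard + 1), ∃ b : Bool,
        P.HaltsWith (encodeInstance A α β ℓ) t b ∧ (b = true ↔ IsYesInstance G α β ℓ)) ∧
      P.WordsBounded (encodeInstance A α β ℓ) (C * ((n + G.edgeSet.ncard + 1) ^ 2 + ℓ)) := by
  obtain ⟨c, hc⟩ : ∃ c, distanceCmd = c := ⟨_, rfl⟩
  obtain ⟨x, hx⟩ : ∃ x, Arith.inp (.lit 1) = x := ⟨_, rfl⟩
  obtain ⟨y, hy⟩ : ∃ y, Arith.var .tot = y := ⟨_, rfl⟩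
  obtain ⟨S, hS⟩ : ∃ S, c.size + x.size + y.size = S := ⟨_, rfl⟩
  obtain ⟨K, hK⟩ : ∃ K, c.len + (testCode x y).length + 20 = K := ⟨_, rfl⟩
  -- The term 801 K covers the time: K steps for each of at most 400 (n + 2 m + 1) ticks and one
  -- more. The term 488 S = 8 · 61 S covers the addresses of array entries, and 17 the length of the
  -- input and small constants.
  refine ⟨c.machine x y, 801 * K + 488 * S + 17, fun n G A α β ℓ => ?_⟩
  have h0 := instanceMemory_zero A α β ℓ
  have h1 := instanceMemory_one A α β ℓ
  have hoff : offset (instanceMemory A α β ℓ) n = 2 * G.edgeSet.ncard := by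
    rw [offset_instanceMemory _ _ _ _ le_rfl, A.offset_card]
  obtain ⟨m, hm⟩ : ∃ m, G.edgeSet.ncard = m := ⟨_, rfl⟩
  obtain ⟨N, hN⟩ : ∃ N, n + m + 1 = N := ⟨_, rfl⟩
  obtain ⟨q, hq⟩ : ∃ q, N ^ 2 = q := ⟨_, rfl⟩
  have hq1 : N ≤ q := by
    rw [← hq]
    exact Nat.le_self_pow (by omega) N
  have hn2 : n * (6 * n + 6) ≤ 6 * q + 6 * N := by
    subst hq hN
    nlinarith
  have hoffm := A.offset_card
  rw [hm] at hoff hoffm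
  have hW : 3 * n + 3 + 2 * m = 3 * instanceMemory A α β ℓ 0 + 3 +
      instanceMemory A α β ℓ (3 * instanceMemory A α β ℓ 0 + 2) := by
    rw [offset, h0, show 2 + (n + n) + n = 3 * n + 2 by ring] at hoff
    rw [h0, hoff]
  -- The quadratic part bounds the costs of components, and 2 ℓ leaves room for adding a component
  -- cost to a capped total.
  have hwp := distanceCmd_wp (M := 60 * q + 2 * ℓ) (isNet_instanceMemory A α β ℓ) (by
    rw [h0, h1, hoff]
    omega)
  rw [h0, h1, hoff, hc] at hwp
  have spec := Cmd.machine_spec c x y (input := encodeInstance A α β ℓ)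
    (I := instanceMemory A α β ℓ) (M := 60 * q + 2 * ℓ) (W := 3 * n + 3 + 2 * m)
    (T := 400 * (n + 2 * m + 1)) (ans := IsYesInstance G α β ℓ)
    (B := (801 * K + 488 * S + 17) * (q + ℓ)) (fun a => rfl)
    (fun a ha => instanceMemory_eq_zero A α β ℓ (by omega)) hW (fun a => by
      have := instanceMemory_le A α β ℓ a
      omega) (by
      rw [hS]
      have e1 : S * (60 * q + 2 * ℓ + 1) ≤ S * (61 * (q + ℓ)) :=
        Nat.mul_le_mul_left _ (by omega)
      have e2 : (801 * K + 488 * S + 17) * (q + ℓ) =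
        801 * K * (q + ℓ) + 8 * (S * (61 * (q + ℓ))) + 17 * (q + ℓ) := by ring
      omega) (by
      refine c.wp_mono (fun s hs => ⟨hs.1, ?_⟩) _ hwp
      rw [isYesInstance_iff, ← affords_instanceMemory A α β ℓ, ← hs.2, ← hx, ← hy]
      simp only [Arith.eval, h1])
  rw [hm, hN, hq]
  refine ⟨?_, spec.2⟩
  obtain ⟨t, ht, hb⟩ := spec.1
  refine ⟨t, ht.trans ?_, hb⟩
  rw [hK]
  have e1 : K * (400 * (n + 2 * m + 1) + 1) ≤ K * (801 * N) := Nat.mul_le_mul_left _ (by omega)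
  have e2 : (801 * K + 488 * S + 17) * N = K * (801 * N) + (488 * S + 17) * N := by ring
  omega

theorem theorem1 :
    -- the decision problem is solved by a random access machine in time `O(n + m)`
    (∃ (P : Program) (C : ℕ), ∀ (n : ℕ) (G : SimpleGraph (Fin n)) (A : AdjLists G)
      (α β : G.Coloring (Fin 3)) (ℓ : ℕ), 0 < ℓ →
        (∃ t ≤ C * (n + G.edgeSet.ncard + 1), ∃ b : Bool,
          P.HaltsWith (encodeInstance A α β ℓ) t b ∧ (b = true ↔ IsYesInstance G α β ℓ)) ∧
        P.WordsBounded (encodeInstance A α β ℓ)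
          (C * ((n + G.edgeSet.ncard + 1) ^ 2 + ℓ))) ∧
    -- reachability and distance in `R_3(G)` for connected `G`
    (∀ (V : Type*) [Fintype V] (G : SimpleGraph V), G.Connected →
      ∀ (T : SimpleGraph V) (hT : T.IsTree), T ≤ G → ∀ α β : G.Coloring (Fin 3),
        (∀ u : V, (reconfGraph G 3).Reachable α β ↔
          (∀ i : Fin 3, fixedVerticesOfColour α i = fixedVerticesOfColour β i) ∧
          (∀ v w : V, G.Adj v w →
            relHeight hT α u β v - relHeight hT α u β w + edgeWeight β v w
              = edgeWeight α v w) ∧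
          (∀ x ∈ fixedVertices β, ∀ y ∈ fixedVertices β,
            relHeight hT α u β x = relHeight hT α u β y)) ∧
        (∀ x : V, IsFocal hT α β x → (reconfGraph G 3).Reachable α β →
          ∀ k₁ k₂ : ℤ, IsLeast {k ∈ targetHeights α β x | 0 ≤ k} k₁ →
            IsGreatest {k ∈ targetHeights α β x | k ≤ 0} k₂ →
            ((reconfGraph G 3).dist α β : ℚ)
              = 1 / 2 * min (heightSum hT α β x k₁ : ℚ) (heightSum hT α β x k₂ : ℚ))) := by
  refine ⟨?_, fun V _ G _ T hT hTG α β =>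
    ⟨reachable_iff hTG hT α β, fun x hx h k₁ k₂ hk₁ hk₂ => ?_⟩⟩
  · obtain ⟨P, C, h⟩ := exists_program
    exact ⟨P, C, fun n G A α β ℓ _ => h n G A α β ℓ⟩
  · have h2 : (2 : ℚ) * ((reconfGraph G 3).dist α β : ℚ) =
        min (heightSum hT α β x k₁ : ℚ) (heightSum hT α β x k₂ : ℚ) := by
      exact_mod_cast dist_eq hTG hT hx h hk₁ hk₂
    rw [← h2]
    ring
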